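/- Setting. Let $d\ge 1$, $\mathcal X\subseteq\mathbb R^d$, let $\mu$ be a probability measure on $\mathcal X$ and $\sigma>0$. Norms and inner products of functions are those of $L^2(\mathcal X,\mu)$. For $f_0\in L^2(\mathcal X,\mu)$ let $\mathrm P_0$ denote the law of the data $(\boldsymbol x,\boldsymbol y)\in\mathcal X^n\times\mathbb R^n$, where $x_1,\dots,x_n$ are i.i.d. $\mu$ and $y_i=f_0(x_i)+\varepsilon_i$ with i.i.d. errors $\varepsilon_i\sim\mathcal N(0,\sigma^2)$ independent of the design. Let the kernel $k$ have the pointwise Mercer decomposition $$k(x,y)=\sum_{j\ge1}\lambda_j\varphi_j(x)\varphi_j(y),\qquad x,y\in\mathcal X,$$ where $(\lambda_j)$ is decreasing, nonnegative and summable, and $(\varphi_j)_{j\ge1}$ is an orthonormal basis of $L^2(\mathcal X,\mu)$. For $\beta>0$ put $\|f\|_\beta^2=\sum_{j\ge1} j^{2\beta/d}\langle f,\varphi_j\rangle^2$ and $\mathcal S^\beta=\{f\in L^2(\mathcal X,\mu):\|f\|_\beta<\infty\}$. Let the prior $\Pi$ on the regression function $f$ be the centered Gaussian process (in a jointly measurable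 version, on a standard Borel probability space) with covariance kernel $k$, and let $\Pi(\cdot\mid\boldsymbol x,\boldsymbol y)$ be the posterior. For $m=m_n$ put $\boldsymbol u=(\langle f,\varphi_1\rangle,\dots,\langle f,\varphi_m\rangle)$ (population spectral inducing variables). The variational posterior $\Psi(\cdot\mid\boldsymbol x,\boldsymbol y)$ is the minimizer of $\Psi\mapsto D_{\mathrm{KL}}(\Psi\,\|\,\Pi(\cdot\mid\boldsymbol x,\boldsymbol y))$ over all $\Psi=\int\Pi(\cdot\mid\boldsymbol u)\,d\Psi_{\boldsymbol u}(\boldsymbol u)$ with $\Psi_{\boldsymbol u}$ a nondegenerate Gaussian law on $\mathbb R^m$. Let $\hat f^{\mathrm v}_m$ be its mean function and, for a fixed $\gamma\in(0,1)$, let $\rho_n$ be the radius determined by $\Psi(\|f-\hat f_m^{\mathrm v}\|\le\rho_n\mid\boldsymbol x,\boldsymbol y)=1-\gamma$. For nonnegative sequences, $a_n\asymp b_n$ means that $C^{-1}b_n\le a_n\le C b_n$ for all $n\ge1$ and some constant $C>0$. All limits are for $n\to\infty$. Corollary. Let $\alpha,\beta>0$, suppose that $\lambda_j\asymp j^{-1-2\alpha/d}$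 and $\sup_{j,x}|\varphi_j(x)|<\infty$, and let $m_n\asymp n^r$ for some $r\in(0,1/2)$. 1. If $\alpha\le\beta$, then $\mathrm P_0(\|\hat f_m^{\mathrm v}-f_0\|\le M_n\rho_n)\to1$ for every bounded $f_0\in\mathcal S^\beta$ and every sequence $M_n\to\infty$. 2. If $\alpha<\beta$ and $r<d/(d+2\alpha)$, then $\mathrm P_0(\|\hat f_m^{\mathrm v}-f_0\|\le\rho_n)\to1$ for every bounded $f_0\in\mathcal S^\beta$. 3. If $\alpha>\beta$, then there exists $f_0\in\mathcal S^\beta$ such that $\mathrm P_0(\|\hat f_m^{\mathrm v}-f_0\|\le M\rho_n)\to0$ for every $M>0$. 4. If $\beta=\alpha$ and $m_n\ge n^{d/(d+2\alpha)}$ for all sufficiently large $n$, then for every $M>0$ there exists $C>0$ such that $$\inf_{f_0\in L^2(\mathcal X,\mu):\ \|f_0\|_\beta\le M}\mathrm P_0\big(\rho_n\le C n^{-\beta/(d+2\beta)}\big)\to1 .$$ -/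

import Mathlib

open MeasureTheory ProbabilityTheory Filter Topology
open scoped ENNReal NNReal

/-! Sequences that the mathematics indexes by `1, 2, 3, …` (eigenvalues, eigenfunctions) are indexed
by `ℕ` here: entry `j` of the Lean sequence is entry `j + 1` of the mathematical one. -/

namespace SparseGP

noncomputable section

/-- `a ≍ b` for sequences of nonnegative reals: equality up to a multiplicative constant. -/
def AsympEq (a b : ℕ → ℝ) : Prop :=
  ∃ C : ℝ, 0 < C ∧ ∀ n, a n ≤ C * b n ∧ b n ≤ C * a n

section Kernel

variable {X : Type*} [MeasurableSpace X]

/-- The functions `φ j` represent an orthonormal basis of `L²(X, μ)`. -/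
def IsOrthonormalBasisL2 (μ : Measure X) (φ : ℕ → X → ℝ) : Prop :=
  (∀ j, Measurable (φ j)) ∧
    ∃ b : HilbertBasis ℕ ℝ (Lp ℝ 2 μ), ∀ j, (b j : X → ℝ) =ᵐ[μ] φ j

/-- The Mercer decomposition `k(s,t) = ∑ j, lam j * φ j s * φ j t` of the kernel `k`, with
decreasing, summable, nonnegative eigenvalues and an orthonormal basis of eigenfunctions. -/
structure IsMercerDecomposition (μ : Measure X) (k : X → X → ℝ) (lam : ℕ → ℝ)
    (φ : ℕ → X → ℝ) : Prop where
  antitone : Antitone lam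
  nonneg : ∀ j, 0 ≤ lam j
  summable : Summable lam
  basis : IsOrthonormalBasisL2 μ φ
  hasSum : ∀ s t, HasSum (fun j => lam j * φ j s * φ j t) (k s t)

/-- The coefficient `⟨f, φ j⟩` in `L²(X, μ)`. -/
def coeff (μ : Measure X) (φ : ℕ → X → ℝ) (f : X → ℝ) (j : ℕ) : ℝ :=
  ∫ t, f t * φ j t ∂μ

/-- The Sobolev norm `‖f‖_β = (∑_{j ≥ 1} j^{2β/d} ⟨f, φ_j⟩²)^{1/2}`, with values in `[0, ∞]`. -/
def sobolevNorm (μ : Measure X) (φ : ℕ → X → ℝ) (d : ℕ) (β : ℝ) (f : X → ℝ) : ℝ≥0∞ :=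
  (∑' j : ℕ, ENNReal.ofReal (((j + 1 : ℕ) : ℝ) ^ (2 * β / d) * coeff μ φ f j ^ 2)) ^ (1 / 2 : ℝ)

/-- The Sobolev space `S^β` (functions in `L²(X, μ)` of finite Sobolev norm). -/
def sobolevSpace (μ : Measure X) (φ : ℕ → X → ℝ) (d : ℕ) (β : ℝ) : Set (X → ℝ) :=
  {f | MemLp f 2 μ ∧ sobolevNorm μ φ d β f < ∞}

/-- The Sobolev ball `{f ∈ L²(X, μ) : ‖f‖_β ≤ R}`. -/
def sobolevBall (μ : Measure X) (φ : ℕ → X → ℝ) (d : ℕ) (β R : ℝ) : Set (X → ℝ) :=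
  {f | MemLp f 2 μ ∧ sobolevNorm μ φ d β f ≤ ENNReal.ofReal R}

/-- The law `P₀` on `Xⁿ × ℝⁿ` of the data `(x, y)`: the design points `x i` are i.i.d. with law `μ`
and `y i = f₀ (x i) + ε i` with i.i.d. `N(0, σ²)` errors `ε i`, independent of the design. -/
def dataLaw (μ : Measure X) (σ : ℝ) (f₀ : X → ℝ) (n : ℕ) :
    Measure ((Fin n → X) × (Fin n → ℝ)) :=
  ((Measure.pi fun _ : Fin n => μ).prod
      (Measure.pi fun _ : Fin n => gaussianReal 0 (σ ^ 2).toNNReal)).map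
    fun p => (p.1, fun i => f₀ (p.1 i) + p.2 i)

end Kernel

section Prior

variable {X : Type*} [MeasurableSpace X] {Ω : Type*} [MeasurableSpace Ω]

/-- `G` is a (jointly measurable version of a) centered Gaussian process on `X` with covariance
kernel `k`, defined on the probability space `(Ω, P)`. The random function is `t ↦ G t ω`. -/
structure IsGPPrior (P : Measure Ω) (k : X → X → ℝ) (G : X → Ω → ℝ) : Prop where
  measurable : Measurable fun p : X × Ω => G p.1 p.2
  gaussian : IsGaussianProcess G P
  mean_zero : ∀ t, ∫ ω, G t ω ∂P = 0
  covariance : ∀ s t, cov[G s, G t; P] = k s t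

/-- The likelihood of the responses `y` at design `x`, for the regression function `t ↦ G t ω`. -/
def likelihood (σ : ℝ) (G : X → Ω → ℝ) {n : ℕ} (x : Fin n → X) (y : Fin n → ℝ) (ω : Ω) : ℝ≥0∞ :=
  ∏ i, gaussianPDF (G (x i) ω) (σ ^ 2).toNNReal (y i)

/-- The true posterior given the data `(x, y)`, by Bayes' formula. -/
def posterior (P : Measure Ω) (σ : ℝ) (G : X → Ω → ℝ) {n : ℕ} (x : Fin n → X) (y : Fin n → ℝ) :
    Measure Ω :=
  (∫⁻ ω, likelihood σ G x y ω ∂P)⁻¹ • P.withDensity (likelihood σ G x y)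

/-- The inducing variables `u_j = ⟨f, φ_j⟩`, `j = 1, …, m` (population spectral features),
of the random function `f = G · ω`. -/
def spectralFeatures (μ : Measure X) (φ : ℕ → X → ℝ) (G : X → Ω → ℝ) (m : ℕ) (ω : Ω) :
    EuclideanSpace ℝ (Fin m) :=
  WithLp.toLp 2 fun j : Fin m => coeff μ φ (fun t => G t ω) j

/-- The variational class `{∫ Π(· | u) dν(u) : ν a nondegenerate Gaussian law on ℝᵐ}`, where
`Π(· | u)` is the prior conditionally on the inducing variables. -/
def variationalClass [StandardBorelSpace Ω] [Nonempty Ω] (P : Measure Ω) [IsFiniteMeasure P]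
    {m : ℕ} (u : Ω → EuclideanSpace ℝ (Fin m)) : Set (Measure Ω) :=
  {Q | ∃ (a : EuclideanSpace ℝ (Fin m)) (S : Matrix (Fin m) (Fin m) ℝ), S.PosDef ∧
    Q = (multivariateGaussian a S).bind (condDistrib id u P)}

/-- `Q` is a variational posterior: it minimizes the Kullback–Leibler divergence to the true
posterior over the variational class with `m` population spectral features. -/
def IsVariationalPosterior [StandardBorelSpace Ω] [Nonempty Ω] (μ : Measure X)
    (φ : ℕ → X → ℝ) (P : Measure Ω) [IsFiniteMeasure P] (σ : ℝ) (G : X → Ω → ℝ) (m : ℕ)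
    {n : ℕ} (x : Fin n → X) (y : Fin n → ℝ) (Q : Measure Ω) : Prop :=
  IsMinOn (fun Q' => InformationTheory.klDiv Q' (posterior P σ G x y))
      (variationalClass P (spectralFeatures μ φ G m)) Q ∧
    Q ∈ variationalClass P (spectralFeatures μ φ G m)

/-- The mean function of the random function `G` under `Q`. -/
def meanFunction (G : X → Ω → ℝ) (Q : Measure Ω) (t : X) : ℝ := ∫ ω, G t ω ∂Q

/-- `ρ` is the radius of a `(1 - γ)`-credible ball of `Q`, centered at the mean function of `Q`:
`Q (‖f - fhat‖ ≤ ρ) = 1 - γ`, with the norm of `L²(X, μ)`. -/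
def IsCredibleRadius (μ : Measure X) (G : X → Ω → ℝ) (Q : Measure Ω) (γ ρ : ℝ) : Prop :=
  0 ≤ ρ ∧
    Q {ω | eLpNorm (fun t => G t ω - meanFunction G Q t) 2 μ ≤ ENNReal.ofReal ρ}
      = ENNReal.ofReal (1 - γ)

/-- The event, in the space of data `(x, y)`, that `f₀` lies in the ball of radius `c * ρ x y` around
the mean function of `Ψ x y`. -/
def coverageEvent (μ : Measure X) (G : X → Ω → ℝ) {n : ℕ}
    (Ψ : (Fin n → X) → (Fin n → ℝ) → Measure Ω) (ρ : (Fin n → X) → (Fin n → ℝ) → ℝ)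
    (f₀ : X → ℝ) (c : ℝ) : Set ((Fin n → X) × (Fin n → ℝ)) :=
  {p | eLpNorm (fun t => meanFunction G (Ψ p.1 p.2) t - f₀ t) 2 μ
      ≤ ENNReal.ofReal (c * ρ p.1 p.2)}

end Prior

end

end SparseGP

/-!
The prior enters only through the coefficients `u_j = ⟨f, φ_j⟩`, which are independent and
`N(0, λ_j)`-distributed: by Fubini's theorem they belong to the closed Gaussian span of the
process (`feature_mem_closure`). The process therefore splits into `∑_{j < m} u_j φ_j` and a
residual process that is independent of the inducing variables
(`indepFun_spectralFeatures_residual`), and a member of the variational class changes the law of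
the inducing variables only. The integral over the residual process of the log-likelihood is, up
to a constant, the log-likelihood of the finite-dimensional linear model with design matrix
`Φ = (φ_j(x_i))`, so the minimizer of the Kullback–Leibler divergence is the conjugate Gaussian
posterior of this model, with precision `Λ⁻¹ + σ⁻² ΦᵀΦ`
(`isReweighting_of_isVariationalPosterior`).

Hence `‖f - f̂‖²` is, under the variational posterior, a sum of squares of centered Gaussian
variables. Markov's inequality bounds the squared radius above by a multiple of the sum of the
variances, and a Laplace transform bound shows that it is also at least a multiple of the sum of
any finitely many of them (`IsReweighting.sq_credibleRadius_mul_le`,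
`IsReweighting.sum_postVar_lt_sq_credibleRadius`); independence of the variables is not needed.

As `m² / n → 0` and the eigenfunctions are bounded, the Gram matrix `ΦᵀΦ / n` is close to the
identity in Frobenius norm, with probability tending to one. On this event the linear model
behaves like the diagonal Gaussian sequence model: the variances are comparable to
`(λ_j⁻¹ + n σ⁻²)⁻¹` for `j < m` and equal to `λ_j` for `j ≥ m`, and the squared error `‖f̂ - f₀‖²`
is comparable to a stochastic term plus the squared bias of the sequence model
(`diag_inv_precision_mem_Icc`, `exists_sq_error`).

With `K = min(m, n^{d/(d+2α)})` (`effectiveDim`), the sum of the variances is of the order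
`K^{-2α/d}`; the lower bound comes from the block `K ≤ j < 2K`, where the data do not reduce the
prior variances. So `ρ_n` is of the order `K^{-α/d}` (`exists_sq_credibleRadius_bounds`), and the
stochastic error is of at most this order. For `f₀` at least as smooth as the prior the bias is of
this order as well, which gives the first claim; if the smoothness is strictly larger and `m` is
of smaller order than `n^{d/(d+2α)}`, both error terms are of smaller order than `m^{-α/d}`, which
gives the second claim. If `f₀` has the coefficients `j^{-1/2-b}` with `β/d < b < α/d`, its bias
is at least of the order `K^{-b}` and exceeds the radius, which gives the third claim. The fourth
is the upper bound for the radius with `K` of the order `n^{d/(d+2α)}`; the event on which it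
holds concerns the design only.
-/

set_option linter.unusedSectionVars false

namespace SparseGP

/-! ### Closed spaces of centered Gaussian variables -/

section GaussianSpace

variable {Ω : Type*} [MeasurableSpace Ω] {P : Measure Ω} [IsProbabilityMeasure P]

lemma integral_norm_le_norm_Lp (ξ : Lp ℝ 2 P) : ∫ ω, ‖ξ ω‖ ∂P ≤ ‖ξ‖ := by
  have h1 : MemLp ξ 1 P := (Lp.memLp ξ).mono_exponent (by norm_num)
  rw [integral_norm_eq_lintegral_enorm h1.1, ← eLpNorm_one_eq_lintegral_enorm, Lp.norm_def]
  refine ENNReal.toReal_mono (Lp.memLp ξ).2.ne ?_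
  exact eLpNorm_le_eLpNorm_of_exponent_le (by norm_num) h1.1

/-- The square-integrable variables `ξ` that look like centered Gaussian variables: their mean is
zero and their characteristic function at `1` is the Gaussian one. On a linear subspace, this
implies joint Gaussianity. -/
def gaussianSet (P : Measure Ω) : Set (Lp ℝ 2 P) :=
  {ξ | ∫ ω, ξ ω ∂P = 0 ∧
    ∫ ω, Complex.exp (ξ ω * Complex.I) ∂P = Complex.exp (-(‖ξ‖ ^ 2 : ℝ) / 2)}

lemma integrable_Lp (ξ : Lp ℝ 2 P) : Integrable ξ P :=
  memLp_one_iff_integrable.1 ((Lp.memLp ξ).mono_exponent (by norm_num))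

lemma integrable_cexp_Lp (ξ : Lp ℝ 2 P) :
    Integrable (fun ω => Complex.exp (ξ ω * Complex.I)) P := by
  refine Integrable.of_bound (C := 1) ?_ ?_
  · have := (Lp.aestronglyMeasurable ξ).aemeasurable
    exact AEMeasurable.aestronglyMeasurable (by fun_prop)
  · exact ae_of_all _ fun ω => (Complex.norm_exp_ofReal_mul_I _).le

lemma isClosed_gaussianSet : IsClosed (gaussianSet P) := by
  have h1 : Continuous fun ξ : Lp ℝ 2 P => ∫ ω, ξ ω ∂P := by
    refine (LipschitzWith.of_dist_le_mul (K := 1) fun ξ η => ?_).continuous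
    rw [dist_eq_norm, ← integral_sub (integrable_Lp ξ) (integrable_Lp η), NNReal.coe_one, one_mul,
      dist_eq_norm]
    refine (norm_integral_le_integral_norm _).trans (le_trans (le_of_eq ?_)
      (integral_norm_le_norm_Lp (ξ - η)))
    refine integral_congr_ae ?_
    filter_upwards [Lp.coeFn_sub ξ η] with ω h
    rw [h, Pi.sub_apply]
  have h2 : Continuous fun ξ : Lp ℝ 2 P => ∫ ω, Complex.exp (ξ ω * Complex.I) ∂P := by
    refine (LipschitzWith.of_dist_le_mul (K := 1) fun ξ η => ?_).continuous
    rw [dist_eq_norm, ← integral_sub (integrable_cexp_Lp ξ) (integrable_cexp_Lp η),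
      NNReal.coe_one, one_mul, dist_eq_norm]
    refine (norm_integral_le_integral_norm _).trans (le_trans ?_
      (integral_norm_le_norm_Lp (ξ - η)))
    refine integral_mono_ae ((integrable_cexp_Lp ξ).sub (integrable_cexp_Lp η)).norm
      (integrable_Lp _).norm ?_
    filter_upwards [Lp.coeFn_sub ξ η] with ω h
    rw [h, Pi.sub_apply]
    have e : Complex.exp (ξ ω * Complex.I) - Complex.exp (η ω * Complex.I)
        = Complex.exp (η ω * Complex.I) * (Complex.exp (Complex.I * ((ξ ω - η ω : ℝ))) - 1) := by
      rw [mul_sub, ← Complex.exp_add, mul_one]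
      congr 2
      push_cast; ring
    rw [e, norm_mul, Complex.norm_exp_ofReal_mul_I, one_mul]
    exact Real.norm_exp_I_mul_ofReal_sub_one_le
  exact (isClosed_eq h1 continuous_const).inter
    (isClosed_eq h2 (by fun_prop))

/-- A family of square-integrable variables whose linear span consists of variables of
`gaussianSet` is a Gaussian process. -/
lemma isGaussianProcess_of_mem {T : Type*} {Y : T → Ω → ℝ} (hY : ∀ t, MemLp (Y t) 2 P)
    (V : Submodule ℝ (Lp ℝ 2 P)) (hV : ∀ ξ ∈ V, ξ ∈ gaussianSet P)
    (hYV : ∀ t, (hY t).toLp ∈ V) : IsGaussianProcess Y P where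
  hasGaussianLaw I := by
    classical
    have hm : AEMeasurable (fun ω => I.restrict (Y · ω)) P :=
      aemeasurable_pi_lambda _ fun t => (hY t).1.aemeasurable
    rw [hasGaussianLaw_iff_charFunDual_map_eq hm]
    intro L
    set ξ : Lp ℝ 2 P := ∑ i : I, L (Pi.single i 1) • (hY i).toLp with hξ
    have hmem : ξ ∈ V := V.sum_mem fun i _ => V.smul_mem _ (hYV i)
    have hae : L ∘ (fun ω => I.restrict (Y · ω)) =ᵐ[P] ξ := by
      have h1 : (ξ : Ω → ℝ) =ᵐ[P] fun ω => ∑ i : I, L (Pi.single i 1) * Y i ω := by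
        rw [hξ]
        refine (Lp.coeFn_finsetSum _ _).trans ?_
        have : ∀ i : I, ((L (Pi.single i 1) • (hY i).toLp : Lp ℝ 2 P) : Ω → ℝ)
            =ᵐ[P] fun ω => L (Pi.single i 1) * Y i ω := fun i => by
          filter_upwards [Lp.coeFn_smul (L (Pi.single i 1)) (hY i).toLp, (hY i).coeFn_toLp]
            with ω h1 h2
          rw [h1, Pi.smul_apply, h2, smul_eq_mul]
        filter_upwards [ae_all_iff.2 this] with ω h
        rw [Finset.sum_apply]
        exact Finset.sum_congr rfl fun i _ => h i
      filter_upwards [h1] with ω h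
      rw [h, Function.comp_apply]
      conv_lhs => rw [← L.sum_comp_single]
      refine Finset.sum_congr rfl fun i _ => ?_
      have : (Pi.single i (I.restrict (Y · ω) i) : I → ℝ) = Y i ω • Pi.single i (1 : ℝ) := by
        rw [← Pi.single_smul, smul_eq_mul, mul_one]; rfl
      simp only [ContinuousLinearMap.comp_apply, ContinuousLinearMap.single_apply]
      rw [this, map_smul, smul_eq_mul, mul_comm]
    obtain ⟨h0, h1⟩ := hV ξ hmem
    have hmean : P[L ∘ (fun ω => I.restrict (Y · ω))] = 0 := by
      rw [integral_congr_ae hae, h0]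
    have hvar : Var[L ∘ (fun ω => I.restrict (Y · ω)); P] = ‖ξ‖ ^ 2 := by
      rw [variance_congr hae, variance_of_integral_eq_zero (Lp.aestronglyMeasurable ξ).aemeasurable
        h0, ← real_inner_self_eq_norm_sq, L2.inner_def]
      exact integral_congr_ae (ae_of_all _ fun ω => by simp [sq])
    rw [hmean, hvar, charFunDual_apply, integral_map hm (by fun_prop)]
    rw [Complex.ofReal_zero, zero_mul, zero_sub, ← neg_div, ← h1]
    refine integral_congr_ae ?_
    filter_upwards [hae] with ω h
    rw [← h]; rfl

/-- The closed linear span of a centered Gaussian process in `L²(P)` consists of centered Gaussian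
variables. -/
lemma closure_span_subset_gaussianSet {T : Type*} {G : T → Ω → ℝ} (hG : IsGaussianProcess G P)
    (h0 : ∀ t, ∫ ω, G t ω ∂P = 0) (h2 : ∀ t, MemLp (G t) 2 P) :
    ∀ ξ ∈ (Submodule.span ℝ (Set.range fun t => (h2 t).toLp)).topologicalClosure,
      ξ ∈ gaussianSet P := by
  intro ξ hξ
  refine closure_minimal ?_ isClosed_gaussianSet hξ
  intro η hη
  obtain ⟨c, rfl⟩ := (Finsupp.mem_span_range_iff_exists_finsupp).1 hη
  set η : Lp ℝ 2 P := c.sum fun i a => a • (h2 i).toLp with hη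
  have hae : (η : Ω → ℝ) =ᵐ[P] fun ω => ∑ i ∈ c.support, c i * G i ω := by
    rw [hη, Finsupp.sum]
    refine (Lp.coeFn_finsetSum _ _).trans ?_
    have : ∀ i ∈ c.support, ((c i • (h2 i).toLp : Lp ℝ 2 P) : Ω → ℝ)
        =ᵐ[P] fun ω => c i * G i ω := fun i _ => by
      filter_upwards [Lp.coeFn_smul (c i) (h2 i).toLp, (h2 i).coeFn_toLp] with ω h1 h2
      rw [h1, Pi.smul_apply, h2, smul_eq_mul]
    filter_upwards [(Finset.eventually_all c.support).2 this] with ω h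
    rw [Finset.sum_apply]
    exact Finset.sum_congr rfl fun i hi => h i hi
  have hlaw : HasGaussianLaw η P := by
    refine HasGaussianLaw.congr ?_ hae.symm
    exact ((hG.smul c).hasGaussianLaw_fun_sum (I := c.support))
  have hmean : ∫ ω, η ω ∂P = 0 := by
    rw [integral_congr_ae hae, integral_finsetSum _ fun i _ =>
      ((h2 i).integrable (by norm_num)).const_mul _]
    simp [integral_const_mul, h0]
  refine ⟨hmean, ?_⟩
  have := hlaw.charFun_map_eq 1
  rw [charFun_apply_real, integral_map hlaw.aemeasurable (by fun_prop)] at this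
  have hvar : Var[η; P] = ‖η‖ ^ 2 := by
    rw [variance_of_integral_eq_zero (Lp.aestronglyMeasurable η).aemeasurable
        hmean, ← real_inner_self_eq_norm_sq, L2.inner_def]
    exact integral_congr_ae (ae_of_all _ fun ω => by simp [sq])
  simp only [Complex.ofReal_one, one_mul] at this
  rw [this]
  have h3 : (fun ω => inner ℝ (1 : ℝ) (η ω)) = η := by ext; simp
  rw [h3, hmean, hvar]
  simp [neg_div]

end GaussianSpace

/-! ### Eigenfunctions and the kernel -/

section Basis

variable {X : Type*} [MeasurableSpace X] {μ : Measure X} [IsProbabilityMeasure μ]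
  {φ : ℕ → X → ℝ}

lemma IsOrthonormalBasisL2.memLp (h : IsOrthonormalBasisL2 μ φ) (j : ℕ) : MemLp (φ j) 2 μ := by
  obtain ⟨b, hb⟩ := h.2
  exact (memLp_congr_ae (hb j)).1 (Lp.memLp (b j))

lemma IsOrthonormalBasisL2.integral_mul (h : IsOrthonormalBasisL2 μ φ) (i j : ℕ) :
    ∫ t, φ i t * φ j t ∂μ = if i = j then 1 else 0 := by
  obtain ⟨b, hb⟩ := h.2
  rw [← orthonormal_iff_ite.1 b.orthonormal i j, L2.inner_def]
  refine integral_congr_ae ?_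
  filter_upwards [hb i, hb j] with t h1 h2
  simp [h1, h2, mul_comm]

/-- Parseval's identity for the coefficients of a square-integrable function. -/
lemma IsOrthonormalBasisL2.hasSum_coeff_sq (h : IsOrthonormalBasisL2 μ φ) {f : X → ℝ}
    (hf : MemLp f 2 μ) : HasSum (fun j => coeff μ φ f j ^ 2) (∫ t, f t ^ 2 ∂μ) := by
  obtain ⟨b, hb⟩ := h.2
  have h1 := b.hasSum_inner_mul_inner hf.toLp hf.toLp
  have hc : ∀ j, inner ℝ (b j) hf.toLp = coeff μ φ f j := fun j => by
    rw [L2.inner_def, coeff]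
    refine integral_congr_ae ?_
    filter_upwards [hb j, hf.coeFn_toLp] with t h1 h2
    simp [h1, h2]
  have h2 : inner ℝ hf.toLp hf.toLp = ∫ t, f t ^ 2 ∂μ := by
    rw [L2.inner_def]
    refine integral_congr_ae ?_
    filter_upwards [hf.coeFn_toLp] with t h2
    simp [h2, sq]
  rw [h2] at h1
  refine h1.congr_fun fun j => ?_
  rw [real_inner_comm, hc, sq]

lemma eLpNorm_two_sq {f : X → ℝ} (hf : MemLp f 2 μ) :
    eLpNorm f 2 μ = ENNReal.ofReal (Real.sqrt (∫ t, f t ^ 2 ∂μ)) := by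
  rw [hf.eLpNorm_eq_integral_rpow_norm (by norm_num) (by norm_num)]
  congr 1
  rw [Real.sqrt_eq_rpow]
  norm_num

lemma coeff_sub {f g : X → ℝ} (hφ : ∀ j, MemLp (φ j) 2 μ) (hf : MemLp f 2 μ) (hg : MemLp g 2 μ)
    (j : ℕ) : coeff μ φ (fun t => f t - g t) j = coeff μ φ f j - coeff μ φ g j := by
  simp only [coeff, sub_mul]
  exact integral_sub (hf.integrable_mul (hφ j)) (hg.integrable_mul (hφ j))

lemma coeff_sum (h : IsOrthonormalBasisL2 μ φ) {m : ℕ} (a : Fin m → ℝ) (j : ℕ) :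
    coeff μ φ (fun t => ∑ i : Fin m, a i * φ i t) j = if hj : j < m then a ⟨j, hj⟩ else 0 := by
  have h1 : coeff μ φ (fun t => ∑ i : Fin m, a i * φ i t) j
      = ∑ i : Fin m, a i * if (i : ℕ) = j then 1 else 0 := by
    simp only [coeff, Finset.sum_mul, mul_assoc]
    have h2 : ∀ i : Fin m, Integrable (fun t => a i * (φ i t * φ j t)) μ := fun i =>
      ((h.memLp i).integrable_mul (h.memLp j)).const_mul (a i)
    rw [integral_finsetSum _ fun i _ => h2 i]
    exact Finset.sum_congr rfl fun i _ => by rw [integral_const_mul, h.integral_mul]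
  rw [h1]
  split_ifs with hj
  · rw [Finset.sum_eq_single ⟨j, hj⟩]
    · simp
    · intro i _ hi
      rw [if_neg, mul_zero]
      exact fun h => hi (Fin.ext h)
    · simp
  · refine Finset.sum_eq_zero fun i _ => ?_
    rw [if_neg, mul_zero]
    have := i.2
    omega

lemma memLp_sum (h : IsOrthonormalBasisL2 μ φ) {m : ℕ} (a : Fin m → ℝ) :
    MemLp (fun t => ∑ i : Fin m, a i * φ i t) 2 μ :=
  memLp_finsetSum _ fun i _ => (h.memLp i).const_mul (a i)

variable {k : X → X → ℝ} {lam : ℕ → ℝ} {C : ℝ}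

lemma IsMercerDecomposition.kernel_diag_le (hk : IsMercerDecomposition μ k lam φ)
    (hC : ∀ j t, |φ j t| ≤ C) (t : X) : k t t ≤ C ^ 2 * ∑' j, lam j := by
  rw [← tsum_mul_left]
  refine hasSum_le (fun j => ?_) (hk.hasSum t t) (hk.summable.mul_left (C ^ 2)).hasSum
  have h1 : φ j t * φ j t ≤ C ^ 2 := by
    rw [← sq, ← sq_abs]; exact pow_le_pow_left₀ (abs_nonneg _) (hC j t) 2
  nlinarith [hk.nonneg j]

/-- The eigenfunctions are pointwise eigenfunctions of the integral operator of the kernel. -/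
lemma IsMercerDecomposition.integral_kernel_mul (hk : IsMercerDecomposition μ k lam φ)
    (hC : ∀ j t, |φ j t| ≤ C) (s : X) (j : ℕ) :
    ∫ t, φ j t * k s t ∂μ = lam j * φ j s := by
  have hb := hk.basis
  have hm := fun i => (hb.memLp i)
  have h1 : ∀ i, Integrable (fun t => φ j t * (lam i * φ i s * φ i t)) μ := fun i => by
    have := ((hm j).integrable_mul (hm i)).const_mul (lam i * φ i s)
    refine this.congr (ae_of_all _ fun t => ?_)
    simp only [Pi.mul_apply]; ring
  have hC0 : ∀ i t, |φ j t * (lam i * φ i s * φ i t)| ≤ C ^ 3 * lam i := fun i t => by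
    have hC0 : 0 ≤ C := (abs_nonneg _).trans (hC j t)
    rw [abs_mul, abs_mul, abs_mul, abs_of_nonneg (hk.nonneg i)]
    calc _ ≤ C * (lam i * C * C) := by
          have := hk.nonneg i
          have h1 := hC j t
          have h2 := hC i s
          have h3 := hC i t
          gcongr
      _ = _ := by ring
  have h2 : HasSum (fun i => ∫ t, φ j t * (lam i * φ i s * φ i t) ∂μ)
      (∫ t, ∑' i, φ j t * (lam i * φ i s * φ i t) ∂μ) := by
    refine hasSum_integral_of_summable_integral_norm h1 ?_
    refine Summable.of_nonneg_of_le (fun i => integral_nonneg fun t => norm_nonneg _) (fun i => ?_)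
      (hk.summable.mul_left (C ^ 3))
    calc ∫ t, ‖φ j t * (lam i * φ i s * φ i t)‖ ∂μ ≤ ∫ t, C ^ 3 * lam i ∂μ :=
          integral_mono (h1 i).norm (integrable_const _) fun t => hC0 i t
      _ = _ := by simp
  have h3 : ∀ t, ∑' i, φ j t * (lam i * φ i s * φ i t) = φ j t * k s t := fun t =>
    ((hk.hasSum s t).mul_left (φ j t)).tsum_eq
  simp_rw [h3] at h2
  refine h2.unique ?_
  have h4 : ∀ i, ∫ t, φ j t * (lam i * φ i s * φ i t) ∂μ = if i = j then lam j * φ j s else 0 := by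
    intro i
    have : ∀ t, φ j t * (lam i * φ i s * φ i t) = lam i * φ i s * (φ i t * φ j t) :=
      fun t => by ring
    simp_rw [this, integral_const_mul, hb.integral_mul]
    split_ifs with h <;> simp [h]
  simp_rw [h4]
  exact hasSum_ite_eq j _

end Basis

/-! ### The prior process and its spectral features -/

section Prior

variable {X : Type*} [MeasurableSpace X] {μ : Measure X} [IsProbabilityMeasure μ]
  {φ : ℕ → X → ℝ} {k : X → X → ℝ} {lam : ℕ → ℝ} {C : ℝ}
  {Ω : Type*} [MeasurableSpace Ω] {P : Measure Ω} [IsProbabilityMeasure P] {G : X → Ω → ℝ}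

/-- The `j`-th spectral feature `⟨f, φ j⟩` of the random function `f = G · ω`. -/
noncomputable def feature (μ : Measure X) (φ : ℕ → X → ℝ) (G : X → Ω → ℝ) (j : ℕ) (ω : Ω) : ℝ :=
  coeff μ φ (fun t => G t ω) j

lemma IsGPPrior.memLp (hG : IsGPPrior P k G) (t : X) : MemLp (G t) 2 P :=
  (hG.gaussian.hasGaussianLaw_eval t).memLp_two

lemma IsGPPrior.measurable_eval (hG : IsGPPrior P k G) (t : X) : Measurable (G t) :=
  hG.measurable.comp (measurable_const.prodMk measurable_id)

lemma IsGPPrior.measurable_path (hG : IsGPPrior P k G) (ω : Ω) : Measurable fun t => G t ω :=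
  hG.measurable.comp (measurable_id.prodMk measurable_const)

lemma IsGPPrior.integral_mul (hG : IsGPPrior P k G) (s t : X) :
    ∫ ω, G s ω * G t ω ∂P = k s t := by
  have := hG.covariance s t
  rw [covariance_eq_sub (hG.memLp s) (hG.memLp t), hG.mean_zero, zero_mul, sub_zero] at this
  exact this

variable (hk : IsMercerDecomposition μ k lam φ) (hC : ∀ j t, |φ j t| ≤ C) (hG : IsGPPrior P k G)
include hk hC hG

lemma memLp_prior_prod : MemLp (fun p : X × Ω => G p.1 p.2) 2 (μ.prod P) := by
  rw [memLp_two_iff_integrable_sq hG.measurable.aestronglyMeasurable]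
  have hm : AEStronglyMeasurable (fun p : X × Ω => G p.1 p.2 ^ 2) (μ.prod P) :=
    (hG.measurable.pow_const 2).aestronglyMeasurable
  have hsq : ∀ t, ∫ ω, ‖G t ω ^ 2‖ ∂P = k t t := fun t => by
    rw [← hG.integral_mul t t]
    exact integral_congr_ae (ae_of_all _ fun ω => by simp [sq])
  refine (integrable_prod_iff hm).2 ⟨ae_of_all _ fun t => (hG.memLp t).integrable_sq, ?_⟩
  simp only [hsq]
  refine Integrable.of_bound (C := C ^ 2 * ∑' j, lam j) ?_ (ae_of_all _ fun t => ?_)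
  · have : (fun t => k t t) = fun t => ∫ ω, ‖G t ω ^ 2‖ ∂P := funext fun t => (hsq t).symm
    rw [this]
    exact ((hG.measurable.pow_const 2).norm.stronglyMeasurable.integral_prod_right
      (ν := P)).aestronglyMeasurable
  · rw [Real.norm_of_nonneg]
    · exact hk.kernel_diag_le hC t
    · rw [← hsq t]; exact integral_nonneg fun _ => norm_nonneg _

lemma ae_memLp_path : ∀ᵐ ω ∂P, MemLp (fun t => G t ω) 2 μ := by
  have h1 := (memLp_prior_prod hk hC hG).integrable_sq.swap
  have h2 := (integrable_prod_iff h1.1).1 h1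
  filter_upwards [h2.1] with ω h
  rw [memLp_two_iff_integrable_sq (hG.measurable_path ω).aestronglyMeasurable]
  exact h

lemma measurable_feature (j : ℕ) : Measurable (feature μ φ G j) := by
  have : StronglyMeasurable fun p : Ω × X => G p.2 p.1 * φ j p.2 :=
    ((hG.measurable.comp measurable_swap).mul
      ((hk.basis.1 j).comp measurable_snd)).stronglyMeasurable
  exact (this.integral_prod_right (ν := μ)).measurable

lemma memLp_feature (j : ℕ) : MemLp (feature μ φ G j) 2 P := by
  rw [memLp_two_iff_integrable_sq (measurable_feature hk hC hG j).aestronglyMeasurable]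
  have h1 := (memLp_prior_prod hk hC hG).integrable_sq.swap.integral_prod_left
  refine h1.mono' ((measurable_feature hk hC hG j).pow_const 2).aestronglyMeasurable ?_
  filter_upwards [ae_memLp_path hk hC hG] with ω h
  rw [Real.norm_of_nonneg (sq_nonneg _)]
  exact le_hasSum (hk.basis.hasSum_coeff_sq h) j fun i _ => sq_nonneg _

/-- Fubini's theorem for the pairing of a feature with a square-integrable variable. -/
lemma integral_mul_feature {ξ : Ω → ℝ} (hξ : MemLp ξ 2 P) (j : ℕ) :
    ∫ ω, ξ ω * feature μ φ G j ω ∂P = ∫ t, φ j t * ∫ ω, ξ ω * G t ω ∂P ∂μ := by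
  have h1 : MemLp (fun p : X × Ω => φ j p.1 * ξ p.2) 2 (μ.prod P) := by
    refine MemLp.of_le_mul (c := C) (g := fun p : X × Ω => ξ p.2) (hξ.comp_snd μ)  ?_ ?_
    · exact ((hk.basis.1 j).comp measurable_fst).aestronglyMeasurable.mul (hξ.comp_snd μ).1
    · refine ae_of_all _ fun p => ?_
      rw [norm_mul]
      exact mul_le_mul_of_nonneg_right (hC j p.1) (norm_nonneg _)
  have h2 := h1.integrable_mul (memLp_prior_prod hk hC hG)
  calc ∫ ω, ξ ω * feature μ φ G j ω ∂P
      = ∫ ω, ∫ t, φ j t * ξ ω * G t ω ∂μ ∂P := by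
        refine integral_congr_ae (ae_of_all _ fun ω => ?_)
        simp only [feature, coeff]
        rw [← integral_const_mul]
        exact integral_congr_ae (ae_of_all _ fun t => by ring)
    _ = ∫ t, ∫ ω, φ j t * ξ ω * G t ω ∂P ∂μ :=
        (integral_integral_swap (f := fun t ω => φ j t * ξ ω * G t ω) h2).symm
    _ = _ := by
        refine integral_congr_ae (ae_of_all _ fun t => ?_)
        simp only []
        rw [← integral_const_mul]
        exact integral_congr_ae (ae_of_all _ fun ω => by ring)

lemma integral_prior_mul_feature (s : X) (j : ℕ) :
    ∫ ω, G s ω * feature μ φ G j ω ∂P = lam j * φ j s := by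
  rw [integral_mul_feature hk hC hG (hG.memLp s), ← hk.integral_kernel_mul hC s j]
  simp_rw [hG.integral_mul]

lemma integral_feature_mul_feature (i j : ℕ) :
    ∫ ω, feature μ φ G i ω * feature μ φ G j ω ∂P = if i = j then lam i else 0 := by
  rw [integral_mul_feature hk hC hG (memLp_feature hk hC hG i)]
  simp_rw [mul_comm (feature μ φ G i _), integral_prior_mul_feature hk hC hG]
  have : ∀ t, φ j t * (lam i * φ i t) = lam i * (φ i t * φ j t) := fun t => by ring
  simp_rw [this, integral_const_mul, hk.basis.integral_mul]
  simp

lemma integral_feature (j : ℕ) : ∫ ω, feature μ φ G j ω ∂P = 0 := by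
  have := integral_mul_feature hk hC hG (ξ := fun _ => 1) (memLp_const 1) j
  simpa [hG.mean_zero] using this

/-- The spectral features lie in the closed linear span of the prior process: this span is its own
double orthogonal complement, and by Fubini's theorem a feature is orthogonal to everything that
is orthogonal to the process. -/
lemma feature_mem_closure (j : ℕ) : (memLp_feature hk hC hG j).toLp ∈
    (Submodule.span ℝ (Set.range fun t => (hG.memLp t).toLp)).topologicalClosure := by
  rw [← Submodule.orthogonal_orthogonal_eq_closure, Submodule.mem_orthogonal]
  intro ξ hξ
  have h1 : ∀ t, ∫ ω, ξ ω * G t ω ∂P = 0 := fun t => by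
    have := (Submodule.mem_orthogonal _ _).1 hξ _ (Submodule.subset_span ⟨t, rfl⟩)
    rw [L2.inner_def] at this
    rw [← this]
    refine integral_congr_ae ?_
    filter_upwards [(hG.memLp t).coeFn_toLp] with ω h
    simp [h]
  have h2 := integral_mul_feature hk hC hG (Lp.memLp ξ) j
  simp only [h1, mul_zero, integral_zero] at h2
  rw [L2.inner_def, ← h2]
  refine integral_congr_ae ?_
  filter_upwards [(memLp_feature hk hC hG j).coeFn_toLp] with ω h
  simp [h, mul_comm]

/-- The residual process: what remains of the prior process after subtracting its projection on
the first `m` features, together with the features of index at least `m`. -/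
noncomputable def residual (μ : Measure X) (φ : ℕ → X → ℝ) (G : X → Ω → ℝ) (m : ℕ) :
    X ⊕ ℕ → Ω → ℝ :=
  Sum.elim (fun t ω => G t ω - ∑ j : Fin m, φ j t * feature μ φ G j ω)
    (fun j => feature μ φ G (m + j))

lemma memLp_residual (m : ℕ) (s : X ⊕ ℕ) : MemLp (residual μ φ G m s) 2 P := by
  rcases s with t | j
  · exact (hG.memLp t).sub (memLp_finsetSum _ fun j _ => (memLp_feature hk hC hG j).const_mul _)
  · exact memLp_feature hk hC hG _

lemma measurable_residual (m : ℕ) (s : X ⊕ ℕ) : Measurable (residual μ φ G m s) := by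
  rcases s with t | j
  · exact (hG.measurable_eval t).sub
      (Finset.measurable_fun_sum _ fun j _ => (measurable_feature hk hC hG j).const_mul _)
  · exact measurable_feature hk hC hG _

lemma isGaussianProcess_feature_residual (m : ℕ) :
    IsGaussianProcess (Sum.elim (fun j : Fin m => feature μ φ G j) (residual μ φ G m)) P := by
  have hV := closure_span_subset_gaussianSet hG.gaussian hG.mean_zero hG.memLp
  set V := (Submodule.span ℝ (Set.range fun t => (hG.memLp t).toLp)).topologicalClosure with hVdef
  have hf : ∀ j, (memLp_feature hk hC hG j).toLp ∈ V := feature_mem_closure hk hC hG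
  have h2 : ∀ s, MemLp (Sum.elim (fun j : Fin m => feature μ φ G j) (residual μ φ G m) s) 2 P := by
    rintro (j | s)
    · exact memLp_feature hk hC hG _
    · exact memLp_residual hk hC hG m s
  refine isGaussianProcess_of_mem h2 V hV ?_
  rintro (j | t | j)
  · exact hf j
  · have h3 : (h2 (Sum.inr (Sum.inl t))).toLp = (hG.memLp t).toLp
        - ∑ j : Fin m, φ j t • (memLp_feature hk hC hG j).toLp := by
      apply Lp.ext
      refine (h2 (Sum.inr (Sum.inl t))).coeFn_toLp.trans ?_
      have h4 : ∀ j : Fin m, ((φ j t • (memLp_feature hk hC hG j).toLp : Lp ℝ 2 P) : Ω → ℝ)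
          =ᵐ[P] fun ω => φ j t * feature μ φ G j ω := fun j => by
        filter_upwards [Lp.coeFn_smul (φ j t) (memLp_feature hk hC hG j).toLp,
          (memLp_feature hk hC hG j).coeFn_toLp] with ω h1 h2
        rw [h1, Pi.smul_apply, h2, smul_eq_mul]
      filter_upwards [Lp.coeFn_sub (hG.memLp t).toLp
        (∑ j : Fin m, φ j t • (memLp_feature hk hC hG j).toLp), (hG.memLp t).coeFn_toLp,
        Lp.coeFn_finsetSum Finset.univ fun j : Fin m => φ j t • (memLp_feature hk hC hG j).toLp,
        ae_all_iff.2 h4] with ω h5 h6 h7 h8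
      rw [h5, Pi.sub_apply, h6, h7, Finset.sum_apply, Finset.sum_congr rfl fun i _ => h8 i]
      rfl
    rw [h3]
    exact V.sub_mem (Submodule.le_topologicalClosure _ (Submodule.subset_span ⟨t, rfl⟩))
      (V.sum_mem fun j _ => V.smul_mem _ (hf j))
  · exact hf _

lemma cov_feature_residual {m : ℕ} (i : Fin m) (s : X ⊕ ℕ) :
    cov[feature μ φ G i, residual μ φ G m s; P] = 0 := by
  rw [covariance_eq_sub (memLp_feature hk hC hG i) (memLp_residual hk hC hG m s),
    integral_feature hk hC hG, zero_mul, sub_zero]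
  have hi := memLp_feature hk hC hG i
  rcases s with t | j
  · have h1 : ∀ ω, (feature μ φ G i * residual μ φ G m (Sum.inl t)) ω = G t ω * feature μ φ G i ω
        - ∑ j : Fin m, φ j t * (feature μ φ G i ω * feature μ φ G j ω) := fun ω => by
      simp only [Pi.mul_apply, residual, Sum.elim_inl, mul_sub, Finset.mul_sum]
      congr 1
      · ring
      · exact Finset.sum_congr rfl fun j _ => by ring
    have h2 : ∀ j : Fin m,
        Integrable (fun ω => φ j t * (feature μ φ G i ω * feature μ φ G j ω)) P := fun j =>
      (hi.integrable_mul (memLp_feature hk hC hG j)).const_mul _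
    rw [integral_congr_ae (ae_of_all _ h1),
      integral_sub (f := fun ω => G t ω * feature μ φ G i ω) ((hG.memLp t).integrable_mul hi)
      (integrable_finsetSum _ fun j _ => h2 j), integral_finsetSum _ fun j _ => h2 j,
      integral_prior_mul_feature hk hC hG]
    simp_rw [integral_const_mul, integral_feature_mul_feature hk hC hG]
    rw [Finset.sum_eq_single i]
    · simp [mul_comm]
    · intro j _ hj
      rw [if_neg, mul_zero]
      exact fun h => hj (Fin.ext h.symm)
    · simp
  · have := integral_feature_mul_feature hk hC hG i (m + j)
    rw [if_neg (by have := i.2; omega)] at this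
    exact this

lemma measurable_spectralFeatures (m : ℕ) : Measurable (spectralFeatures μ φ G m) :=
  (WithLp.measurable_toLp 2 _).comp
    (measurable_pi_lambda _ fun j : Fin m => measurable_feature hk hC hG j)

/-- The residual process is independent of the inducing variables under the prior. -/
lemma indepFun_spectralFeatures_residual (m : ℕ) :
    IndepFun (spectralFeatures μ φ G m) (fun ω s => residual μ φ G m s ω) P := by
  have := (isGaussianProcess_feature_residual hk hC hG m).indepFun_of_covariance_eq_zero
    (fun j => (measurable_feature hk hC hG j).aemeasurable)
    (fun s => (measurable_residual hk hC hG m s).aemeasurable)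
    (cov_feature_residual hk hC hG)
  exact this.comp (WithLp.measurable_toLp 2 _) measurable_id

lemma map_feature (j : ℕ) : P.map (feature μ φ G j) = gaussianReal 0 (lam j).toNNReal := by
  have h1 := (isGaussianProcess_feature_residual hk hC hG 0).hasGaussianLaw_eval
    (Sum.inr (Sum.inr j))
  have h2 : Sum.elim (fun j : Fin 0 => feature μ φ G j) (residual μ φ G 0)
      (Sum.inr (Sum.inr j)) = feature μ φ G j := by
    simp [residual]
  rw [h2] at h1
  have h3 := integral_feature_mul_feature hk hC hG j j
  rw [h1.map_eq_gaussianReal, integral_feature hk hC hG,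
    variance_of_integral_eq_zero h1.aemeasurable (integral_feature hk hC hG j)]
  congr
  simpa [sq] using h3

/-- The inducing variables are independent under the prior, with variances `lam j`. -/
lemma map_spectralFeatures (m : ℕ) : P.map (spectralFeatures μ φ G m)
    = multivariateGaussian 0 (Matrix.diagonal fun j : Fin m => lam j) := by
  have hp := isGaussianProcess_feature_residual hk hC hG m
  have hS : (Matrix.diagonal fun j : Fin m => lam j).PosSemidef :=
    Matrix.PosSemidef.diagonal fun j => hk.nonneg j
  have hlaw : HasGaussianLaw (spectralFeatures μ φ G m) P := by
    have h1 : IsGaussianProcess (fun j : Fin m => feature μ φ G j) P :=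
      hp.comp_right Sum.inl
    have h2 := h1.hasGaussianLaw Finset.univ
    let L : (↥(Finset.univ : Finset (Fin m)) → ℝ) →L[ℝ] (Fin m → ℝ) :=
      ContinuousLinearMap.pi fun j => ContinuousLinearMap.proj ⟨j, Finset.mem_univ j⟩
    have h3 : HasGaussianLaw (fun ω => fun j : Fin m => feature μ φ G j ω) P := by
      exact h2.map L
    exact h3.toLp_pi 2
  have hmeas := measurable_spectralFeatures hk hC hG m
  have := hlaw.isGaussian_map
  apply IsGaussian.ext
  · rw [integral_id_multivariateGaussian', integral_map hmeas.aemeasurable (by fun_prop)]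
    have hint : Integrable (spectralFeatures μ φ G m) P := hlaw.integrable
    ext j
    have h1 := (EuclideanSpace.proj (𝕜 := ℝ) j).integral_comp_comm hint
    exact h1.symm.trans (integral_feature hk hC hG j)
  · rw [← ContinuousLinearMap.toBilinForm_inj]
    refine LinearMap.BilinForm.ext_basis (EuclideanSpace.basisFun (Fin m) ℝ).toBasis fun i j ↦ ?_
    rw [ContinuousLinearMap.toBilinForm_apply, ContinuousLinearMap.toBilinForm_apply,
      covarianceBilin_apply_eq_cov, covariance_map, covarianceBilin_multivariateGaussian hS]
    · have h1 (i : Fin m) : (fun u ↦ inner ℝ ((EuclideanSpace.basisFun (Fin m) ℝ).toBasis i) u) ∘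
          spectralFeatures μ φ G m = feature μ φ G i := by
        ext; simp [PiLp.inner_apply]; rfl
      rw [h1, h1, covariance_eq_sub (memLp_feature hk hC hG i) (memLp_feature hk hC hG j),
        integral_feature hk hC hG, zero_mul, sub_zero]
      simp only [Pi.mul_apply, integral_feature_mul_feature hk hC hG]
      by_cases h : i = j
      · simp [h]
      · simp [h, Fin.val_inj]
    any_goals exact Measurable.aestronglyMeasurable (by fun_prop)
    · exact hmeas.aemeasurable
    · exact IsGaussian.memLp_two_id

end Prior

/-! ### Densities of multivariate Gaussian laws -/

section Density

open Matrix
open scoped MatrixOrder Matrix.Norms.L2Operator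

lemma withDensity_comp_map {α β : Type*} [MeasurableSpace α] [MeasurableSpace β] {μ : Measure α}
    {T : α → β} (hT : Measurable T) {h : β → ℝ≥0∞} (hh : Measurable h) :
    (μ.withDensity fun x => h (T x)).map T = (μ.map T).withDensity h := by
  ext s hs
  rw [Measure.map_apply hT hs, withDensity_apply _ (hT hs), withDensity_apply _ hs,
    setLIntegral_map hs hh hT]

variable {m n : ℕ}

lemma integrable_exp_neg_norm_sq (m : ℕ) :
    Integrable fun v : EuclideanSpace ℝ (Fin m) => Real.exp (-(‖v‖ ^ 2) / 2) := by
  have := (GaussianFourier.integrable_cexp_neg_mul_sq_norm_add (V := EuclideanSpace ℝ (Fin m))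
    (b := 1 / 2) (by norm_num) 0 0).re
  refine this.congr (ae_of_all _ fun v => ?_)
  simp only [zero_mul, add_zero]
  have : -(1 / 2 : ℂ) * (‖v‖ : ℂ) ^ 2 = ((-(‖v‖ ^ 2) / 2 : ℝ) : ℂ) := by push_cast; ring
  rw [this, ← Complex.ofReal_exp]
  rfl

/-- The density of the standard Gaussian law; both sides have the same characteristic function. -/
lemma stdGaussian_eq_withDensity (m : ℕ) : ∃ c : ℝ, 0 < c ∧
    stdGaussian (EuclideanSpace ℝ (Fin m)) =
      volume.withDensity fun v => ENNReal.ofReal (c * Real.exp (-(‖v‖ ^ 2) / 2)) := by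
  set E := EuclideanSpace ℝ (Fin m)
  have hint := integrable_exp_neg_norm_sq m
  set Z : ℝ := ∫ v : E, Real.exp (-(‖v‖ ^ 2) / 2) with hZ
  have hZpos : 0 < Z := integral_exp_pos hint
  refine ⟨Z⁻¹, inv_pos.2 hZpos, ?_⟩
  have hint' : Integrable fun v : E => Z⁻¹ * Real.exp (-(‖v‖ ^ 2) / 2) := hint.const_mul _
  have hnn : ∀ v : E, 0 ≤ Z⁻¹ * Real.exp (-(‖v‖ ^ 2) / 2) := fun v => by positivity
  have hfin : IsFiniteMeasure ((volume : Measure E).withDensity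
      fun v => ENNReal.ofReal (Z⁻¹ * Real.exp (-(‖v‖ ^ 2) / 2))) :=
    isFiniteMeasure_withDensity_ofReal hint'.2
  refine Measure.ext_of_charFun ?_
  ext t
  rw [charFun_stdGaussian, charFun_apply, integral_withDensity_eq_integral_toReal_smul
    (by fun_prop) (ae_of_all _ fun v => ENNReal.ofReal_lt_top)]
  have h1 := GaussianFourier.integral_cexp_neg_mul_sq_norm_add (V := E) (b := 1 / 2) (by norm_num)
    Complex.I t
  have h0 := GaussianFourier.integral_cexp_neg_mul_sq_norm_add (V := E) (b := 1 / 2) (by norm_num)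
    0 t
  have hZc : (Z : ℂ) = ∫ v : E, Complex.exp (-(1 / 2) * (‖v‖ : ℂ) ^ 2 + 0 * (inner ℝ t v : ℝ)) := by
    rw [hZ, ← integral_complex_ofReal]
    refine integral_congr_ae (ae_of_all _ fun v => ?_)
    simp only []
    rw [Complex.ofReal_exp]
    congr 1
    push_cast
    ring
  have h2 : ∀ v : E, (ENNReal.ofReal (Z⁻¹ * Real.exp (-(‖v‖ ^ 2) / 2))).toReal •
      Complex.exp ((inner ℝ v t : ℝ) * Complex.I)
      = (Z : ℂ)⁻¹ * Complex.exp (-(1 / 2) * (‖v‖ : ℂ) ^ 2 + Complex.I * (inner ℝ t v : ℝ)) := by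
    intro v
    rw [ENNReal.toReal_ofReal (hnn v), Complex.real_smul, Complex.ofReal_mul, Complex.ofReal_exp,
      Complex.ofReal_inv, mul_assoc, ← Complex.exp_add, real_inner_comm]
    congr 2
    push_cast
    ring
  simp_rw [h2]
  rw [integral_const_mul, h1]
  rw [h0] at hZc
  have hne : (Z : ℂ) ≠ 0 := by exact_mod_cast hZpos.ne'
  have h3 : Complex.exp (0 ^ 2 * (‖t‖ : ℂ) ^ 2 / (4 * (1 / 2))) = 1 := by simp
  rw [h3, mul_one] at hZc
  rw [← hZc, ← mul_assoc, inv_mul_cancel₀ hne, one_mul, Complex.I_sq]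
  congr 1
  ring

/-- The density of a nondegenerate Gaussian law. -/
lemma multivariateGaussian_eq_withDensity (a : EuclideanSpace ℝ (Fin m))
    {S : Matrix (Fin m) (Fin m) ℝ} (hS : S.PosDef) : ∃ c : ℝ, 0 < c ∧
    multivariateGaussian a S = volume.withDensity fun v =>
      ENNReal.ofReal (c * Real.exp (-((v - a).ofLp ⬝ᵥ S⁻¹ *ᵥ (v - a).ofLp) / 2)) := by
  obtain ⟨c, hc, h⟩ := stdGaussian_eq_withDensity m
  set R := CFC.sqrt S with hR
  have hRR : R * R = S := CFC.sqrt_mul_sqrt_self _ hS.posSemidef.nonneg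
  have hdet : IsUnit S.det := hS.det_pos.ne'.isUnit
  have hRdet : IsUnit R.det := by
    rw [← hRR, det_mul] at hdet
    exact isUnit_of_mul_isUnit_left hdet
  have hRT : Rᵀ = R := by
    have := (CFC.sqrt_nonneg S).isSelfAdjoint
    simpa [IsSelfAdjoint, star_eq_conjTranspose] using this
  have hkey : R * S⁻¹ * R = 1 := by
    rw [← hRR, Matrix.mul_inv_rev, ← mul_assoc, mul_nonsing_inv _ hRdet, one_mul,
      nonsing_inv_mul _ hRdet]
  set A := toEuclideanCLM (n := Fin m) (𝕜 := ℝ) R with hA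
  have hq : ∀ x : EuclideanSpace ℝ (Fin m),
      ((a + A x) - a).ofLp ⬝ᵥ S⁻¹ *ᵥ ((a + A x) - a).ofLp = ‖x‖ ^ 2 := fun x => by
    rw [add_sub_cancel_left, hA, ofLp_toEuclideanCLM, mulVec_mulVec, dotProduct_mulVec,
      vecMul_mulVec, hRT, ← mul_assoc, hkey, vecMul_one, EuclideanSpace.real_norm_sq_eq]
    simp [dotProduct, sq]
  have hdetA : LinearMap.det (A : EuclideanSpace ℝ (Fin m) →ₗ[ℝ] _) ≠ 0 := by
    have h1 : (A : EuclideanSpace ℝ (Fin m) →ₗ[ℝ] _) ∘ₗ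
        (toEuclideanCLM (n := Fin m) (𝕜 := ℝ) R⁻¹ : EuclideanSpace ℝ (Fin m) →ₗ[ℝ] _)
        = LinearMap.id := by
      ext x : 1
      have : A (toEuclideanCLM (n := Fin m) (𝕜 := ℝ) R⁻¹ x) = x := by
        rw [hA, ← mul_apply_eq_comp, ← map_mul, mul_nonsing_inv _ hRdet, map_one]
        rfl
      exact this
    intro h0
    have h2 := congrArg LinearMap.det h1
    rw [LinearMap.det_comp, h0, zero_mul, LinearMap.det_id] at h2
    exact zero_ne_one h2
  set κ : ℝ := |(LinearMap.det (A : EuclideanSpace ℝ (Fin m) →ₗ[ℝ] _))⁻¹| with hκ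
  have hκpos : 0 < κ := abs_pos.2 (inv_ne_zero hdetA)
  have hvol : (volume : Measure (EuclideanSpace ℝ (Fin m))).map (fun x => a + A x)
      = ENNReal.ofReal κ • volume := by
    have h1 : (fun x => a + A x) = (fun x => a + x) ∘ A := rfl
    have h2 := Measure.map_linearMap_addHaar_eq_smul_addHaar
      (volume : Measure (EuclideanSpace ℝ (Fin m))) hdetA
    have h3 : ((A : EuclideanSpace ℝ (Fin m) →ₗ[ℝ] _) : _ → EuclideanSpace ℝ (Fin m)) = A := rfl
    rw [h3] at h2
    rw [h1, ← Measure.map_map (measurable_const_add a) (by fun_prop), h2, Measure.map_smul,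
      map_add_left_eq_self]
  set h' : EuclideanSpace ℝ (Fin m) → ℝ≥0∞ := fun v =>
    ENNReal.ofReal (c * Real.exp (-((v - a).ofLp ⬝ᵥ S⁻¹ *ᵥ (v - a).ofLp) / 2)) with hh'
  have hmeas : Measurable h' := by
    simp only [hh', dotProduct, mulVec]
    fun_prop
  refine ⟨κ * c, by positivity, ?_⟩
  rw [multivariateGaussian, h]
  have h4 : (fun v : EuclideanSpace ℝ (Fin m) => ENNReal.ofReal (c * Real.exp (-(‖v‖ ^ 2) / 2)))
      = fun x => h' (a + A x) := by
    ext x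
    simp only [hh', hq]
  rw [h4, withDensity_comp_map (by fun_prop) hmeas, hvol, withDensity_smul_measure,
    ← withDensity_smul _ hmeas]
  congr 1
  ext v
  simp only [hh', Pi.smul_apply, smul_eq_mul]
  rw [← ENNReal.ofReal_mul hκpos.le, mul_assoc]

lemma multivariateGaussian_absolutelyContinuous (a b : EuclideanSpace ℝ (Fin m))
    {S T : Matrix (Fin m) (Fin m) ℝ} (hS : S.PosDef) (hT : T.PosDef) :
    multivariateGaussian a S ≪ multivariateGaussian b T := by
  obtain ⟨c, hc, h⟩ := multivariateGaussian_eq_withDensity a hS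
  obtain ⟨c', hc', h'⟩ := multivariateGaussian_eq_withDensity b hT
  rw [h, h']
  refine (withDensity_absolutelyContinuous _ _).trans (withDensity_absolutelyContinuous' ?_ ?_)
  · refine Measurable.aemeasurable ?_
    simp only [dotProduct, mulVec]
    fun_prop
  · refine ae_of_all _ fun v => ?_
    have : 0 < c' * Real.exp (-((v - b).ofLp ⬝ᵥ T⁻¹ *ᵥ (v - b).ofLp) / 2) := by positivity
    exact (ENNReal.ofReal_pos.2 this).ne'

/-- The precision matrix of the optimal law of the inducing variables: the prior precision plus the
information `σ⁻² ΦᵀΦ` in the design. -/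
noncomputable def precision (lam : Fin m → ℝ) (σ : ℝ) (Φ : Matrix (Fin n) (Fin m) ℝ) :
    Matrix (Fin m) (Fin m) ℝ :=
  diagonal (fun j => (lam j)⁻¹) + (σ ^ 2)⁻¹ • (Φᵀ * Φ)

lemma precision_mulVec (lam : Fin m → ℝ) (σ : ℝ) (Φ : Matrix (Fin n) (Fin m) ℝ) (v : Fin m → ℝ)
    (j : Fin m) : (precision lam σ Φ *ᵥ v) j
      = (lam j)⁻¹ * v j + (σ ^ 2)⁻¹ * (Φᵀ *ᵥ (Φ *ᵥ v)) j := by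
  rw [precision, add_mulVec, Pi.add_apply, mulVec_diagonal, smul_mulVec, Pi.smul_apply,
    mulVec_mulVec, smul_eq_mul]

lemma dotProduct_precision_mulVec (lam : Fin m → ℝ) (σ : ℝ) (Φ : Matrix (Fin n) (Fin m) ℝ)
    (v : Fin m → ℝ) : v ⬝ᵥ precision lam σ Φ *ᵥ v
      = ∑ j, (lam j)⁻¹ * v j ^ 2 + (σ ^ 2)⁻¹ * ∑ i, (Φ *ᵥ v) i ^ 2 := by
  rw [precision, add_mulVec, dotProduct_add, smul_mulVec, dotProduct_smul, ← mulVec_mulVec,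
    dotProduct_mulVec v Φᵀ, vecMul_transpose, smul_eq_mul]
  congr 1
  · simp only [dotProduct, mulVec_diagonal]
    exact Finset.sum_congr rfl fun j _ => by ring
  · simp only [dotProduct, sq]

lemma posDef_precision {lam : Fin m → ℝ} (hlam : ∀ j, 0 < lam j) (σ : ℝ)
    (Φ : Matrix (Fin n) (Fin m) ℝ) : (precision lam σ Φ).PosDef := by
  refine PosDef.add_posSemidef (PosDef.diagonal fun j => inv_pos.2 (hlam j)) ?_
  have := posSemidef_conjTranspose_mul_self Φ
  rw [conjTranspose_eq_transpose_of_trivial] at this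
  exact this.smul (by positivity)

/-- Bayes' formula in the linear Gaussian model: tilting the prior `N(0, diag lam)` with the
Gaussian likelihood gives a Gaussian law. -/
lemma multivariateGaussian_eq_tilt {lam : Fin m → ℝ} (hlam : ∀ j, 0 < lam j) (σ : ℝ)
    (Φ : Matrix (Fin n) (Fin m) ℝ) (y : Fin n → ℝ) (a : EuclideanSpace ℝ (Fin m))
    (ha : precision lam σ Φ *ᵥ a.ofLp = (σ ^ 2)⁻¹ • Φᵀ *ᵥ y) : ∃ c : ℝ, 0 < c ∧
    multivariateGaussian a (precision lam σ Φ)⁻¹ =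
      (multivariateGaussian 0 (diagonal lam)).withDensity fun v =>
        ENNReal.ofReal (c * Real.exp (-(σ ^ 2)⁻¹ / 2 * ∑ i, (y i - (Φ *ᵥ v.ofLp) i) ^ 2)) := by
  have hB := posDef_precision hlam σ Φ
  obtain ⟨c₁, hc₁, h₁⟩ := multivariateGaussian_eq_withDensity a hB.inv
  obtain ⟨c₀, hc₀, h₀⟩ := multivariateGaussian_eq_withDensity (m := m) 0 (PosDef.diagonal hlam)
  rw [nonsing_inv_nonsing_inv _ hB.det_pos.ne'.isUnit] at h₁
  have hdiag : (diagonal lam)⁻¹ = diagonal fun j => (lam j)⁻¹ := by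
    apply inv_eq_right_inv
    rw [diagonal_mul_diagonal, ← diagonal_one]
    congr 1
    ext j
    exact mul_inv_cancel₀ (hlam j).ne'
  set B := precision lam σ Φ with hBdef
  set q : ℝ := ((σ ^ 2)⁻¹ * (y ⬝ᵥ y) - a.ofLp ⬝ᵥ B *ᵥ a.ofLp) / 2 with hq
  refine ⟨c₁ / c₀ * Real.exp q, by positivity, ?_⟩
  rw [h₁, h₀, ← withDensity_mul]
  · congr 1
    ext v
    rw [Pi.mul_apply, ← ENNReal.ofReal_mul (by positivity)]
    congr 1
    have e1 : ∀ u w : ℝ, c₀ * Real.exp u * (c₁ / c₀ * Real.exp q * Real.exp w)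
        = c₁ * Real.exp (u + q + w) := fun u w => by
      rw [Real.exp_add, Real.exp_add]
      field_simp
    rw [e1]
    congr 2
    have hBT : Bᵀ = B := by
      have := hB.isHermitian
      rwa [IsHermitian, conjTranspose_eq_transpose_of_trivial] at this
    have e2 : (v - a).ofLp ⬝ᵥ B *ᵥ (v - a).ofLp = v.ofLp ⬝ᵥ B *ᵥ v.ofLp
        - 2 * (v.ofLp ⬝ᵥ B *ᵥ a.ofLp) + a.ofLp ⬝ᵥ B *ᵥ a.ofLp := by
      have e3 : a.ofLp ⬝ᵥ B *ᵥ v.ofLp = v.ofLp ⬝ᵥ B *ᵥ a.ofLp := by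
        rw [dotProduct_mulVec, ← mulVec_transpose, hBT, dotProduct_comm]
      rw [WithLp.ofLp_sub, mulVec_sub, sub_dotProduct, dotProduct_sub, dotProduct_sub, e3]
      ring
    have e4 : v.ofLp ⬝ᵥ B *ᵥ a.ofLp = (σ ^ 2)⁻¹ * ((Φ *ᵥ v.ofLp) ⬝ᵥ y) := by
      rw [ha, dotProduct_smul, smul_eq_mul, dotProduct_mulVec, vecMul_transpose]
    have e5 : ∑ i, (y i - (Φ *ᵥ v.ofLp) i) ^ 2 = y ⬝ᵥ y - 2 * ((Φ *ᵥ v.ofLp) ⬝ᵥ y)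
        + ∑ i, (Φ *ᵥ v.ofLp) i ^ 2 := by
      simp only [dotProduct, Finset.mul_sum, ← Finset.sum_sub_distrib, ← Finset.sum_add_distrib]
      exact Finset.sum_congr rfl fun i _ => by ring
    have e6 : (v - 0).ofLp ⬝ᵥ (diagonal lam)⁻¹ *ᵥ (v - 0).ofLp
        = ∑ j, (lam j)⁻¹ * v.ofLp j ^ 2 := by
      rw [sub_zero, hdiag]
      simp only [dotProduct, mulVec_diagonal]
      exact Finset.sum_congr rfl fun j _ => by ring
    rw [e2, e4, e5, e6, hBdef, dotProduct_precision_mulVec, ← hBdef, hq]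
    ring
  · simp only [dotProduct, mulVec]
    fun_prop
  · simp only [dotProduct, mulVec]
    fun_prop

end Density

/-! ### Reweighting the law of the inducing variables -/

section Reweight

variable {Ω : Type*} [MeasurableSpace Ω] {P : Measure Ω} [IsProbabilityMeasure P]
  {E F : Type*} [MeasurableSpace E] [MeasurableSpace F] {u : Ω → E}

/-- Changing the law of `u` by a density, while keeping the conditional law given `u`, amounts to
composing the density with `u`. -/
lemma bind_condDistrib_eq_withDensity [StandardBorelSpace Ω] [Nonempty Ω] (hu : Measurable u)
    {f : E → ℝ≥0∞} (hf : Measurable f) :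
    ((P.map u).withDensity f).bind (condDistrib id u P) = P.withDensity fun ω => f (u ω) := by
  ext A hA
  have hk : Measurable fun v => condDistrib id u P v A := Kernel.measurable_coe _ hA
  rw [Measure.bind_apply hA (Kernel.aemeasurable _), lintegral_withDensity_eq_lintegral_mul _ hf hk,
    withDensity_apply _ hA]
  have hF : Measurable fun p : E × Ω => f p.1 * A.indicator 1 p.2 :=
    (hf.comp measurable_fst).mul ((measurable_one.indicator hA).comp measurable_snd)
  have h1 := compProd_map_condDistrib (mβ := ‹MeasurableSpace E›) (X := u) (Y := id) (μ := P)
    measurable_id.aemeasurable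
  have h2 := congrArg (fun M => ∫⁻ p, f p.1 * A.indicator 1 p.2 ∂M) h1
  simp only [Measure.lintegral_compProd hF] at h2
  rw [lintegral_map hF (hu.prodMk measurable_id)] at h2
  simp only [id] at h2
  rw [← lintegral_indicator hA]
  convert! h2 using 1
  · refine lintegral_congr fun v => ?_
    rw [lintegral_const_mul _ (measurable_one.indicator hA), lintegral_indicator_one hA,
      Pi.mul_apply]
  · refine lintegral_congr fun ω => ?_
    by_cases h : ω ∈ A <;> simp [h]

/-- Variables that are independent of `u` remain so, with the same law, when the law of `u` is
changed by a density. -/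
lemma map_withDensity_of_indepFun (hu : Measurable u) {R : Ω → F} (hR : Measurable R)
    (h : IndepFun u R P) {f : E → ℝ≥0∞} (hf : Measurable f) :
    (P.withDensity fun ω => f (u ω)).map (fun ω => (u ω, R ω))
      = ((P.map u).withDensity f).prod (P.map R) := by
  have := withDensity_comp_map (μ := P) (hu.prodMk hR) (h := fun z : E × F => f z.1)
    (hf.comp measurable_fst)
  have hP := Measure.isProbabilityMeasure_map (μ := P) hR.aemeasurable
  simp only at this
  rw [this, (indepFun_iff_map_prod_eq_prod_map_map hu.aemeasurable hR.aemeasurable).1 h,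
    prod_withDensity_left hf]

end Reweight

/-! ### Uniqueness of the minimizer of the Kullback–Leibler divergence -/

section KL

open InformationTheory

variable {Ω : Type*} [MeasurableSpace Ω]

/-- If the log-density `g` of `Q'` with respect to `π` has the same mean under `Q` as under `Q'`,
then `klDiv Q π = klDiv Q Q' + klDiv Q' π`; so `Q` can do as well as `Q'` only if `Q = Q'`. -/
lemma eq_of_klDiv_le {Q Q' π : Measure Ω} [IsProbabilityMeasure Q] [IsProbabilityMeasure Q']
    [IsProbabilityMeasure π] {g : Ω → ℝ} (hg : Measurable g)
    (hQ' : Q' = π.withDensity fun ω => ENNReal.ofReal (Real.exp (g ω))) (hac : Q ≪ Q')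
    (hgQ : Integrable g Q) (hgQ' : Integrable g Q') (heq : ∫ ω, g ω ∂Q = ∫ ω, g ω ∂Q')
    (hle : klDiv Q π ≤ klDiv Q' π) : Q = Q' := by
  have hac' : Q' ≪ π := by rw [hQ']; exact withDensity_absolutelyContinuous _ _
  have hrn : Q'.rnDeriv π =ᵐ[π] fun ω => ENNReal.ofReal (Real.exp (g ω)) := by
    conv_lhs => rw [hQ']
    exact Measure.rnDeriv_withDensity π (by fun_prop)
  have hllr' : llr Q' π =ᵐ[Q'] g := by
    filter_upwards [hac'.ae_le hrn] with ω h
    rw [llr, h, ENNReal.toReal_ofReal (Real.exp_pos _).le, Real.log_exp]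
  have hint' : Integrable (llr Q' π) Q' := hgQ'.congr hllr'.symm
  have hfin' : klDiv Q' π ≠ ∞ := klDiv_ne_top hac' hint'
  have hfin : klDiv Q π ≠ ∞ := ne_top_of_le_ne_top hfin' hle
  have hQπ := (klDiv_ne_top_iff.1 hfin)
  have hllr : llr Q π =ᵐ[Q] fun ω => llr Q Q' ω + g ω := by
    filter_upwards [hQπ.1.ae_le (Measure.rnDeriv_mul_rnDeriv (κ := π) hac), hQπ.1.ae_le hrn,
      Measure.rnDeriv_pos hac, hac.ae_le (Measure.rnDeriv_lt_top Q Q')] with ω h1 h2 h3 h4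
    rw [llr, llr, ← h1, Pi.mul_apply, h2, ENNReal.toReal_mul,
      ENNReal.toReal_ofReal (Real.exp_pos _).le, Real.log_mul (ENNReal.toReal_pos h3.ne' h4.ne).ne'
        (Real.exp_pos _).ne', Real.log_exp]
  have hint : Integrable (llr Q Q') Q := by
    have h := (hQπ.2.congr hllr).sub hgQ
    refine h.congr (ae_of_all _ fun ω => ?_)
    simp
  have h1 : ∫ ω, llr Q π ω ∂Q = ∫ ω, llr Q Q' ω ∂Q + ∫ ω, g ω ∂Q := by
    rw [integral_congr_ae hllr, integral_add hint hgQ]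
  have h2 : (klDiv Q π).toReal ≤ (klDiv Q' π).toReal := ENNReal.toReal_mono hfin' hle
  rw [toReal_klDiv_of_measure_eq hQπ.1 (by simp), toReal_klDiv_of_measure_eq hac' (by simp), h1,
    integral_congr_ae hllr', heq] at h2
  have h3 := toReal_klDiv_of_measure_eq hac (by simp)
  have h4 : (klDiv Q Q').toReal = 0 :=
    le_antisymm (by rw [h3]; linarith) ENNReal.toReal_nonneg
  exact klDiv_eq_zero_iff.1 (((ENNReal.toReal_eq_zero_iff _).1 h4).resolve_right
    (klDiv_ne_top hac hint))

end KL

/-! ### The variational posterior -/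

section Variational

variable {X : Type*} [MeasurableSpace X] {μ : Measure X} [IsProbabilityMeasure μ]
  {φ : ℕ → X → ℝ} {k : X → X → ℝ} {lam : ℕ → ℝ} {C : ℝ}
  {Ω : Type*} [MeasurableSpace Ω] {P : Measure Ω} [IsProbabilityMeasure P] {G : X → Ω → ℝ}
  {m n : ℕ}

/-- `Q` is the law under which the inducing variables are `N(a, S)`, and the residual process is
independent of them with the same law as under the prior `P`. -/
structure IsReweighting (μ : Measure X) (φ : ℕ → X → ℝ) (P : Measure Ω) (G : X → Ω → ℝ) {m : ℕ}
    (a : EuclideanSpace ℝ (Fin m)) (S : Matrix (Fin m) (Fin m) ℝ) (Q : Measure Ω) : Prop where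
  ac : Q ≪ P
  posSemidef : S.PosSemidef
  map_eq : Q.map (fun ω => (spectralFeatures μ φ G m ω, fun s => residual μ φ G m s ω))
    = (multivariateGaussian a S).prod (P.map fun ω s => residual μ φ G m s ω)

variable (hk : IsMercerDecomposition μ k lam φ) (hC : ∀ j t, |φ j t| ≤ C) (hG : IsGPPrior P k G)
include hk hC hG

lemma measurable_residual_pi (m : ℕ) : Measurable fun ω s => residual μ φ G m s ω :=
  measurable_pi_lambda _ fun s => measurable_residual hk hC hG m s

lemma isReweighting_of_withDensity {a : EuclideanSpace ℝ (Fin m)} {S : Matrix (Fin m) (Fin m) ℝ}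
    (hS : S.PosDef) {f : EuclideanSpace ℝ (Fin m) → ℝ≥0∞} (hf : Measurable f)
    (h : multivariateGaussian a S = (P.map (spectralFeatures μ φ G m)).withDensity f) :
    IsReweighting μ φ P G a S (P.withDensity fun ω => f (spectralFeatures μ φ G m ω)) where
  ac := withDensity_absolutelyContinuous _ _
  posSemidef := hS.posSemidef
  map_eq := by
    rw [map_withDensity_of_indepFun (measurable_spectralFeatures hk hC hG m)
      (measurable_residual_pi hk hC hG m) (indepFun_spectralFeatures_residual hk hC hG m) hf, h]

lemma isReweighting_of_bind [StandardBorelSpace Ω] [Nonempty Ω] (hlam : ∀ j, 0 < lam j)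
    {a : EuclideanSpace ℝ (Fin m)} {S : Matrix (Fin m) (Fin m) ℝ} (hS : S.PosDef) :
    IsReweighting μ φ P G a S
      ((multivariateGaussian a S).bind (condDistrib id (spectralFeatures μ φ G m) P)) := by
  have hu := measurable_spectralFeatures hk hC hG m
  have hac : multivariateGaussian a S ≪ P.map (spectralFeatures μ φ G m) := by
    rw [map_spectralFeatures hk hC hG]
    exact multivariateGaussian_absolutelyContinuous _ _ hS
      (Matrix.PosDef.diagonal fun j : Fin m => hlam j)
  have hp := Measure.isProbabilityMeasure_map (μ := P) hu.aemeasurable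
  have hq : IsProbabilityMeasure (multivariateGaussian a S) := inferInstance
  have hd := Measure.haveLebesgueDecomposition_of_sigmaFinite (multivariateGaussian a S)
    (P.map (spectralFeatures μ φ G m))
  have hrn := (Measure.withDensity_rnDeriv_eq _ _ hac).symm
  have hf := Measure.measurable_rnDeriv (multivariateGaussian a S)
    (P.map (spectralFeatures μ φ G m))
  have h := isReweighting_of_withDensity hk hC hG hS hf hrn
  rw [← bind_condDistrib_eq_withDensity hu hf, ← hrn] at h
  exact h

namespace IsReweighting

variable {a : EuclideanSpace ℝ (Fin m)} {S : Matrix (Fin m) (Fin m) ℝ} {Q : Measure Ω}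
  (hQ : IsReweighting μ φ P G a S Q)
include hQ

lemma measurable_pair :
    Measurable fun ω => (spectralFeatures μ φ G m ω, fun s => residual μ φ G m s ω) :=
  (measurable_spectralFeatures hk hC hG m).prodMk (measurable_residual_pi hk hC hG m)

lemma isProbabilityMeasure : IsProbabilityMeasure Q := by
  have h1 := Measure.isProbabilityMeasure_map (μ := P)
    (measurable_residual_pi hk hC hG m).aemeasurable
  constructor
  have h2 := congrArg (fun M => M Set.univ) hQ.map_eq
  simp only [Measure.map_apply (hQ.measurable_pair hk hC hG) MeasurableSet.univ,
    Set.preimage_univ, measure_univ] at h2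
  exact h2

lemma map_spectralFeatures : Q.map (spectralFeatures μ φ G m) = multivariateGaussian a S := by
  have h1 := Measure.isProbabilityMeasure_map (μ := P)
    (measurable_residual_pi hk hC hG m).aemeasurable
  have h2 := congrArg (fun M => M.map Prod.fst) hQ.map_eq
  simp only [Measure.map_map measurable_fst (hQ.measurable_pair hk hC hG), Measure.map_fst_prod,
    measure_univ, one_smul] at h2
  exact h2

lemma map_residual_pi : Q.map (fun ω s => residual μ φ G m s ω)
    = P.map fun ω s => residual μ φ G m s ω := by
  have h1 := Measure.isProbabilityMeasure_map (μ := P)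
    (measurable_residual_pi hk hC hG m).aemeasurable
  have h2 := congrArg (fun M => M.map Prod.snd) hQ.map_eq
  simp only [Measure.map_map measurable_snd (hQ.measurable_pair hk hC hG), Measure.map_snd_prod,
    measure_univ, one_smul] at h2
  exact h2

lemma map_residual (s : X ⊕ ℕ) :
    Q.map (residual μ φ G m s) = P.map (residual μ φ G m s) := by
  have h := congrArg (fun M => M.map fun z => z s) (hQ.map_residual_pi hk hC hG)
  simp only [Measure.map_map (measurable_pi_apply s) (measurable_residual_pi hk hC hG m)] at h
  exact h

lemma indepFun (s : X ⊕ ℕ) : IndepFun (spectralFeatures μ φ G m) (residual μ φ G m s) Q := by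
  have := hQ.isProbabilityMeasure hk hC hG
  have hu := measurable_spectralFeatures hk hC hG m
  have hR := measurable_residual_pi hk hC hG m
  have h : IndepFun (spectralFeatures μ φ G m) (fun ω s => residual μ φ G m s ω) Q := by
    rw [indepFun_iff_map_prod_eq_prod_map_map hu.aemeasurable hR.aemeasurable, hQ.map_eq,
      hQ.map_spectralFeatures hk hC hG, hQ.map_residual_pi hk hC hG]
  exact h.comp measurable_id (measurable_pi_apply s)

/-- The marginal laws of the features of index below `m`. -/
lemma map_feature (j : Fin m) :
    Q.map (feature μ φ G j) = gaussianReal (a j) (S j j).toNNReal := by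
  have h := (measurePreserving_eval_multivariateGaussian hQ.posSemidef (μ := a) (i := j)).map_eq
  rw [← hQ.map_spectralFeatures hk hC hG, Measure.map_map (by fun_prop)
    (measurable_spectralFeatures hk hC hG m)] at h
  exact h

/-- The marginal laws of the features of index at least `m`. -/
lemma map_feature_of_le {j : ℕ} (hj : m ≤ j) :
    Q.map (feature μ φ G j) = gaussianReal 0 (lam j).toNNReal := by
  have h := hQ.map_residual hk hC hG (Sum.inr (j - m))
  have e : residual μ φ G m (Sum.inr (j - m)) = feature μ φ G j := by
    simp only [residual, Sum.elim_inr]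
    congr 1
    omega
  rw [e, SparseGP.map_feature hk hC hG] at h
  exact h

lemma memLp_feature (j : Fin m) : MemLp (feature μ φ G j) 2 Q := by
  have h := (measurable_feature hk hC hG j).aemeasurable (μ := Q)
  rw [← Function.id_comp (feature μ φ G j), ← memLp_map_measure_iff (by fun_prop) h,
    hQ.map_feature hk hC hG]
  exact memLp_id_gaussianReal' 2 (by norm_num)

lemma integral_feature (j : Fin m) : ∫ ω, feature μ φ G j ω ∂Q = a j := by
  have h := (measurable_feature hk hC hG j).aemeasurable (μ := Q)
  have h1 := integral_map (f := fun x : ℝ => x) h (by fun_prop)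
  rw [hQ.map_feature hk hC hG, integral_id_gaussianReal] at h1
  exact h1.symm

lemma memLp_residual (s : X ⊕ ℕ) : MemLp (residual μ φ G m s) 2 Q := by
  have h := (measurable_residual hk hC hG m s)
  rw [← Function.id_comp (residual μ φ G m s), ← memLp_map_measure_iff (by fun_prop) h.aemeasurable,
    hQ.map_residual hk hC hG, memLp_map_measure_iff (by fun_prop) h.aemeasurable]
  exact SparseGP.memLp_residual hk hC hG m s

lemma integral_comp_residual (s : X ⊕ ℕ) {F : ℝ → ℝ} (hF : Measurable F) :
    ∫ ω, F (residual μ φ G m s ω) ∂Q = ∫ ω, F (residual μ φ G m s ω) ∂P := by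
  have h := (measurable_residual hk hC hG m s)
  rw [← integral_map (f := F) h.aemeasurable hF.aestronglyMeasurable, hQ.map_residual hk hC hG,
    integral_map (f := F) h.aemeasurable hF.aestronglyMeasurable]

lemma integral_residual (t : X) : ∫ ω, residual μ φ G m (Sum.inl t) ω ∂Q = 0 := by
  rw [hQ.integral_comp_residual hk hC hG (Sum.inl t) (F := fun x => x) measurable_id]
  simp only [residual, Sum.elim_inl]
  have h1 : ∀ j : Fin m, Integrable (fun ω => φ j t * feature μ φ G j ω) P := fun j =>
    ((SparseGP.memLp_feature hk hC hG j).integrable (by norm_num)).const_mul _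
  rw [integral_sub ((hG.memLp t).integrable (by norm_num)) (integrable_finsetSum _ fun j _ => h1 j),
    integral_finsetSum _ fun j _ => h1 j, hG.mean_zero]
  simp [integral_const_mul, SparseGP.integral_feature hk hC hG]

omit hk hC hG hQ in
lemma prior_eq_sum_add_residual (t : X) (ω : Ω) : G t ω
    = ∑ j : Fin m, φ j t * feature μ φ G j ω + residual μ φ G m (Sum.inl t) ω := by
  simp [residual]

lemma memLp_sum_feature (t : X) :
    MemLp (fun ω => ∑ j : Fin m, φ j t * feature μ φ G j ω) 2 Q :=
  memLp_finsetSum _ fun j _ => (hQ.memLp_feature hk hC hG j).const_mul _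

/-- The mean function under `Q` is a linear combination of the first `m` eigenfunctions. -/
lemma meanFunction_eq (t : X) : meanFunction G Q t = ∑ j : Fin m, a j * φ j t := by
  have := hQ.isProbabilityMeasure hk hC hG
  have h1 : ∀ j : Fin m, Integrable (fun ω => φ j t * feature μ φ G j ω) Q := fun j =>
    ((hQ.memLp_feature hk hC hG j).integrable (by norm_num)).const_mul _
  rw [meanFunction]
  simp_rw [prior_eq_sum_add_residual (μ := μ) (φ := φ) (G := G) (m := m) t]
  rw [integral_add ((hQ.memLp_sum_feature hk hC hG t).integrable (by norm_num))
    ((hQ.memLp_residual hk hC hG _).integrable (by norm_num)), hQ.integral_residual hk hC hG,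
    add_zero, integral_finsetSum _ fun j _ => h1 j]
  simp [integral_const_mul, hQ.integral_feature hk hC hG, mul_comm]

/-- The difference of the squared residuals with and without conditioning on the inducing variables
has a mean that depends on the prior only. -/
lemma integral_sq_sub_sq (t : X) (z : ℝ) :
    Integrable (fun ω => (z - G t ω) ^ 2 - (z - ∑ j : Fin m, φ j t * feature μ φ G j ω) ^ 2) Q ∧
    ∫ ω, ((z - G t ω) ^ 2 - (z - ∑ j : Fin m, φ j t * feature μ φ G j ω) ^ 2) ∂Q
      = ∫ ω, residual μ φ G m (Sum.inl t) ω ^ 2 ∂P := by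
  have := hQ.isProbabilityMeasure hk hC hG
  have hR := hQ.memLp_residual hk hC hG (Sum.inl t)
  have hp : MemLp (fun ω => z - ∑ j : Fin m, φ j t * feature μ φ G j ω) 2 Q :=
    (memLp_const z).sub (hQ.memLp_sum_feature hk hC hG t)
  have e : (fun ω => (z - G t ω) ^ 2 - (z - ∑ j : Fin m, φ j t * feature μ φ G j ω) ^ 2)
      = fun ω => residual μ φ G m (Sum.inl t) ω ^ 2 - 2 * ((z - ∑ j : Fin m, φ j t *
        feature μ φ G j ω) * residual μ φ G m (Sum.inl t) ω) := by
    ext ω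
    rw [prior_eq_sum_add_residual (μ := μ) (φ := φ) (G := G) (m := m) t ω]
    ring
  have hi2 : Integrable (fun ω => 2 * ((z - ∑ j : Fin m, φ j t *
        feature μ φ G j ω) * residual μ φ G m (Sum.inl t) ω)) Q :=
    (hp.integrable_mul hR).const_mul 2
  rw [e]
  refine ⟨hR.integrable_sq.sub hi2, ?_⟩
  have hind : IndepFun (fun ω => z - ∑ j : Fin m, φ j t * feature μ φ G j ω)
      (residual μ φ G m (Sum.inl t)) Q := by
    have h := (hQ.indepFun hk hC hG (Sum.inl t)).comp
      (φ := fun v : EuclideanSpace ℝ (Fin m) => z - ∑ j : Fin m, φ j t * v j)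
      (by fun_prop) measurable_id
    exact h
  have h0 := hind.integral_fun_mul_eq_mul_integral hp.1 hR.1
  rw [integral_sub hR.integrable_sq hi2, integral_const_mul, h0, hQ.integral_residual hk hC hG,
    mul_zero, mul_zero, sub_zero]
  exact hQ.integral_comp_residual hk hC hG (Sum.inl t) (F := fun x => x ^ 2) (by fun_prop)

end IsReweighting

/-- The design matrix `φ j (x i)` of the first `m` eigenfunctions. -/
def designMatrix (φ : ℕ → X → ℝ) (m : ℕ) {n : ℕ} (x : Fin n → X) : Matrix (Fin n) (Fin m) ℝ :=
  Matrix.of fun i j => φ j (x i)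

omit hk hC hG in
lemma likelihood_eq {σ : ℝ} (x : Fin n → X) (y : Fin n → ℝ) (ω : Ω) :
    likelihood σ G x y ω = ENNReal.ofReal ((Real.sqrt (2 * Real.pi * σ ^ 2))⁻¹ ^ n *
      Real.exp (-(σ ^ 2)⁻¹ / 2 * ∑ i, (y i - G (x i) ω) ^ 2)) := by
  simp only [likelihood, gaussianPDF, gaussianPDFReal, Real.coe_toNNReal _ (sq_nonneg σ)]
  rw [← ENNReal.ofReal_prod_of_nonneg fun i _ => by positivity, Finset.prod_mul_distrib,
    Finset.prod_const, Finset.card_univ, Fintype.card_fin, ← Real.exp_sum, Finset.mul_sum]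
  congr 3
  refine Finset.sum_congr rfl fun i _ => ?_
  field_simp

/-- The variational posterior makes the inducing variables Gaussian with precision matrix
`precision` and with the posterior mean of the linear model, and leaves the residual process
as it is. -/
lemma isReweighting_of_isVariationalPosterior [StandardBorelSpace Ω] [Nonempty Ω]
    (hlam : ∀ j, 0 < lam j) {σ : ℝ} (hσ : 0 < σ) {x : Fin n → X} {y : Fin n → ℝ} {Q : Measure Ω}
    (hQ : IsVariationalPosterior μ φ P σ G m x y Q) {a : EuclideanSpace ℝ (Fin m)}
    (ha : (precision (fun j : Fin m => lam j) σ (designMatrix φ m x)).mulVec a.ofLp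
      = (σ ^ 2)⁻¹ • (designMatrix φ m x).transpose.mulVec y) :
    IsReweighting μ φ P G a (precision (fun j : Fin m => lam j) σ (designMatrix φ m x))⁻¹ Q := by
  obtain ⟨hmin, a', S', hS', hQeq⟩ := hQ
  set B := precision (fun j : Fin m => lam j) σ (designMatrix φ m x) with hB
  have hBpos : B.PosDef := posDef_precision (fun j => hlam j) σ _
  set u := spectralFeatures μ φ G m with hu
  have humeas : Measurable u := measurable_spectralFeatures hk hC hG m
  set Q' := (multivariateGaussian a B⁻¹).bind (condDistrib id u P) with hQ'
  have hQR : IsReweighting μ φ P G a' S' Q := by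
    rw [hQeq]; exact isReweighting_of_bind hk hC hG hlam hS'
  have hQR' : IsReweighting μ φ P G a B⁻¹ Q' := isReweighting_of_bind hk hC hG hlam hBpos.inv
  suffices Q = Q' by rw [this]; exact hQR'
  have hp := hQR.isProbabilityMeasure hk hC hG
  have hp' := hQR'.isProbabilityMeasure hk hC hG
  -- the density of `Q'` with respect to the prior
  obtain ⟨c, hc, htilt⟩ := multivariateGaussian_eq_tilt (fun j : Fin m => hlam j) σ
    (designMatrix φ m x) y a ha
  rw [← SparseGP.map_spectralFeatures hk hC hG m, ← hB] at htilt
  have hfit : ∀ ω i, ((designMatrix φ m x).mulVec (u ω).ofLp) i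
      = ∑ j : Fin m, φ j (x i) * feature μ φ G j ω := fun ω i => rfl
  have hdens : Q' = P.withDensity fun ω => ENNReal.ofReal (c * Real.exp (-(σ ^ 2)⁻¹ / 2 *
      ∑ i, (y i - ∑ j : Fin m, φ j (x i) * feature μ φ G j ω) ^ 2)) := by
    rw [hQ', htilt, bind_condDistrib_eq_withDensity humeas]
    · rfl
    · simp only [dotProduct, Matrix.mulVec]
      fun_prop
  -- the posterior
  set K : ℝ := (Real.sqrt (2 * Real.pi * σ ^ 2))⁻¹ ^ n with hK
  have hKpos : 0 < K := by positivity
  set L : Ω → ℝ := fun ω => -(σ ^ 2)⁻¹ / 2 * ∑ i, (y i - G (x i) ω) ^ 2 with hL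
  have hGm : ∀ i, Measurable (G (x i)) := fun i => hG.measurable_eval _
  have hLm : Measurable L := by fun_prop
  have hlik : likelihood σ G x y = fun ω => ENNReal.ofReal (K * Real.exp (L ω)) :=
    funext fun ω => likelihood_eq x y ω
  have hL0 : ∀ ω, L ω ≤ 0 := fun ω => by
    have h1 : 0 ≤ ∑ i, (y i - G (x i) ω) ^ 2 := Finset.sum_nonneg fun i _ => sq_nonneg _
    have h2 : 0 ≤ (σ ^ 2)⁻¹ / 2 := by positivity
    simp only [hL]
    nlinarith
  set Z := ∫⁻ ω, likelihood σ G x y ω ∂P with hZ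
  have hlikm : Measurable (likelihood σ G x y) := by rw [hlik]; fun_prop
  have hZ0 : Z ≠ 0 := by
    rw [hZ, Ne, lintegral_eq_zero_iff hlikm]
    intro h
    have h1 : ∀ᵐ ω ∂P, False := by
      filter_upwards [h] with ω hω
      rw [hlik] at hω
      have : 0 < K * Real.exp (L ω) := by positivity
      exact (ENNReal.ofReal_pos.2 this).ne' hω
    simp only [eventually_false_iff_eq_bot, ae_eq_bot] at h1
    exact IsProbabilityMeasure.ne_zero P h1
  have hZtop : Z ≠ ∞ := by
    have : Z ≤ ∫⁻ _, ENNReal.ofReal K ∂P := by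
      rw [hZ, hlik]
      refine lintegral_mono fun ω => ENNReal.ofReal_le_ofReal ?_
      have := Real.exp_le_one_iff.2 (hL0 ω)
      nlinarith
    refine ne_top_of_le_ne_top ?_ this
    simp
  have hπ : posterior P σ G x y = Z⁻¹ • P.withDensity (likelihood σ G x y) := rfl
  have hπp : IsProbabilityMeasure (posterior P σ G x y) := by
    constructor
    rw [hπ, Measure.smul_apply, withDensity_apply _ MeasurableSet.univ, setLIntegral_univ,
      smul_eq_mul]
    exact ENNReal.inv_mul_cancel hZ0 hZtop
  have hZr : 0 < Z.toReal := ENNReal.toReal_pos hZ0 hZtop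
  -- the log-density of `Q'` with respect to the posterior; it depends on the inducing variables
  -- only through their products with the residual process, which have mean zero under every member
  -- of the variational class, so its mean is the same for all of them
  set g : Ω → ℝ := fun ω => Real.log (c * Z.toReal / K) + (σ ^ 2)⁻¹ / 2 * ∑ i,
    ((y i - G (x i) ω) ^ 2 - (y i - ∑ j : Fin m, φ j (x i) * feature μ φ G j ω) ^ 2) with hg
  have hfm : ∀ j, Measurable (feature μ φ G j) := fun j => measurable_feature hk hC hG j
  have hgm : Measurable g := by fun_prop
  have hgI : ∀ {b : EuclideanSpace ℝ (Fin m)} {T : Matrix (Fin m) (Fin m) ℝ} {ν : Measure Ω},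
      IsReweighting μ φ P G b T ν → Integrable g ν ∧ ∫ ω, g ω ∂ν
        = Real.log (c * Z.toReal / K) + (σ ^ 2)⁻¹ / 2 *
          ∑ i, ∫ ω, residual μ φ G m (Sum.inl (x i)) ω ^ 2 ∂P := by
    intro b T ν hR
    have := hR.isProbabilityMeasure hk hC hG
    have h1 : ∀ i, Integrable (fun ω => (y i - G (x i) ω) ^ 2
        - (y i - ∑ j : Fin m, φ j (x i) * feature μ φ G j ω) ^ 2) ν := fun i =>
      (hR.integral_sq_sub_sq hk hC hG (x i) (y i)).1
    have h2 : Integrable (fun ω => (σ ^ 2)⁻¹ / 2 * ∑ i, ((y i - G (x i) ω) ^ 2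
        - (y i - ∑ j : Fin m, φ j (x i) * feature μ φ G j ω) ^ 2)) ν :=
      (integrable_finsetSum _ fun i _ => h1 i).const_mul _
    refine ⟨(integrable_const _).add h2, ?_⟩
    rw [hg, integral_add (integrable_const _) h2, integral_const_mul,
      integral_finsetSum _ fun i _ => h1 i]
    simp only [(hR.integral_sq_sub_sq hk hC hG _ _).2]
    simp
  have hQ'π : Q' = (posterior P σ G x y).withDensity
      fun ω => ENNReal.ofReal (Real.exp (g ω)) := by
    rw [hπ, withDensity_smul_measure, ← withDensity_mul _ hlikm (by fun_prop),
      ← withDensity_smul _ (hlikm.mul (by fun_prop)), hdens]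
    congr 1
    ext ω
    rw [Pi.smul_apply, Pi.mul_apply, hlik, smul_eq_mul, ← ENNReal.ofReal_toReal hZtop,
      ← ENNReal.ofReal_inv_of_pos hZr, ← ENNReal.ofReal_mul (by positivity),
      ← ENNReal.ofReal_mul (by positivity)]
    congr 1
    have e1 : Real.exp (g ω) = c * Z.toReal / K * Real.exp ((σ ^ 2)⁻¹ / 2 * ∑ i,
        ((y i - G (x i) ω) ^ 2 - (y i - ∑ j : Fin m, φ j (x i) * feature μ φ G j ω) ^ 2)) := by
      rw [hg, Real.exp_add, Real.exp_log (by positivity)]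
    have e2 : Real.exp (-(σ ^ 2)⁻¹ / 2 *
        ∑ i, (y i - ∑ j : Fin m, φ j (x i) * feature μ φ G j ω) ^ 2)
        = Real.exp (L ω) * Real.exp ((σ ^ 2)⁻¹ / 2 * ∑ i, ((y i - G (x i) ω) ^ 2
          - (y i - ∑ j : Fin m, φ j (x i) * feature μ φ G j ω) ^ 2)) := by
      rw [← Real.exp_add, Finset.sum_sub_distrib]
      congr 1
      simp only [hL]
      ring
    rw [e1, e2]
    field_simp
  have hac : Q ≪ Q' := by
    refine hQR.ac.trans ?_
    rw [hdens]
    refine withDensity_absolutelyContinuous' (Measurable.aemeasurable (by fun_prop))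
      (ae_of_all _ fun ω => ?_)
    have : 0 < c * Real.exp (-(σ ^ 2)⁻¹ / 2 *
      ∑ i, (y i - ∑ j : Fin m, φ j (x i) * feature μ φ G j ω) ^ 2) := by positivity
    exact (ENNReal.ofReal_pos.2 this).ne'
  refine eq_of_klDiv_le hgm hQ'π hac (hgI hQR).1 (hgI hQR').1
    ((hgI hQR).2.trans (hgI hQR').2.symm) (hmin ⟨a, B⁻¹, hBpos.inv, rfl⟩)

end Variational

/-! ### Two-sided bounds on the credible radius -/

section GaussianMoments

/-- The Laplace transform of the square of a centered Gaussian variable. -/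
lemma integral_exp_neg_sq_gaussianReal {v : ℝ} (hv : 0 < v) {s : ℝ} (hs : 0 < s) :
    ∫ x, Real.exp (-(s / v) * x ^ 2) ∂(gaussianReal 0 v.toNNReal) = 1 / Real.sqrt (1 + 2 * s) := by
  have hv' : v.toNNReal ≠ 0 := (Real.toNNReal_pos.2 hv).ne'
  rw [integral_gaussianReal_eq_integral_smul hv']
  simp only [gaussianPDFReal, Real.coe_toNNReal _ hv.le, smul_eq_mul, sub_zero]
  have h1 : ∀ x : ℝ, (Real.sqrt (2 * Real.pi * v))⁻¹ * Real.exp (-x ^ 2 / (2 * v)) *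
      Real.exp (-(s / v) * x ^ 2)
      = (Real.sqrt (2 * Real.pi * v))⁻¹ * Real.exp (-((1 + 2 * s) / (2 * v)) * x ^ 2) := fun x => by
    rw [mul_assoc, ← Real.exp_add]
    congr 2
    field_simp
    ring
  simp_rw [h1]
  rw [integral_const_mul, integral_gaussian, ← Real.sqrt_inv, ← Real.sqrt_mul (by positivity),
    ← Real.sqrt_one, ← Real.sqrt_div (by norm_num), Real.sqrt_one]
  congr 1
  have := Real.pi_pos
  field_simp

lemma integral_sq_gaussianReal (v : ℝ≥0) : ∫ x, x ^ 2 ∂(gaussianReal 0 v) = v := by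
  have h1 := variance_fun_id_gaussianReal (μ := 0) (v := v)
  rwa [variance_of_integral_eq_zero (by fun_prop) integral_id_gaussianReal] at h1

lemma lintegral_sq_gaussianReal {v : ℝ} (hv : 0 ≤ v) :
    ∫⁻ x, ENNReal.ofReal (x ^ 2) ∂(gaussianReal 0 v.toNNReal) = ENNReal.ofReal v := by
  rw [← ofReal_integral_eq_lintegral_ofReal, integral_sq_gaussianReal, Real.coe_toNNReal _ hv]
  · exact (memLp_id_gaussianReal' 2 (by norm_num)).integrable_sq
  · exact ae_of_all _ fun x => sq_nonneg x

/-- A small-ball bound for a sum of squares of centered Gaussian variables, whatever their joint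
law: by convexity, the Laplace transform of a weighted mean of `χ²₁` variables is at most that of
a single one. -/
lemma measure_sum_sq_le {Ω ι : Type*} [MeasurableSpace Ω] {Q : Measure Ω} [IsProbabilityMeasure Q]
    {z : ι → Ω → ℝ} {v : ι → ℝ} (I : Finset ι) (hI : I.Nonempty) (hv : ∀ j ∈ I, 0 < v j)
    (hzm : ∀ j, Measurable (z j)) (hz : ∀ j ∈ I, Q.map (z j) = gaussianReal 0 (v j).toNNReal)
    {s : ℝ} (hs : 0 < s) :
    Q.real {ω | ∑ j ∈ I, z j ω ^ 2 ≤ (∑ j ∈ I, v j) / s} ≤ Real.exp 1 / Real.sqrt (1 + 2 * s) := by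
  set V := ∑ j ∈ I, v j with hV
  have hVpos : 0 < V := Finset.sum_pos hv hI
  set f : Ω → ℝ := fun ω => Real.exp (1 - s / V * ∑ j ∈ I, z j ω ^ 2) with hf
  have hfm : Measurable f := by fun_prop
  have hsum : ∀ ω, 0 ≤ ∑ j ∈ I, z j ω ^ 2 := fun ω => Finset.sum_nonneg fun j _ => sq_nonneg _
  have hfi : Integrable f Q := by
    refine Integrable.of_bound (C := Real.exp 1) hfm.aestronglyMeasurable (ae_of_all _ fun ω => ?_)
    rw [Real.norm_of_nonneg (Real.exp_pos _).le, Real.exp_le_exp]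
    have := mul_nonneg (div_pos hs hVpos).le (hsum ω)
    linarith
  have h1 := mul_meas_ge_le_integral_of_nonneg (ae_of_all _ fun ω => (Real.exp_pos _).le) hfi 1
  rw [one_mul] at h1
  have h2 : {ω | ∑ j ∈ I, z j ω ^ 2 ≤ V / s} ⊆ {ω | 1 ≤ f ω} := fun ω hω => by
    simp only [Set.mem_ofPred_eq, hf] at hω ⊢
    refine Real.one_le_exp ?_
    have : s / V * ∑ j ∈ I, z j ω ^ 2 ≤ s / V * (V / s) :=
      mul_le_mul_of_nonneg_left hω (div_pos hs hVpos).le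
    have e : s / V * (V / s) = 1 := by field_simp
    linarith
  refine (measureReal_mono h2).trans (h1.trans ?_)
  have hgi : ∀ j ∈ I, Integrable (fun ω => v j / V * Real.exp (-(s / v j) * z j ω ^ 2)) Q := by
    intro j hj
    refine Integrable.const_mul ?_ _
    have := hzm j
    refine Integrable.of_bound (C := 1) (by fun_prop) (ae_of_all _ fun ω => ?_)
    rw [Real.norm_of_nonneg (Real.exp_pos _).le, Real.exp_le_one_iff]
    have := mul_nonneg (div_pos hs (hv j hj)).le (sq_nonneg (z j ω))
    linarith
  have hle : ∀ ω, f ω ≤ Real.exp 1 * ∑ j ∈ I, v j / V * Real.exp (-(s / v j) * z j ω ^ 2) := by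
    intro ω
    have h3 : ∑ j ∈ I, (v j / V) • (-(s / v j) * z j ω ^ 2) = - (s / V * ∑ j ∈ I, z j ω ^ 2) := by
      rw [Finset.mul_sum, ← Finset.sum_neg_distrib]
      refine Finset.sum_congr rfl fun j hj => ?_
      have := (hv j hj).ne'
      rw [smul_eq_mul]
      field_simp
    have h4 := convexOn_exp.map_sum_le (t := I) (w := fun j => v j / V)
      (p := fun j => -(s / v j) * z j ω ^ 2) (fun j hj => (div_pos (hv j hj) hVpos).le)
      (by rw [← Finset.sum_div, ← hV, div_self hVpos.ne']) (fun j _ => Set.mem_univ _)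
    rw [h3] at h4
    simp only [hf, smul_eq_mul] at h4 ⊢
    rw [sub_eq_add_neg, Real.exp_add]
    exact mul_le_mul_of_nonneg_left h4 (Real.exp_pos _).le
  calc ∫ ω, f ω ∂Q
      ≤ ∫ ω, Real.exp 1 * ∑ j ∈ I, v j / V * Real.exp (-(s / v j) * z j ω ^ 2) ∂Q :=
        integral_mono hfi ((integrable_finsetSum _ hgi).const_mul _) hle
    _ = Real.exp 1 * ∑ j ∈ I, v j / V * (1 / Real.sqrt (1 + 2 * s)) := by
        rw [integral_const_mul, integral_finsetSum _ hgi]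
        congr 1
        refine Finset.sum_congr rfl fun j hj => ?_
        rw [integral_const_mul]
        congr 1
        rw [← integral_exp_neg_sq_gaussianReal (hv j hj) hs, ← hz j hj,
          integral_map (hzm j).aemeasurable (by fun_prop)]
    _ = Real.exp 1 / Real.sqrt (1 + 2 * s) := by
        rw [← Finset.sum_mul, ← Finset.sum_div, ← hV, div_self hVpos.ne']
        ring

end GaussianMoments

section Radius

variable {X : Type*} [MeasurableSpace X] {μ : Measure X} [IsProbabilityMeasure μ]
  {φ : ℕ → X → ℝ} {k : X → X → ℝ} {lam : ℕ → ℝ} {C : ℝ}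
  {Ω : Type*} [MeasurableSpace Ω] {P : Measure Ω} [IsProbabilityMeasure P] {G : X → Ω → ℝ}
  {m n : ℕ}

/-- The variances of the features under the variational posterior: the diagonal of `S` for the
inducing variables, and the prior variances for the other features. -/
def postVar (lam : ℕ → ℝ) (S : Matrix (Fin m) (Fin m) ℝ) (j : ℕ) : ℝ :=
  if h : j < m then S ⟨j, h⟩ ⟨j, h⟩ else lam j

/-- A vector in `ℝᵐ`, extended by zero to a sequence. -/
def extendZero (a : EuclideanSpace ℝ (Fin m)) (j : ℕ) : ℝ :=
  if h : j < m then a ⟨j, h⟩ else 0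

namespace IsReweighting

variable (hk : IsMercerDecomposition μ k lam φ) (hC : ∀ j t, |φ j t| ≤ C) (hG : IsGPPrior P k G)
  {a : EuclideanSpace ℝ (Fin m)} {S : Matrix (Fin m) (Fin m) ℝ} {Q : Measure Ω}
  (hQ : IsReweighting μ φ P G a S Q)
include hk hQ

lemma postVar_nonneg (j : ℕ) : 0 ≤ postVar lam S j := by
  rw [postVar]
  split_ifs
  · exact hQ.posSemidef.diag_nonneg
  · exact hk.nonneg j

omit hQ in
lemma summable_postVar (S : Matrix (Fin m) (Fin m) ℝ) : Summable (postVar lam S) := by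
  refine (summable_nat_add_iff m).1 (((summable_nat_add_iff m).2 hk.summable).congr fun j => ?_)
  rw [postVar, dif_neg (by omega)]

include hC hG

lemma map_centered_feature (j : ℕ) : Q.map (fun ω => feature μ φ G j ω - extendZero a j)
    = gaussianReal 0 (postVar lam S j).toNNReal := by
  have h1 : (fun ω => feature μ φ G j ω - extendZero a j)
      = (fun x => x - extendZero a j) ∘ feature μ φ G j := rfl
  rw [h1, ← Measure.map_map (by fun_prop) (measurable_feature hk hC hG j)]
  by_cases h : j < m
  · rw [hQ.map_feature hk hC hG ⟨j, h⟩, gaussianReal_map_sub_const]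
    simp [postVar, extendZero, h]
  · rw [hQ.map_feature_of_le hk hC hG (not_lt.1 h), gaussianReal_map_sub_const]
    simp [postVar, extendZero, h]

/-- The squared distance of the random function to the mean function, by Parseval's identity. -/
lemma ae_hasSum_sq : ∀ᵐ ω ∂Q, ∃ W : ℝ, 0 ≤ W ∧
    eLpNorm (fun t => G t ω - meanFunction G Q t) 2 μ = ENNReal.ofReal (Real.sqrt W) ∧
    HasSum (fun j => (feature μ φ G j ω - extendZero a j) ^ 2) W := by
  filter_upwards [hQ.ac.ae_le (ae_memLp_path hk hC hG)] with ω h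
  have hmean : (fun t => meanFunction G Q t) = fun t => ∑ j : Fin m, a j * φ j t :=
    funext fun t => hQ.meanFunction_eq hk hC hG t
  have hm : MemLp (fun t => meanFunction G Q t) 2 μ := by
    rw [hmean]; exact memLp_sum hk.basis _
  have hd : MemLp (fun t => G t ω - meanFunction G Q t) 2 μ := h.sub hm
  refine ⟨_, integral_nonneg fun t => sq_nonneg _, eLpNorm_two_sq hd, ?_⟩
  refine (hk.basis.hasSum_coeff_sq hd).congr_fun fun j => ?_
  rw [coeff_sub hk.basis.memLp h hm, hmean, coeff_sum hk.basis]
  rfl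

lemma sq_credibleRadius_mul_le {γ ρ : ℝ} (hγ : γ ∈ Set.Ioo (0 : ℝ) 1)
    (hρ : IsCredibleRadius μ G Q γ ρ) : ρ ^ 2 * γ ≤ ∑' j, postVar lam S j := by
  have hp := hQ.isProbabilityMeasure hk hC hG
  obtain ⟨hρ0, hρ1⟩ := hρ
  set A := {ω | eLpNorm (fun t => G t ω - meanFunction G Q t) 2 μ ≤ ENNReal.ofReal ρ} with hA
  set T : Ω → ℝ≥0∞ := fun ω => ∑' j, ENNReal.ofReal ((feature μ φ G j ω - extendZero a j) ^ 2)
    with hT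
  have hfm : ∀ j, Measurable fun ω => feature μ φ G j ω - extendZero a j := fun j =>
    (measurable_feature hk hC hG j).sub_const _
  have hTm : Measurable T := by
    refine Measurable.tsum fun j => ?_
    have := hfm j
    fun_prop
  have hTint : ∫⁻ ω, T ω ∂Q = ENNReal.ofReal (∑' j, postVar lam S j) := by
    rw [hT, lintegral_tsum fun j => ((hfm j).pow_const 2).ennreal_ofReal.aemeasurable,
      ENNReal.ofReal_tsum_of_nonneg (hQ.postVar_nonneg hk) (summable_postVar hk S)]
    refine tsum_congr fun j => ?_
    rw [← lintegral_sq_gaussianReal (hQ.postVar_nonneg hk j), ← hQ.map_centered_feature hk hC hG j,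
      lintegral_map (by fun_prop) (hfm j)]
  have hAc : ENNReal.ofReal γ ≤ Q Aᶜ := by
    have h1 : (1 : ℝ≥0∞) ≤ Q A + Q Aᶜ := by
      rw [← measure_univ (μ := Q), ← Set.union_compl_self A]
      exact measure_union_le _ _
    rw [hρ1] at h1
    have h2 : (1 : ℝ≥0∞) = ENNReal.ofReal (1 - γ) + ENNReal.ofReal γ := by
      rw [← ENNReal.ofReal_add (by linarith [hγ.2]) hγ.1.le]; simp
    rw [h2] at h1
    exact (ENNReal.add_le_add_iff_left ENNReal.ofReal_ne_top).1 h1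
  have hsub : Q Aᶜ ≤ Q {ω | ENNReal.ofReal (ρ ^ 2) ≤ T ω} := by
    refine measure_mono_ae ?_
    filter_upwards [hQ.ae_hasSum_sq hk hC hG] with ω ⟨W, hW0, hW1, hW2⟩ hω
    have h3 : ¬ eLpNorm (fun t => G t ω - meanFunction G Q t) 2 μ ≤ ENNReal.ofReal ρ := hω
    rw [hW1, not_le, ENNReal.ofReal_lt_ofReal_iff_of_nonneg hρ0] at h3
    change ENNReal.ofReal (ρ ^ 2) ≤ T ω
    have h4 : T ω = ENNReal.ofReal W := by
      rw [← hW2.tsum_eq, ENNReal.ofReal_tsum_of_nonneg (fun j => sq_nonneg _) hW2.summable]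
    rw [h4]
    exact ENNReal.ofReal_le_ofReal ((Real.le_sqrt hρ0 hW0).1 h3.le)
  have hmarkov := mul_meas_ge_le_lintegral (μ := Q) hTm (ENNReal.ofReal (ρ ^ 2))
  have h5 : ENNReal.ofReal (ρ ^ 2 * γ) ≤ ENNReal.ofReal (∑' j, postVar lam S j) := by
    rw [ENNReal.ofReal_mul (sq_nonneg ρ), ← hTint]
    exact le_trans (by gcongr; exact hAc.trans hsub) hmarkov
  exact (ENNReal.ofReal_le_ofReal_iff (tsum_nonneg (hQ.postVar_nonneg hk))).1 h5

lemma sum_postVar_lt_sq_credibleRadius {γ ρ : ℝ}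
    (hρ : IsCredibleRadius μ G Q γ ρ) {s : ℝ} (hs : 0 < s)
    (hsγ : Real.exp 1 / Real.sqrt (1 + 2 * s) < 1 - γ) (I : Finset ℕ) (hI : I.Nonempty)
    (hv : ∀ j ∈ I, 0 < postVar lam S j) : (∑ j ∈ I, postVar lam S j) / s < ρ ^ 2 := by
  have hp := hQ.isProbabilityMeasure hk hC hG
  obtain ⟨hρ0, hρ1⟩ := hρ
  by_contra! hcon
  have h1 := measure_sum_sq_le (Q := Q) (z := fun j ω => feature μ φ G j ω - extendZero a j) I hI hv
    (fun j => (measurable_feature hk hC hG j).sub_const _)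
    (fun j _ => hQ.map_centered_feature hk hC hG j) hs
  have h2 : Q {ω | eLpNorm (fun t => G t ω - meanFunction G Q t) 2 μ ≤ ENNReal.ofReal ρ}
      ≤ Q {ω | ∑ j ∈ I, (feature μ φ G j ω - extendZero a j) ^ 2
        ≤ (∑ j ∈ I, postVar lam S j) / s} := by
    refine measure_mono_ae ?_
    filter_upwards [hQ.ae_hasSum_sq hk hC hG] with ω ⟨W, hW0, hW1, hW2⟩ hω
    have h3 : eLpNorm (fun t => G t ω - meanFunction G Q t) 2 μ ≤ ENNReal.ofReal ρ := hω
    rw [hW1, ENNReal.ofReal_le_ofReal_iff hρ0, Real.sqrt_le_left hρ0] at h3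
    exact (sum_le_hasSum I (fun j _ => sq_nonneg _) hW2).trans (h3.trans hcon)
  rw [hρ1] at h2
  have h4 : 1 - γ ≤ Q.real {ω | ∑ j ∈ I, (feature μ φ G j ω - extendZero a j) ^ 2
        ≤ (∑ j ∈ I, postVar lam S j) / s} := by
    rw [measureReal_def, ← ENNReal.ofReal_le_iff_le_toReal (measure_ne_top _ _)]
    exact h2
  linarith

end IsReweighting

lemma exists_smallBall_constant {γ : ℝ} (hγ : γ < 1) :
    ∃ s : ℝ, 0 < s ∧ Real.exp 1 / Real.sqrt (1 + 2 * s) < 1 - γ := by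
  have h1 : 0 < 1 - γ := by linarith
  refine ⟨(Real.exp 1 / (1 - γ)) ^ 2, by positivity, ?_⟩
  rw [div_lt_iff₀ (Real.sqrt_pos.2 (by positivity)), ← div_lt_iff₀' h1]
  refine Real.lt_sqrt_of_sq_lt ?_
  nlinarith [sq_nonneg (Real.exp 1 / (1 - γ))]

end Radius

/-! ### Perturbation of the normal equations -/

section Perturbation

variable {X : Type*} {φ : ℕ → X → ℝ} {lam : ℕ → ℝ} {σ : ℝ} {m n : ℕ} {x : Fin n → X}

/-- The posterior variance `(λ_j⁻¹ + n σ⁻²)⁻¹` of the `j`-th coefficient in the idealized model in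
which the empirical Gram matrix of the eigenfunctions is the identity. -/
noncomputable def shrunkVar (lam : ℕ → ℝ) (σ : ℝ) (n j : ℕ) : ℝ :=
  ((lam j)⁻¹ + n * (σ ^ 2)⁻¹)⁻¹

/-- The squared Frobenius distance between the empirical Gram matrix of the first `m` eigenfunctions
at the design points and the identity. -/
noncomputable def gramError (φ : ℕ → X → ℝ) (m : ℕ) (x : Fin n → X) : ℝ :=
  ∑ j : Fin m, ∑ l : Fin m,
    ((n : ℝ)⁻¹ * ∑ i, φ j (x i) * φ l (x i) - if j = l then 1 else 0) ^ 2

/-- The squared norm of the stochastic part of the posterior mean, in the idealized model. The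
vector `y - ∑ l, θ l • φ l (x ·)` consists of noise and of the part of the regression function
that the first `m` eigenfunctions do not see. -/
noncomputable def stochError (φ : ℕ → X → ℝ) (lam : ℕ → ℝ) (σ : ℝ) (θ : ℕ → ℝ) (m : ℕ)
    (x : Fin n → X) (y : Fin n → ℝ) : ℝ :=
  ∑ j : Fin m, (shrunkVar lam σ n j * ((σ ^ 2)⁻¹ *
    ∑ i, φ j (x i) * (y i - ∑ l : Fin m, θ l * φ l (x i)))) ^ 2

lemma shrunkVar_pos (hlam : ∀ j, 0 < lam j) (σ : ℝ) (n j : ℕ) : 0 < shrunkVar lam σ n j :=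
  inv_pos.2 (add_pos_of_pos_of_nonneg (inv_pos.2 (hlam j)) (by positivity))

lemma shrunkVar_le (hlam : ∀ j, 0 < lam j) (σ : ℝ) (n j : ℕ) : shrunkVar lam σ n j ≤ lam j := by
  rw [shrunkVar]
  refine inv_le_of_inv_le₀ (hlam j) ?_
  have : 0 ≤ n * (σ ^ 2)⁻¹ := by positivity
  linarith

lemma mul_shrunkVar_le_one (hlam : ∀ j, 0 < lam j) (σ : ℝ) (n j : ℕ) :
    n * (σ ^ 2)⁻¹ * shrunkVar lam σ n j ≤ 1 := by
  have h := inv_pos.2 (hlam j)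
  have h2 : 0 ≤ n * (σ ^ 2)⁻¹ := by positivity
  rw [shrunkVar, ← div_eq_mul_inv, div_le_one (by linarith)]
  linarith

/-- A solution of the normal equations is a perturbation of the solution in the idealized model. -/
lemma solution_eq (hlam : ∀ j, 0 < lam j) (hn : 0 < n) {g w : Fin m → ℝ}
    (h : (precision (fun j : Fin m => lam j) σ (designMatrix φ m x)).mulVec g = w) (j : Fin m) :
    g j - shrunkVar lam σ n j * w j = -(n * (σ ^ 2)⁻¹ * shrunkVar lam σ n j) * ∑ l : Fin m,
      ((n : ℝ)⁻¹ * ∑ i, φ j (x i) * φ l (x i) - if j = l then 1 else 0) * g l := by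
  have hn' : (n : ℝ) ≠ 0 := by exact_mod_cast hn.ne'
  have h1 := congrFun h j
  rw [precision_mulVec] at h1
  have h2 : ((designMatrix φ m x).transpose.mulVec ((designMatrix φ m x).mulVec g)) j
      = ∑ l : Fin m, (∑ i, φ j (x i) * φ l (x i)) * g l := by
    rw [Matrix.mulVec_mulVec]
    simp only [Matrix.mulVec, dotProduct, Matrix.mul_apply, Matrix.transpose_apply, designMatrix,
      Matrix.of_apply]
  have h3 : ∑ l : Fin m, ((n : ℝ)⁻¹ * ∑ i, φ j (x i) * φ l (x i) - if j = l then 1 else 0) * g l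
      = (n : ℝ)⁻¹ * ∑ l : Fin m, (∑ i, φ j (x i) * φ l (x i)) * g l - g j := by
    simp only [sub_mul, Finset.sum_sub_distrib, mul_assoc, ite_mul, one_mul,
      zero_mul, Finset.sum_ite_eq, Finset.mem_univ, if_true]
    rw [Finset.mul_sum]
  rw [h2] at h1
  rw [h3, ← h1]
  set T := ∑ l : Fin m, (∑ i, φ j (x i) * φ l (x i)) * g l
  have h4 : shrunkVar lam σ n j * ((lam j)⁻¹ + n * (σ ^ 2)⁻¹) = 1 :=
    inv_mul_cancel₀ (by
      have h := inv_pos.2 (hlam j)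
      have h2 : 0 ≤ n * (σ ^ 2)⁻¹ := by positivity
      linarith)
  have h5 : (n : ℝ) * (n : ℝ)⁻¹ = 1 := mul_inv_cancel₀ hn'
  linear_combination (-(g j)) * h4 + (σ ^ 2)⁻¹ * shrunkVar lam σ n j * T * h5

lemma sq_solution_sub_le (hlam : ∀ j, 0 < lam j) (hn : 0 < n) {g w : Fin m → ℝ}
    (h : (precision (fun j : Fin m => lam j) σ (designMatrix φ m x)).mulVec g = w) (j : Fin m) :
    (g j - shrunkVar lam σ n j * w j) ^ 2 ≤ (∑ l : Fin m,
      ((n : ℝ)⁻¹ * ∑ i, φ j (x i) * φ l (x i) - if j = l then 1 else 0) ^ 2) *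
        ∑ l : Fin m, g l ^ 2 := by
  rw [solution_eq hlam hn h j, mul_pow, neg_sq]
  have h1 := mul_shrunkVar_le_one hlam σ n j
  have h0 : 0 ≤ n * (σ ^ 2)⁻¹ * shrunkVar lam σ n j := by
    have := shrunkVar_pos hlam σ n j
    positivity
  refine le_trans (mul_le_of_le_one_left (sq_nonneg _) (pow_le_one₀ h0 h1)) ?_
  exact Finset.sum_mul_sq_le_sq_mul_sq _ _ _

lemma sum_sq_solution_sub_le (hlam : ∀ j, 0 < lam j) (hn : 0 < n) {g w : Fin m → ℝ}
    (h : (precision (fun j : Fin m => lam j) σ (designMatrix φ m x)).mulVec g = w) :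
    ∑ j : Fin m, (g j - shrunkVar lam σ n j * w j) ^ 2
      ≤ gramError φ m x * ∑ l : Fin m, g l ^ 2 := by
  rw [gramError, Finset.sum_mul]
  exact Finset.sum_le_sum fun j _ => sq_solution_sub_le hlam hn h j

lemma sum_sq_solution_le (hlam : ∀ j, 0 < lam j) (hn : 0 < n) {g w : Fin m → ℝ}
    (h : (precision (fun j : Fin m => lam j) σ (designMatrix φ m x)).mulVec g = w)
    (hE : gramError φ m x ≤ 1 / 16) :
    ∑ j : Fin m, g j ^ 2 ≤ 4 * ∑ j : Fin m, (shrunkVar lam σ n j * w j) ^ 2 := by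
  have h1 := sum_sq_solution_sub_le hlam hn h
  have h0 : 0 ≤ ∑ l : Fin m, g l ^ 2 := Finset.sum_nonneg fun j _ => sq_nonneg _
  have h2 : ∑ j : Fin m, g j ^ 2 ≤ 2 * ∑ j : Fin m, (shrunkVar lam σ n j * w j) ^ 2
      + 2 * ∑ j : Fin m, (g j - shrunkVar lam σ n j * w j) ^ 2 := by
    rw [Finset.mul_sum, Finset.mul_sum, ← Finset.sum_add_distrib]
    exact Finset.sum_le_sum fun j _ => by
      nlinarith [sq_nonneg (g j - 2 * (shrunkVar lam σ n j * w j))]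
  nlinarith

lemma sum_sq_le_sum_sq_solution (hlam : ∀ j, 0 < lam j) (hn : 0 < n) {g w : Fin m → ℝ}
    (h : (precision (fun j : Fin m => lam j) σ (designMatrix φ m x)).mulVec g = w)
    (hE : gramError φ m x ≤ 1 / 16) :
    ∑ j : Fin m, (shrunkVar lam σ n j * w j) ^ 2 ≤ 3 * ∑ j : Fin m, g j ^ 2 := by
  have h1 := sum_sq_solution_sub_le hlam hn h
  have h0 : 0 ≤ ∑ l : Fin m, g l ^ 2 := Finset.sum_nonneg fun j _ => sq_nonneg _
  have h2 : ∑ j : Fin m, (shrunkVar lam σ n j * w j) ^ 2 ≤ 2 * ∑ j : Fin m, g j ^ 2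
      + 2 * ∑ j : Fin m, (g j - shrunkVar lam σ n j * w j) ^ 2 := by
    rw [Finset.mul_sum, Finset.mul_sum, ← Finset.sum_add_distrib]
    exact Finset.sum_le_sum fun j _ => by
      nlinarith [sq_nonneg (2 * g j - shrunkVar lam σ n j * w j)]
  nlinarith

/-- The diagonal of the covariance matrix of the variational posterior. -/
lemma diag_inv_precision_mem_Icc (hlam : ∀ j, 0 < lam j) (hn : 0 < n)
    (hE : gramError φ m x ≤ 1 / 16) (j : Fin m) :
    (precision (fun j : Fin m => lam j) σ (designMatrix φ m x))⁻¹ j j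
      ∈ Set.Icc (1 / 2 * shrunkVar lam σ n j) (3 / 2 * shrunkVar lam σ n j) := by
  set B := precision (fun j : Fin m => lam j) σ (designMatrix φ m x) with hB
  have hBpos : B.PosDef := posDef_precision (fun j => hlam j) σ _
  have hcol : B.mulVec (fun l => B⁻¹ l j) = Pi.single j 1 := by
    have h1 : (fun l => B⁻¹ l j) = B⁻¹.mulVec (Pi.single j 1) := by
      rw [Matrix.mulVec_single_one]; rfl
    rw [h1, Matrix.mulVec_mulVec, Matrix.mul_nonsing_inv _ hBpos.det_pos.ne'.isUnit,
      Matrix.one_mulVec]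
  have h2 := sum_sq_solution_le hlam hn hcol hE
  have h3 := sq_solution_sub_le hlam hn hcol j
  have hD := shrunkVar_pos hlam σ n j
  have h4 : ∑ l : Fin m, (shrunkVar lam σ n l * (Pi.single j 1 : Fin m → ℝ) l) ^ 2
      = shrunkVar lam σ n j ^ 2 := by
    rw [Finset.sum_eq_single j]
    · simp
    · intro l _ hl
      simp [hl]
    · simp
  have h5 : (∑ l : Fin m, ((n : ℝ)⁻¹ * ∑ i, φ j (x i) * φ l (x i) - if j = l then 1 else 0) ^ 2)
      ≤ gramError φ m x :=
    Finset.single_le_sum (f := fun j : Fin m => ∑ l : Fin m,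
      ((n : ℝ)⁻¹ * ∑ i, φ j (x i) * φ l (x i) - if j = l then 1 else 0) ^ 2)
      (fun _ _ => Finset.sum_nonneg fun _ _ => sq_nonneg _) (Finset.mem_univ j)
  rw [h4] at h2
  rw [Pi.single_eq_same, mul_one] at h3
  have h6 : (B⁻¹ j j - shrunkVar lam σ n j) ^ 2 ≤ (1 / 2 * shrunkVar lam σ n j) ^ 2 := by
    have h0 : 0 ≤ ∑ l : Fin m, B⁻¹ l j ^ 2 := Finset.sum_nonneg fun j _ => sq_nonneg _
    nlinarith
  have h7 := abs_le_of_sq_le_sq' h6 (by positivity)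
  constructor
  · linarith [h7.1]
  · linarith [h7.2]

section Error

variable {a : EuclideanSpace ℝ (Fin m)} {y : Fin n → ℝ}

lemma normal_equation_error {θ : ℕ → ℝ}
    (ha : (precision (fun j : Fin m => lam j) σ (designMatrix φ m x)).mulVec a.ofLp
      = (σ ^ 2)⁻¹ • (designMatrix φ m x).transpose.mulVec y) :
    (precision (fun j : Fin m => lam j) σ (designMatrix φ m x)).mulVec (fun j => a j - θ j)
      = fun j : Fin m => (σ ^ 2)⁻¹ * ∑ i, φ j (x i) * (y i - ∑ l : Fin m, θ l * φ l (x i))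
        - (lam j)⁻¹ * θ j := by
  have h1 : (fun j : Fin m => a j - θ j) = a.ofLp - fun j : Fin m => θ j := rfl
  rw [h1, Matrix.mulVec_sub, ha]
  ext j
  rw [Pi.sub_apply, precision_mulVec, Pi.smul_apply, smul_eq_mul]
  simp only [Matrix.mulVec, dotProduct, Matrix.transpose_apply, designMatrix, Matrix.of_apply,
    mul_sub, Finset.sum_sub_distrib]
  have : ∀ i, ∑ l : Fin m, φ l (x i) * θ l = ∑ l : Fin m, θ l * φ l (x i) := fun i =>
    Finset.sum_congr rfl fun l _ => mul_comm _ _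
  simp only [this]
  ring

/-- The squared distance of the posterior mean to the truth, in the first `m` coordinates, is at
most a multiple of the stochastic error plus the squared bias. -/
lemma sum_sq_error_le (hlam : ∀ j, 0 < lam j) (hn : 0 < n) (θ : ℕ → ℝ)
    (ha : (precision (fun j : Fin m => lam j) σ (designMatrix φ m x)).mulVec a.ofLp
      = (σ ^ 2)⁻¹ • (designMatrix φ m x).transpose.mulVec y) (hE : gramError φ m x ≤ 1 / 16) :
    ∑ j : Fin m, (a j - θ j) ^ 2 ≤ 8 * stochError φ lam σ θ m x y
      + 8 * ∑ j : Fin m, (shrunkVar lam σ n j * (lam j)⁻¹ * θ j) ^ 2 := by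
  refine (sum_sq_solution_le hlam hn (normal_equation_error ha) hE).trans ?_
  rw [stochError, Finset.mul_sum, Finset.mul_sum, Finset.mul_sum, ← Finset.sum_add_distrib]
  refine Finset.sum_le_sum fun j _ => ?_
  set u := (σ ^ 2)⁻¹ * ∑ i, φ j (x i) * (y i - ∑ l : Fin m, θ l * φ l (x i))
  set D := shrunkVar lam σ n j
  nlinarith [sq_nonneg (D * u + D * (lam j)⁻¹ * θ j)]

lemma sum_sq_bias_le (hlam : ∀ j, 0 < lam j) (hn : 0 < n) (θ : ℕ → ℝ)
    (ha : (precision (fun j : Fin m => lam j) σ (designMatrix φ m x)).mulVec a.ofLp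
      = (σ ^ 2)⁻¹ • (designMatrix φ m x).transpose.mulVec y) (hE : gramError φ m x ≤ 1 / 16) :
    ∑ j : Fin m, (shrunkVar lam σ n j * (lam j)⁻¹ * θ j) ^ 2
      ≤ 6 * ∑ j : Fin m, (a j - θ j) ^ 2 + 2 * stochError φ lam σ θ m x y := by
  have h1 := sum_sq_le_sum_sq_solution hlam hn (normal_equation_error (θ := θ) ha) hE
  have h2 : ∑ j : Fin m, (shrunkVar lam σ n j * (lam j)⁻¹ * θ j) ^ 2
      ≤ 2 * ∑ j : Fin m, (shrunkVar lam σ n j * ((σ ^ 2)⁻¹ *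
        ∑ i, φ j (x i) * (y i - ∑ l : Fin m, θ l * φ l (x i)) - (lam j)⁻¹ * θ j)) ^ 2
        + 2 * stochError φ lam σ θ m x y := by
    rw [stochError, Finset.mul_sum, Finset.mul_sum, ← Finset.sum_add_distrib]
    refine Finset.sum_le_sum fun j _ => ?_
    set u := (σ ^ 2)⁻¹ * ∑ i, φ j (x i) * (y i - ∑ l : Fin m, θ l * φ l (x i))
    set D := shrunkVar lam σ n j
    nlinarith [sq_nonneg (2 * (D * u) - D * (lam j)⁻¹ * θ j)]
  linarith

end Error

end Perturbation

/-! ### Moments under the law of the data -/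

section Data

lemma lintegral_sq_sum_pi {Y : Type*} [MeasurableSpace Y] {ν : Measure Y} [IsProbabilityMeasure ν]
    {n : ℕ} {h : Fin n → Y → ℝ} (hmem : ∀ i, MemLp (h i) 2 ν) (hmean : ∀ i, ∫ t, h i t ∂ν = 0) :
    ∫⁻ z, ENNReal.ofReal ((∑ i, h i (z i)) ^ 2) ∂(Measure.pi fun _ : Fin n => ν)
      = ENNReal.ofReal (∑ i, ∫ t, h i t ^ 2 ∂ν) := by
  set F : (Fin n → Y) → ℝ := ∑ i, fun z => h i (z i) with hF
  have hFi : ∀ i, MemLp (fun z : Fin n → Y => h i (z i)) 2 (Measure.pi fun _ : Fin n => ν) :=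
    fun i => (hmem i).comp_measurePreserving (measurePreserving_eval (fun _ : Fin n => ν) i)
  have hFm : MemLp F 2 (Measure.pi fun _ : Fin n => ν) := memLp_finsetSum' _ fun i _ => hFi i
  have happ : ∀ z, F z = ∑ i, h i (z i) := fun z => by rw [hF, Finset.sum_apply]
  have hF0 : ∫ z, F z ∂(Measure.pi fun _ : Fin n => ν) = 0 := by
    simp_rw [happ]
    rw [integral_finsetSum _ fun i _ => (hFi i).integrable (by norm_num)]
    refine Finset.sum_eq_zero fun i _ => ?_
    rw [integral_comp_eval (μ := fun _ : Fin n => ν) (f := h i) (hmem i).1, hmean]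
  have h1 := variance_sum_pi (μ := fun _ : Fin n => ν) hmem
  rw [← hF, variance_of_integral_eq_zero hFm.1.aemeasurable hF0] at h1
  have h2 : ∀ i, Var[h i; ν] = ∫ t, h i t ^ 2 ∂ν := fun i =>
    variance_of_integral_eq_zero (hmem i).1.aemeasurable (hmean i)
  simp_rw [← happ]
  rw [← ofReal_integral_eq_lintegral_ofReal hFm.integrable_sq (ae_of_all _ fun z => sq_nonneg _),
    h1]
  simp_rw [h2]

variable {X : Type*} [MeasurableSpace X] {μ : Measure X} [IsProbabilityMeasure μ]
  {φ : ℕ → X → ℝ} {lam : ℕ → ℝ} {C σ : ℝ} {f₀ : X → ℝ} {n : ℕ}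

lemma aemeasurable_data (hf : AEMeasurable f₀ μ) (σ : ℝ) (n : ℕ) : AEMeasurable
    (fun p : (Fin n → X) × (Fin n → ℝ) => (p.1, fun i => f₀ (p.1 i) + p.2 i))
    ((Measure.pi fun _ : Fin n => μ).prod
      (Measure.pi fun _ : Fin n => gaussianReal 0 (σ ^ 2).toNNReal)) := by
  refine measurable_fst.aemeasurable.prodMk (aemeasurable_pi_lambda _ fun i => ?_)
  refine AEMeasurable.add ?_ ((measurable_pi_apply i).comp measurable_snd).aemeasurable
  exact (hf.comp_quasiMeasurePreserving (measurePreserving_eval (fun _ : Fin n => μ)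
    i).quasiMeasurePreserving).comp_quasiMeasurePreserving Measure.quasiMeasurePreserving_fst

lemma isProbabilityMeasure_dataLaw (hf : AEMeasurable f₀ μ) (σ : ℝ) (n : ℕ) :
    IsProbabilityMeasure (dataLaw μ σ f₀ n) :=
  Measure.isProbabilityMeasure_map (aemeasurable_data hf σ n)

lemma lintegral_fst_dataLaw (hf : AEMeasurable f₀ μ) {F : (Fin n → X) → ℝ≥0∞} (hF : Measurable F) :
    ∫⁻ p, F p.1 ∂(dataLaw μ σ f₀ n) = ∫⁻ x, F x ∂(Measure.pi fun _ : Fin n => μ) := by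
  have hF' : Measurable fun p : (Fin n → X) × (Fin n → ℝ) => F p.1 := hF.comp measurable_fst
  rw [dataLaw, lintegral_map' hF'.aemeasurable (aemeasurable_data hf σ n),
    lintegral_prod _ hF'.aemeasurable]
  simp

lemma measurable_gramError (hφ : ∀ j, Measurable (φ j)) (m n : ℕ) :
    Measurable fun x : Fin n → X => gramError φ m x := by
  unfold gramError
  fun_prop

lemma measurable_stochError (hφ : ∀ j, Measurable (φ j)) (lam : ℕ → ℝ) (σ : ℝ) (θ : ℕ → ℝ)
    (m n : ℕ) :
    Measurable fun p : (Fin n → X) × (Fin n → ℝ) => stochError φ lam σ θ m p.1 p.2 := by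
  unfold stochError
  fun_prop

lemma lintegral_gramError_le (hb : IsOrthonormalBasisL2 μ φ) (hC : ∀ j t, |φ j t| ≤ C) (m : ℕ)
    (hn : 0 < n) : ∫⁻ x, ENNReal.ofReal (gramError φ m x) ∂(Measure.pi fun _ : Fin n => μ)
      ≤ ENNReal.ofReal ((m : ℝ) ^ 2 * C ^ 4 / n) := by
  have hn' : (0 : ℝ) < n := by exact_mod_cast hn
  have hterm : ∀ j l : Fin m, ∫⁻ x : Fin n → X, ENNReal.ofReal (((n : ℝ)⁻¹ *
      ∑ i, φ j (x i) * φ l (x i) - if j = l then 1 else 0) ^ 2) ∂(Measure.pi fun _ : Fin n => μ)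
      ≤ ENNReal.ofReal (C ^ 4 / n) := by
    intro j l
    set δ : ℝ := if j = l then 1 else 0 with hδ
    have hbd : ∀ t, (φ j t * φ l t) ^ 2 ≤ C ^ 4 := fun t => by
      have h1 : |φ j t * φ l t| ≤ C * C := by
        rw [abs_mul]
        exact mul_le_mul (hC j t) (hC l t) (abs_nonneg _) ((abs_nonneg _).trans (hC j t))
      rw [← sq_abs]
      calc _ ≤ (C * C) ^ 2 := pow_le_pow_left₀ (abs_nonneg _) h1 2
        _ = _ := by ring
    have hm : Measurable fun t => φ j t * φ l t := (hb.1 j).mul (hb.1 l)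
    have hmem0 : MemLp (fun t => φ j t * φ l t) 2 μ := by
      refine MemLp.of_bound hm.aestronglyMeasurable (C ^ 2) (ae_of_all _ fun t => ?_)
      rw [Real.norm_eq_abs]
      exact abs_le_of_sq_le_sq (by have := hbd t; nlinarith) (sq_nonneg C)
    have hmem : MemLp (fun t => φ j t * φ l t - δ) 2 μ := hmem0.sub (memLp_const δ)
    have hint := hmem0.integrable (by norm_num)
    have hδ' : ∫ t, φ j t * φ l t ∂μ = δ := by
      rw [hb.integral_mul]; simp [hδ, Fin.val_inj]
    have hmean : ∫ t, (φ j t * φ l t - δ) ∂μ = 0 := by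
      rw [integral_sub hint (integrable_const _), hδ']
      simp
    have hsq : ∫ t, (φ j t * φ l t - δ) ^ 2 ∂μ ≤ C ^ 4 := by
      have h1 : ∫ t, (φ j t * φ l t - δ) ^ 2 ∂μ
          = ∫ t, (φ j t * φ l t) ^ 2 ∂μ - δ ^ 2 := by
        have := variance_eq_sub hmem0
        rw [variance_eq_integral hm.aemeasurable, hδ'] at this
        exact this
      have h2 : ∫ t, (φ j t * φ l t) ^ 2 ∂μ ≤ ∫ _, C ^ 4 ∂μ :=
        integral_mono hmem0.integrable_sq (integrable_const _) hbd
      simp only [integral_const, probReal_univ, smul_eq_mul, one_mul] at h2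
      linarith [sq_nonneg δ]
    have h3 := lintegral_sq_sum_pi (ν := μ) (n := n) (h := fun _ t => φ j t * φ l t - δ)
      (fun _ => hmem) (fun _ => hmean)
    have h4 : ∀ x : Fin n → X, ENNReal.ofReal (((n : ℝ)⁻¹ *
        ∑ i, φ j (x i) * φ l (x i) - δ) ^ 2) = ENNReal.ofReal (((n : ℝ)⁻¹) ^ 2) *
          ENNReal.ofReal ((∑ i, (φ j (x i) * φ l (x i) - δ)) ^ 2) := fun x => by
      rw [← ENNReal.ofReal_mul (by positivity), ← mul_pow, Finset.sum_sub_distrib]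
      congr 2
      simp only [Finset.sum_const, Finset.card_univ, Fintype.card_fin, nsmul_eq_mul]
      field_simp
    simp_rw [h4]
    rw [lintegral_const_mul _ (by have := hb.1; fun_prop), h3, ← ENNReal.ofReal_mul (by positivity)]
    refine ENNReal.ofReal_le_ofReal ?_
    simp only [Finset.sum_const, Finset.card_univ, Fintype.card_fin, nsmul_eq_mul]
    rw [div_eq_inv_mul]
    calc ((n : ℝ)⁻¹) ^ 2 * (n * ∫ t, (φ j t * φ l t - δ) ^ 2 ∂μ)
        = (n : ℝ)⁻¹ * ∫ t, (φ j t * φ l t - δ) ^ 2 ∂μ := by field_simp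
      _ ≤ _ := by gcongr
  unfold gramError
  have hmeas : ∀ j l : Fin m, Measurable fun x : Fin n → X => ENNReal.ofReal (((n : ℝ)⁻¹ *
      ∑ i, φ j (x i) * φ l (x i) - if j = l then 1 else 0) ^ 2) := fun j l => by
    have := hb.1; fun_prop
  simp_rw [ENNReal.ofReal_sum_of_nonneg fun _ _ => Finset.sum_nonneg fun _ _ => sq_nonneg _,
    ENNReal.ofReal_sum_of_nonneg fun _ _ => sq_nonneg _]
  rw [lintegral_finsetSum _ fun j _ => Finset.measurable_fun_sum _ fun l _ => hmeas j l]
  simp_rw [lintegral_finsetSum _ fun l _ => hmeas _ l]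
  refine (Finset.sum_le_sum fun j _ => Finset.sum_le_sum fun l _ => hterm j l).trans ?_
  simp only [Finset.sum_const, Finset.card_univ, Fintype.card_fin, nsmul_eq_mul]
  rw [← ENNReal.ofReal_natCast, ← ENNReal.ofReal_mul (by positivity),
    ← ENNReal.ofReal_mul (by positivity)]
  exact le_of_eq (by congr 1; ring)

/-- The expected squared coefficients of the noise and of the unseen part of `f₀`. -/
lemma lintegral_sq_sum_residual_le (hb : IsOrthonormalBasisL2 μ φ) (hC : ∀ j t, |φ j t| ≤ C)
    (hf : MemLp f₀ 2 μ) {m : ℕ} (j : Fin m) (σ : ℝ) (n : ℕ) :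
    ∫⁻ p, ENNReal.ofReal ((∑ i, φ j (p.1 i) *
      (p.2 i - ∑ l : Fin m, coeff μ φ f₀ l * φ l (p.1 i))) ^ 2) ∂(dataLaw μ σ f₀ n)
      ≤ ENNReal.ofReal (2 * n * C ^ 2 * (∫ t, f₀ t ^ 2 ∂μ + σ ^ 2)) := by
  have hφm := hb.1
  set r : X → ℝ := fun t => f₀ t - ∑ l : Fin m, coeff μ φ f₀ l * φ l t with hr
  have hsum : MemLp (fun t => ∑ l : Fin m, coeff μ φ f₀ l * φ l t) 2 μ :=
    memLp_sum hb (fun l : Fin m => coeff μ φ f₀ l)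
  have hrm : MemLp r 2 μ := hf.sub hsum
  have hcr : ∀ i, coeff μ φ r i = if i < m then 0 else coeff μ φ f₀ i := fun i => by
    rw [hr, coeff_sub hb.memLp hf hsum, coeff_sum hb (fun l : Fin m => coeff μ φ f₀ l)]
    split_ifs <;> simp
  have hr2 : ∫ t, r t ^ 2 ∂μ ≤ ∫ t, f₀ t ^ 2 ∂μ := by
    refine hasSum_le (fun i => ?_) (hb.hasSum_coeff_sq hrm) (hb.hasSum_coeff_sq hf)
    rw [hcr]
    split_ifs
    · simpa using sq_nonneg _
    · exact le_rfl
  -- the part that depends on the design only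
  have hφsq : ∀ t, φ j t ^ 2 ≤ C ^ 2 := fun t => by
    rw [← sq_abs]; exact pow_le_pow_left₀ (abs_nonneg _) (hC j t) 2
  have hA : MemLp (fun t => φ j t * r t) 2 μ := by
    refine MemLp.of_le_mul (c := C) hrm ((hφm j).aestronglyMeasurable.mul hrm.1)
      (ae_of_all _ fun t => ?_)
    rw [norm_mul]
    exact mul_le_mul_of_nonneg_right (hC j t) (norm_nonneg _)
  have hA0 : ∫ t, φ j t * r t ∂μ = 0 := by
    have h := hcr j
    rw [if_pos j.2, coeff] at h
    rw [← h]
    exact integral_congr_ae (ae_of_all _ fun t => mul_comm _ _)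
  have hA2 : ∫ t, (φ j t * r t) ^ 2 ∂μ ≤ C ^ 2 * ∫ t, f₀ t ^ 2 ∂μ := by
    refine le_trans ?_ (mul_le_mul_of_nonneg_left hr2 (sq_nonneg C))
    rw [← integral_const_mul]
    refine integral_mono hA.integrable_sq (hrm.integrable_sq.const_mul _) fun t => ?_
    simp only [mul_pow]
    exact mul_le_mul_of_nonneg_right (hφsq t) (sq_nonneg _)
  have h1 := lintegral_sq_sum_pi (ν := μ) (n := n) (h := fun _ t => φ j t * r t)
    (fun _ => hA) (fun _ => hA0)
  -- the noise
  have h2 : ∀ x : Fin n → X, ∫⁻ ε, ENNReal.ofReal ((∑ i, φ j (x i) * ε i) ^ 2)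
      ∂(Measure.pi fun _ : Fin n => gaussianReal 0 (σ ^ 2).toNNReal)
      ≤ ENNReal.ofReal (n * (C ^ 2 * σ ^ 2)) := fun x => by
    have hm : ∀ i, MemLp (fun e : ℝ => φ j (x i) * e) 2 (gaussianReal 0 (σ ^ 2).toNNReal) :=
      fun i => (memLp_id_gaussianReal' 2 (by norm_num)).const_mul _
    have h3 := lintegral_sq_sum_pi (n := n) (h := fun i e => φ j (x i) * e) hm fun i => by
      rw [integral_const_mul, integral_id_gaussianReal, mul_zero]
    rw [h3]
    refine ENNReal.ofReal_le_ofReal ?_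
    have h4 : ∀ i, ∫ e, (φ j (x i) * e) ^ 2 ∂(gaussianReal 0 (σ ^ 2).toNNReal)
        = φ j (x i) ^ 2 * σ ^ 2 := fun i => by
      simp_rw [mul_pow]
      rw [integral_const_mul, integral_sq_gaussianReal, Real.coe_toNNReal _ (sq_nonneg σ)]
    simp_rw [h4]
    calc ∑ i, φ j (x i) ^ 2 * σ ^ 2 ≤ ∑ _i : Fin n, C ^ 2 * σ ^ 2 :=
          Finset.sum_le_sum fun i _ => mul_le_mul_of_nonneg_right (hφsq _) (sq_nonneg _)
      _ = _ := by simp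
  have hAm : AEMeasurable (fun p : (Fin n → X) × (Fin n → ℝ) =>
      ENNReal.ofReal ((∑ i, φ j (p.1 i) * r (p.1 i)) ^ 2)) ((Measure.pi fun _ : Fin n => μ).prod
      (Measure.pi fun _ : Fin n => gaussianReal 0 (σ ^ 2).toNNReal)) := by
    refine AEMeasurable.ennreal_ofReal (AEMeasurable.pow_const ?_ 2)
    refine Finset.aemeasurable_fun_sum _ fun i _ => ?_
    exact (hA.1.aemeasurable.comp_quasiMeasurePreserving (measurePreserving_eval
      (fun _ : Fin n => μ) i).quasiMeasurePreserving).comp_quasiMeasurePreserving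
        Measure.quasiMeasurePreserving_fst
  have hBm : Measurable (fun p : (Fin n → X) × (Fin n → ℝ) =>
      ENNReal.ofReal ((∑ i, φ j (p.1 i) * p.2 i) ^ 2)) := by fun_prop
  rw [dataLaw, lintegral_map' (by fun_prop) (aemeasurable_data hf.1.aemeasurable σ n)]
  calc _ ≤ ∫⁻ p : (Fin n → X) × (Fin n → ℝ),
        (2 * ENNReal.ofReal ((∑ i, φ j (p.1 i) * r (p.1 i)) ^ 2)
        + 2 * ENNReal.ofReal ((∑ i, φ j (p.1 i) * p.2 i) ^ 2))
        ∂((Measure.pi fun _ : Fin n => μ).prod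
      (Measure.pi fun _ : Fin n => gaussianReal 0 (σ ^ 2).toNNReal)) := by
        refine lintegral_mono fun p => ?_
        have e2 : (2 : ℝ≥0∞) = ENNReal.ofReal 2 := by simp
        rw [e2, ← ENNReal.ofReal_mul (by norm_num), ← ENNReal.ofReal_mul (by norm_num),
          ← ENNReal.ofReal_add (by positivity) (by positivity)]
        refine ENNReal.ofReal_le_ofReal ?_
        have e : ∑ i, φ j (p.1 i) * (f₀ (p.1 i) + p.2 i
            - ∑ l : Fin m, coeff μ φ f₀ l * φ l (p.1 i))
            = ∑ i, φ j (p.1 i) * r (p.1 i) + ∑ i, φ j (p.1 i) * p.2 i := by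
          rw [← Finset.sum_add_distrib]
          exact Finset.sum_congr rfl fun i _ => by simp only [hr]; ring
        rw [e]
        nlinarith [sq_nonneg (∑ i, φ j (p.1 i) * r (p.1 i) - ∑ i, φ j (p.1 i) * p.2 i)]
    _ ≤ 2 * ENNReal.ofReal (n * (C ^ 2 * ∫ t, f₀ t ^ 2 ∂μ))
        + 2 * ENNReal.ofReal (n * (C ^ 2 * σ ^ 2)) := by
        rw [lintegral_add_right _ (hBm.const_mul 2), lintegral_const_mul'' _ hAm,
          lintegral_const_mul _ hBm, lintegral_prod _ hAm, lintegral_prod _ hBm.aemeasurable]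
        gcongr
        · simp only [lintegral_const, measure_univ, mul_one]
          rw [h1]
          refine ENNReal.ofReal_le_ofReal ?_
          simp only [Finset.sum_const, Finset.card_univ, Fintype.card_fin, nsmul_eq_mul]
          gcongr
        · refine (lintegral_mono h2).trans ?_
          simp
    _ = _ := by
        have e2 : (2 : ℝ≥0∞) = ENNReal.ofReal 2 := by simp
        have hpos : 0 ≤ ∫ t, f₀ t ^ 2 ∂μ := integral_nonneg fun t => sq_nonneg _
        rw [e2, ← ENNReal.ofReal_mul (by norm_num), ← ENNReal.ofReal_mul (by norm_num),
          ← ENNReal.ofReal_add (by positivity) (by positivity)]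
        congr 1
        ring

lemma lintegral_stochError_le (hb : IsOrthonormalBasisL2 μ φ) (hC : ∀ j t, |φ j t| ≤ C)
    (hlam : ∀ j, 0 < lam j) (hf : MemLp f₀ 2 μ) (hσ : 0 < σ) (m n : ℕ) :
    ∫⁻ p, ENNReal.ofReal (stochError φ lam σ (coeff μ φ f₀) m p.1 p.2) ∂(dataLaw μ σ f₀ n)
      ≤ ENNReal.ofReal (2 * C ^ 2 * (∫ t, f₀ t ^ 2 ∂μ + σ ^ 2) * (σ ^ 2)⁻¹ *
        ∑ j : Fin m, shrunkVar lam σ n j) := by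
  have hφm := hb.1
  have hpos : 0 ≤ ∫ t, f₀ t ^ 2 ∂μ := integral_nonneg fun t => sq_nonneg _
  unfold stochError
  simp_rw [ENNReal.ofReal_sum_of_nonneg fun _ _ => sq_nonneg _]
  rw [lintegral_finsetSum _ fun j _ => by fun_prop, Finset.mul_sum, ENNReal.ofReal_sum_of_nonneg
    fun j _ => by have := shrunkVar_pos hlam σ n j; positivity]
  refine Finset.sum_le_sum fun j _ => ?_
  have h1 : ∀ p : (Fin n → X) × (Fin n → ℝ), ENNReal.ofReal ((shrunkVar lam σ n j * ((σ ^ 2)⁻¹ *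
    ∑ i, φ j (p.1 i) * (p.2 i - ∑ l : Fin m, coeff μ φ f₀ l * φ l (p.1 i)))) ^ 2)
    = ENNReal.ofReal ((shrunkVar lam σ n j * (σ ^ 2)⁻¹) ^ 2) * ENNReal.ofReal ((∑ i, φ j (p.1 i) *
      (p.2 i - ∑ l : Fin m, coeff μ φ f₀ l * φ l (p.1 i))) ^ 2) := fun p => by
    rw [← ENNReal.ofReal_mul (sq_nonneg _)]
    congr 1
    ring
  simp_rw [h1]
  rw [lintegral_const_mul _ (by fun_prop)]
  refine (mul_le_mul_right (lintegral_sq_sum_residual_le hb hC hf j σ n) _).trans ?_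
  rw [← ENNReal.ofReal_mul (sq_nonneg _)]
  refine ENNReal.ofReal_le_ofReal ?_
  have h2 := mul_shrunkVar_le_one hlam σ n j
  have h3 := shrunkVar_pos hlam σ n j
  set D := shrunkVar lam σ n j
  calc (D * (σ ^ 2)⁻¹) ^ 2 * (2 * n * C ^ 2 * (∫ t, f₀ t ^ 2 ∂μ + σ ^ 2))
      = (n * (σ ^ 2)⁻¹ * D) * (2 * C ^ 2 * (∫ t, f₀ t ^ 2 ∂μ + σ ^ 2) * (σ ^ 2)⁻¹ * D) := by ring
    _ ≤ 1 * (2 * C ^ 2 * (∫ t, f₀ t ^ 2 ∂μ + σ ^ 2) * (σ ^ 2)⁻¹ * D) := by gcongr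
    _ = _ := one_mul _

end Data

noncomputable section

/-! ### Rates for polynomially decaying eigenvalues -/

section Rates

variable {a A σ : ℝ} {lam : ℕ → ℝ} {n m : ℕ}

/-- A telescoping bound, which replaces the comparison of a power sum with an integral. -/
lemma rpow_neg_one_sub_le {p x : ℝ} (hp : 0 < p) (hx : 1 < x) :
    x ^ (-1 - p) ≤ p⁻¹ * ((x - 1) ^ (-p) - x ^ (-p)) := by
  have hx0 : 0 < x := by linarith
  have hu : 0 < 1 - x⁻¹ := by
    have : x⁻¹ < 1 := inv_lt_one_of_one_lt₀ hx
    linarith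
  have h1 : 1 + p * x⁻¹ ≤ (1 - x⁻¹) ^ (-p) := by
    rw [Real.rpow_def_of_pos hu]
    have h2 := Real.log_le_sub_one_of_pos hu
    have h3 := Real.add_one_le_exp (Real.log (1 - x⁻¹) * -p)
    nlinarith
  have h4 : (x - 1) ^ (-p) = x ^ (-p) * (1 - x⁻¹) ^ (-p) := by
    rw [← Real.mul_rpow hx0.le hu.le]
    congr 1
    field_simp
  have h5 : x ^ (-1 - p) = x ^ (-p) * x⁻¹ := by
    rw [show -1 - p = -p + -1 by ring, Real.rpow_add hx0, Real.rpow_neg_one]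
  rw [h4, h5]
  have h6 : 0 < x ^ (-p) := Real.rpow_pos_of_pos hx0 _
  rw [inv_mul_eq_div, le_div_iff₀ hp]
  nlinarith

lemma sum_range_rpow_le {p : ℝ} (hp : 0 < p) {K : ℕ} (hK : 0 < K) (N : ℕ) :
    ∑ i ∈ Finset.range N, ((i + K + 1 : ℕ) : ℝ) ^ (-1 - p) ≤ p⁻¹ * (K : ℝ) ^ (-p) := by
  have hK' : (1 : ℝ) ≤ K := by exact_mod_cast hK
  have h : ∑ i ∈ Finset.range N, ((i + K + 1 : ℕ) : ℝ) ^ (-1 - p)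
      ≤ p⁻¹ * ((K : ℝ) ^ (-p) - ((N + K : ℕ) : ℝ) ^ (-p)) := by
    induction N with
    | zero => simp
    | succ N ih =>
      rw [Finset.sum_range_succ]
      have h1 := rpow_neg_one_sub_le hp (x := ((N + K + 1 : ℕ) : ℝ)) (by
        push_cast; have : (0 : ℝ) ≤ N := N.cast_nonneg
        linarith)
      rw [show ((N + K + 1 : ℕ) : ℝ) - 1 = ((N + K : ℕ) : ℝ) by push_cast; ring] at h1
      rw [show N + 1 + K = N + K + 1 by ring]
      linarith
  refine h.trans (mul_le_mul_of_nonneg_left ?_ (by positivity))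
  linarith [Real.rpow_nonneg (Nat.cast_nonneg (α := ℝ) (N + K)) (-p)]

/-- The number of eigendirections that the variational posterior learns from the data: the minimum
of the number of inducing variables and of the index beyond which `n * lam j` drops below `1`. -/
def effectiveDim (a : ℝ) (n m : ℕ) : ℕ := min m ⌈(n : ℝ) ^ (1 / (1 + 2 * a))⌉₊

lemma rpow_one_div_rpow (ha : 0 < a) (n : ℕ) :
    ((n : ℝ) ^ (1 / (1 + 2 * a))) ^ (1 + 2 * a) = n := by
  rw [← Real.rpow_mul n.cast_nonneg, one_div_mul_cancel (by positivity), Real.rpow_one]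

lemma effectiveDim_pos (hn : 0 < n) (hm : 0 < m) (a : ℝ) : 0 < effectiveDim a n m :=
  lt_min hm (Nat.ceil_pos.2 (Real.rpow_pos_of_pos (by exact_mod_cast hn) _))

lemma effectiveDim_rpow_le (ha : 0 < a) (hn : 0 < n) (m : ℕ) :
    (effectiveDim a n m : ℝ) ^ (1 + 2 * a) ≤ 2 ^ (1 + 2 * a) * n := by
  set J : ℝ := (n : ℝ) ^ (1 / (1 + 2 * a)) with hJ
  have hJ1 : 1 ≤ J := Real.one_le_rpow (by exact_mod_cast hn) (by positivity)
  have h1 : (effectiveDim a n m : ℝ) ≤ 2 * J := by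
    have h2 : (effectiveDim a n m : ℝ) ≤ ⌈J⌉₊ := by exact_mod_cast min_le_right _ _
    have h3 := Nat.ceil_lt_add_one (zero_le_one.trans hJ1)
    linarith
  calc _ ≤ (2 * J) ^ (1 + 2 * a) := Real.rpow_le_rpow (Nat.cast_nonneg _) h1 (by positivity)
    _ = _ := by rw [Real.mul_rpow (by norm_num) (by positivity), hJ, rpow_one_div_rpow ha]

lemma le_effectiveDim_rpow (ha : 0 < a) (h : ⌈(n : ℝ) ^ (1 / (1 + 2 * a))⌉₊ ≤ m) :
    (n : ℝ) ≤ (effectiveDim a n m : ℝ) ^ (1 + 2 * a) := by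
  rw [effectiveDim, min_eq_right h]
  conv_lhs => rw [← rpow_one_div_rpow ha n]
  exact Real.rpow_le_rpow (by positivity) (Nat.le_ceil _) (by positivity)

lemma le_effectiveDim_rpow_of_lt (ha : 0 < a) (h : effectiveDim a n m < m) :
    (n : ℝ) ≤ (effectiveDim a n m : ℝ) ^ (1 + 2 * a) := by
  refine le_effectiveDim_rpow ha ?_
  by_contra hlt
  rw [effectiveDim, min_eq_left (not_le.1 hlt).le] at h
  exact lt_irrefl _ h

lemma effectiveDim_div_le (ha : 0 < a) (hn : 0 < n) (hm : 0 < m) :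
    (effectiveDim a n m : ℝ) / n ≤ 2 ^ (1 + 2 * a) * (effectiveDim a n m : ℝ) ^ (-(2 * a)) := by
  have hK : (0 : ℝ) < effectiveDim a n m := by exact_mod_cast effectiveDim_pos hn hm a
  have hn' : (0 : ℝ) < n := by exact_mod_cast hn
  have h := effectiveDim_rpow_le ha hn m
  rw [Real.rpow_add hK, Real.rpow_one] at h
  rw [Real.rpow_neg hK.le, div_le_iff₀ hn']
  have h2 : 0 < (effectiveDim a n m : ℝ) ^ (2 * a) := Real.rpow_pos_of_pos hK _
  calc (effectiveDim a n m : ℝ)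
      = (effectiveDim a n m * (effectiveDim a n m : ℝ) ^ (2 * a)) *
        ((effectiveDim a n m : ℝ) ^ (2 * a))⁻¹ := by field_simp
    _ ≤ (2 ^ (1 + 2 * a) * n) * ((effectiveDim a n m : ℝ) ^ (2 * a))⁻¹ := by gcongr
    _ = _ := by ring

/-- The approximate variances of the coefficients `⟨f, φ j⟩` under the variational posterior. -/
def approxVar (lam : ℕ → ℝ) (σ : ℝ) (n m j : ℕ) : ℝ :=
  if j < m then shrunkVar lam σ n j else lam j

/-- The approximate bias of the `j`-th coefficient of the variational posterior mean, when the
coefficients of the regression function are `θ`. -/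
def biasTerm (lam : ℕ → ℝ) (σ : ℝ) (n m : ℕ) (θ : ℕ → ℝ) (j : ℕ) : ℝ :=
  if j < m then shrunkVar lam σ n j * (lam j)⁻¹ * θ j else θ j

lemma approxVar_pos (hlam : ∀ j, 0 < lam j) (σ : ℝ) (n m j : ℕ) : 0 < approxVar lam σ n m j := by
  unfold approxVar
  split_ifs
  exacts [shrunkVar_pos hlam σ n j, hlam j]

lemma approxVar_le (hlam : ∀ j, 0 < lam j) (σ : ℝ) (n m j : ℕ) :
    approxVar lam σ n m j ≤ lam j := by
  unfold approxVar
  split_ifs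
  exacts [shrunkVar_le hlam σ n j, le_rfl]

lemma summable_approxVar (hlam : ∀ j, 0 < lam j) (hs : Summable lam) (σ : ℝ) (n m : ℕ) :
    Summable (approxVar lam σ n m) :=
  hs.of_nonneg_of_le (fun j => (approxVar_pos hlam σ n m j).le) (approxVar_le hlam σ n m)

lemma shrunkVar_le_div (hlam : ∀ j, 0 < lam j) (hσ : 0 < σ) (hn : 0 < n) (j : ℕ) :
    shrunkVar lam σ n j ≤ σ ^ 2 / n := by
  have h := mul_shrunkVar_le_one hlam σ n j
  have hn' : (0 : ℝ) < n := by exact_mod_cast hn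
  rw [le_div_iff₀ hn']
  calc shrunkVar lam σ n j * n = σ ^ 2 * (n * (σ ^ 2)⁻¹ * shrunkVar lam σ n j) := by field_simp
    _ ≤ σ ^ 2 * 1 := by gcongr
    _ = σ ^ 2 := mul_one _

lemma sum_shrunkVar_le (hlam : ∀ j, 0 < lam j) (hσ : 0 < σ) (hn : 0 < n) (m : ℕ) :
    ∑ j : Fin m, shrunkVar lam σ n j ≤ σ ^ 2 * (m / n) := by
  calc _ ≤ ∑ _j : Fin m, σ ^ 2 / n := Finset.sum_le_sum fun j _ => shrunkVar_le_div hlam hσ hn j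
    _ = _ := by simp; ring

lemma sum_shrunkVar_le_tsum (hlam : ∀ j, 0 < lam j) (hs : Summable lam) (σ : ℝ) (n m : ℕ) :
    ∑ j : Fin m, shrunkVar lam σ n j ≤ ∑' j, approxVar lam σ n m j := by
  have h := (summable_approxVar hlam hs σ n m).sum_le_tsum (Finset.range m)
    fun j _ => (approxVar_pos hlam σ n m j).le
  rw [← Fin.sum_univ_eq_sum_range] at h
  refine le_trans (le_of_eq ?_) h
  exact Finset.sum_congr rfl fun j _ => by simp [approxVar]

lemma tsum_approxVar_le (ha : 0 < a) (hA : 0 < A) (hσ : 0 < σ) (hlam : ∀ j, 0 < lam j)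
    (hs : Summable lam) (hle : ∀ j, lam j ≤ A * ((j + 1 : ℕ) : ℝ) ^ (-1 - 2 * a)) (hn : 0 < n)
    (hm : 0 < m) : ∑' j, approxVar lam σ n m j
      ≤ (σ ^ 2 * 2 ^ (1 + 2 * a) + A * (2 * a)⁻¹) * (effectiveDim a n m : ℝ) ^ (-(2 * a)) := by
  have hK := effectiveDim_pos hn hm a
  have hdiv := effectiveDim_div_le ha hn hm
  have hsum := summable_approxVar hlam hs σ n m
  have hKm : effectiveDim a n m ≤ m := min_le_left _ _
  set K := effectiveDim a n m
  rw [← hsum.sum_add_tsum_nat_add K, add_mul]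
  refine add_le_add ?_ ?_
  · calc _ ≤ ∑ _j ∈ Finset.range K, σ ^ 2 / n := by
          refine Finset.sum_le_sum fun j hj => ?_
          rw [approxVar, if_pos ((Finset.mem_range.1 hj).trans_le hKm)]
          exact shrunkVar_le_div hlam hσ hn j
      _ = σ ^ 2 * (K / n) := by simp; ring
      _ ≤ _ := by rw [mul_assoc]; gcongr
  · refine Real.tsum_le_of_sum_range_le (fun j => (approxVar_pos hlam σ n m _).le) fun N => ?_
    calc _ ≤ ∑ i ∈ Finset.range N, A * ((i + K + 1 : ℕ) : ℝ) ^ (-1 - 2 * a) :=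
          Finset.sum_le_sum fun i _ => (approxVar_le hlam σ n m _).trans (hle _)
      _ ≤ A * ((2 * a)⁻¹ * (K : ℝ) ^ (-(2 * a))) := by
          rw [← Finset.mul_sum]
          exact mul_le_mul_of_nonneg_left (sum_range_rpow_le (by positivity) hK N) hA.le
      _ = _ := by ring

lemma inv_mul_rpow_le_of_mem_Ico {p : ℝ} (hp : 0 < p) {K j : ℕ} (hK : 0 < K) (hj : j < 2 * K) :
    ((2 : ℝ) ^ p)⁻¹ * (K : ℝ) ^ (-p) ≤ ((j + 1 : ℕ) : ℝ) ^ (-p) := by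
  have hK' : (0 : ℝ) < K := by exact_mod_cast hK
  rw [← Real.rpow_neg (by norm_num), ← Real.mul_rpow (by norm_num) hK'.le]
  refine Real.rpow_le_rpow_of_nonpos (by positivity) ?_ (by linarith)
  exact_mod_cast (by omega : j + 1 ≤ 2 * K)

/-- Beyond the effective dimension, the variances are not reduced by the data. -/
lemma le_approxVar (ha : 0 < a) (hA : 0 < A) (hlam : ∀ j, 0 < lam j)
    (hge : ∀ j, ((j + 1 : ℕ) : ℝ) ^ (-1 - 2 * a) ≤ A * lam j) (hn : 0 < n) (hm : 0 < m) {j : ℕ}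
    (hj : j ∈ Finset.Ico (effectiveDim a n m) (2 * effectiveDim a n m)) :
    (A * 2 ^ (1 + 2 * a) + (σ ^ 2)⁻¹)⁻¹ * (effectiveDim a n m : ℝ) ^ (-(1 + 2 * a))
      ≤ approxVar lam σ n m j := by
  have hK := effectiveDim_pos hn hm a
  have hlt := le_effectiveDim_rpow_of_lt (n := n) (m := m) ha
  set K := effectiveDim a n m
  obtain ⟨hj1, hj2⟩ := Finset.mem_Ico.1 hj
  have hK' : (0 : ℝ) < K := by exact_mod_cast hK
  have hp : 0 < 1 + 2 * a := by positivity
  have hlj : (lam j)⁻¹ ≤ A * 2 ^ (1 + 2 * a) * (K : ℝ) ^ (1 + 2 * a) := by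
    have h1 := (inv_mul_rpow_le_of_mem_Ico hp hK hj2).trans
      (le_of_eq (by congr 1; ring) |>.trans (hge j))
    rw [inv_le_comm₀ (hlam j) (by positivity)]
    rw [Real.rpow_neg hK'.le] at h1
    calc _ = A⁻¹ * ((2 ^ (1 + 2 * a))⁻¹ * ((K : ℝ) ^ (1 + 2 * a))⁻¹) := by
          rw [mul_inv, mul_inv]; ring
      _ ≤ A⁻¹ * (A * lam j) := by gcongr
      _ = lam j := by field_simp
  rw [Real.rpow_neg hK'.le, ← mul_inv]
  unfold approxVar
  split_ifs with hjm
  · unfold shrunkVar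
    have := hlam j
    refine inv_anti₀ (by positivity) ?_
    rw [add_mul, mul_comm (n : ℝ)]
    refine add_le_add hlj (mul_le_mul_of_nonneg_left (hlt (hj1.trans_lt hjm)) (by positivity))
  · rw [inv_le_comm₀ (by positivity) (hlam j)]
    refine hlj.trans ?_
    rw [add_mul]
    exact le_add_of_nonneg_right (by positivity)

lemma le_sum_approxVar (ha : 0 < a) (hA : 0 < A) (hlam : ∀ j, 0 < lam j)
    (hge : ∀ j, ((j + 1 : ℕ) : ℝ) ^ (-1 - 2 * a) ≤ A * lam j) (hn : 0 < n) (hm : 0 < m) :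
    (A * 2 ^ (1 + 2 * a) + (σ ^ 2)⁻¹)⁻¹ * (effectiveDim a n m : ℝ) ^ (-(2 * a))
      ≤ ∑ j ∈ Finset.Ico (effectiveDim a n m) (2 * effectiveDim a n m), approxVar lam σ n m j := by
  have hK := effectiveDim_pos hn hm a
  have h := Finset.card_nsmul_le_sum _ _ _ fun j hj =>
    le_approxVar (σ := σ) ha hA hlam hge hn hm hj
  set K := effectiveDim a n m
  have hK' : (0 : ℝ) < K := by exact_mod_cast hK
  refine le_trans (le_of_eq ?_) h
  rw [Nat.card_Ico, show 2 * K - K = K by omega, nsmul_eq_mul, neg_add, Real.rpow_add hK',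
    Real.rpow_neg_one]
  field_simp

lemma sq_biasTerm_le_sq (hlam : ∀ j, 0 < lam j) (θ : ℕ → ℝ) (j : ℕ) :
    biasTerm lam σ n m θ j ^ 2 ≤ θ j ^ 2 := by
  unfold biasTerm
  split_ifs
  · have h1 := shrunkVar_pos hlam σ n j
    have h2 := shrunkVar_le hlam σ n j
    have h3 : shrunkVar lam σ n j * (lam j)⁻¹ ≤ 1 := by
      rw [← div_eq_mul_inv, div_le_one (hlam j)]; exact h2
    have h4 : 0 ≤ shrunkVar lam σ n j * (lam j)⁻¹ := mul_nonneg h1.le (inv_nonneg.2 (hlam j).le)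
    rw [mul_pow]
    exact mul_le_of_le_one_left (sq_nonneg _) (pow_le_one₀ h4 h3)
  · exact le_rfl

lemma sq_biasTerm_le_of_lt (hA : 0 < A) (hσ : 0 < σ) (hlam : ∀ j, 0 < lam j)
    (hge : ∀ j, ((j + 1 : ℕ) : ℝ) ^ (-1 - 2 * a) ≤ A * lam j) (hn : 0 < n) (θ : ℕ → ℝ) {j K : ℕ}
    (hjm : j < m) (hjK : j < K) :
    biasTerm lam σ n m θ j ^ 2 ≤ σ ^ 2 * A * (K / n) * (((j + 1 : ℕ) : ℝ) ^ (2 * a) * θ j ^ 2) := by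
  rw [biasTerm, if_pos hjm]
  have h1 := shrunkVar_pos hlam σ n j
  have h2 := shrunkVar_le hlam σ n j
  have h3 : shrunkVar lam σ n j * (lam j)⁻¹ ≤ 1 := by
    rw [← div_eq_mul_inv, div_le_one (hlam j)]; exact h2
  have h4 : 0 ≤ shrunkVar lam σ n j * (lam j)⁻¹ := mul_nonneg h1.le (inv_nonneg.2 (hlam j).le)
  have h5 := shrunkVar_le_div hlam hσ hn j
  have hj0 : (0 : ℝ) < ((j + 1 : ℕ) : ℝ) := by positivity
  have h6 : (lam j)⁻¹ ≤ A * (K * ((j + 1 : ℕ) : ℝ) ^ (2 * a)) := by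
    have h7 := hge j
    rw [show -1 - 2 * a = -(1 + 2 * a) by ring, Real.rpow_neg hj0.le, Real.rpow_add hj0,
      Real.rpow_one] at h7
    have hK : (((j + 1 : ℕ) : ℝ)) ≤ K := by exact_mod_cast hjK
    rw [inv_le_iff_one_le_mul₀ (hlam j)]
    have h8 : 0 < ((j + 1 : ℕ) : ℝ) ^ (2 * a) := Real.rpow_pos_of_pos hj0 _
    rw [inv_le_iff_one_le_mul₀ (by positivity)] at h7
    have := hlam j
    calc 1 ≤ _ := h7
      _ ≤ A * lam j * (K * ((j + 1 : ℕ) : ℝ) ^ (2 * a)) := by gcongr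
      _ = _ := by ring
  have h9 := hlam j
  calc (shrunkVar lam σ n j * (lam j)⁻¹ * θ j) ^ 2
      = (shrunkVar lam σ n j * (lam j)⁻¹) * (shrunkVar lam σ n j * (lam j)⁻¹) * θ j ^ 2 := by ring
    _ ≤ 1 * (σ ^ 2 / n * (A * (K * ((j + 1 : ℕ) : ℝ) ^ (2 * a)))) * θ j ^ 2 := by gcongr
    _ = _ := by ring

lemma sq_le_of_ge {b : ℝ} (hb : 0 < b) (θ : ℕ → ℝ) {j K : ℕ} (hK : 0 < K) (hjK : K ≤ j) :
    θ j ^ 2 ≤ (K : ℝ) ^ (-(2 * b)) * (((j + 1 : ℕ) : ℝ) ^ (2 * b) * θ j ^ 2) := by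
  have hK' : (0 : ℝ) < K := by exact_mod_cast hK
  rw [← mul_assoc]
  refine le_mul_of_one_le_left (sq_nonneg _) ?_
  rw [Real.rpow_neg hK'.le, inv_mul_eq_div, one_le_div (by positivity)]
  exact Real.rpow_le_rpow hK'.le (by exact_mod_cast hjK.trans (Nat.le_succ j)) (by positivity)

lemma summable_sq_biasTerm (hlam : ∀ j, 0 < lam j) {θ : ℕ → ℝ} (hθ : Summable fun j => θ j ^ 2)
    (σ : ℝ) (n m : ℕ) : Summable fun j => biasTerm lam σ n m θ j ^ 2 :=
  hθ.of_nonneg_of_le (fun _ => sq_nonneg _) (sq_biasTerm_le_sq hlam θ)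

/-- The squared bias is at most of the order of the posterior spread, if the regression function is
at least as smooth as the prior. -/
lemma tsum_sq_biasTerm_le (ha : 0 < a) (hA : 0 < A) (hσ : 0 < σ) (hlam : ∀ j, 0 < lam j)
    (hge : ∀ j, ((j + 1 : ℕ) : ℝ) ^ (-1 - 2 * a) ≤ A * lam j) (hn : 0 < n) (hm : 0 < m)
    {θ : ℕ → ℝ} (hθ : Summable fun j => θ j ^ 2)
    (hθa : Summable fun j => ((j + 1 : ℕ) : ℝ) ^ (2 * a) * θ j ^ 2) :
    ∑' j, biasTerm lam σ n m θ j ^ 2 ≤ (1 + σ ^ 2 * A * 2 ^ (1 + 2 * a)) *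
      (∑' j, ((j + 1 : ℕ) : ℝ) ^ (2 * a) * θ j ^ 2) * (effectiveDim a n m : ℝ) ^ (-(2 * a)) := by
  have hK := effectiveDim_pos hn hm a
  have hdiv := effectiveDim_div_le ha hn hm
  have hKm : effectiveDim a n m ≤ m := min_le_left _ _
  set K := effectiveDim a n m
  have h0 : 0 < (K : ℝ) ^ (-(2 * a)) := Real.rpow_pos_of_pos (by exact_mod_cast hK) _
  rw [mul_assoc, mul_comm (tsum _), ← mul_assoc, ← tsum_mul_left]
  refine (summable_sq_biasTerm hlam hθ σ n m).tsum_le_tsum (fun j => ?_) (hθa.mul_left _)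
  have ht : 0 ≤ ((j + 1 : ℕ) : ℝ) ^ (2 * a) * θ j ^ 2 := by positivity
  rcases lt_or_ge j K with hj | hj
  · refine (sq_biasTerm_le_of_lt hA hσ hlam hge hn θ (hj.trans_le hKm) hj).trans ?_
    refine mul_le_mul_of_nonneg_right ?_ ht
    calc σ ^ 2 * A * (K / n) ≤ σ ^ 2 * A * (2 ^ (1 + 2 * a) * (K : ℝ) ^ (-(2 * a))) := by gcongr
      _ ≤ _ := by nlinarith
  · refine (sq_biasTerm_le_sq hlam θ j).trans ((sq_le_of_ge ha θ hK hj).trans ?_)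
    refine mul_le_mul_of_nonneg_right ?_ ht
    refine le_mul_of_one_le_left h0.le ?_
    have : 0 ≤ σ ^ 2 * A * 2 ^ (1 + 2 * a) := by positivity
    linarith

/-- A bound for the squared bias that improves with the smoothness of the regression function. -/
lemma tsum_sq_biasTerm_le_add {b : ℝ} (hb : 0 < b) (hab : a ≤ b) (hA : 0 < A) (hσ : 0 < σ)
    (hlam : ∀ j, 0 < lam j) (hge : ∀ j, ((j + 1 : ℕ) : ℝ) ^ (-1 - 2 * a) ≤ A * lam j) (hn : 0 < n)
    (hm : 0 < m) {θ : ℕ → ℝ} (hθ : Summable fun j => θ j ^ 2)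
    (hθb : Summable fun j => ((j + 1 : ℕ) : ℝ) ^ (2 * b) * θ j ^ 2) :
    ∑' j, biasTerm lam σ n m θ j ^ 2 ≤ (σ ^ 2 * A * (m / n) + (m : ℝ) ^ (-(2 * b))) *
      ∑' j, ((j + 1 : ℕ) : ℝ) ^ (2 * b) * θ j ^ 2 := by
  rw [← tsum_mul_left]
  refine (summable_sq_biasTerm hlam hθ σ n m).tsum_le_tsum (fun j => ?_) (hθb.mul_left _)
  have ht : 0 ≤ ((j + 1 : ℕ) : ℝ) ^ (2 * b) * θ j ^ 2 := by positivity
  rcases lt_or_ge j m with hj | hj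
  · calc biasTerm lam σ n m θ j ^ 2
        ≤ σ ^ 2 * A * (m / n) * (((j + 1 : ℕ) : ℝ) ^ (2 * a) * θ j ^ 2) :=
          sq_biasTerm_le_of_lt hA hσ hlam hge hn θ hj hj
      _ ≤ σ ^ 2 * A * (m / n) * (((j + 1 : ℕ) : ℝ) ^ (2 * b) * θ j ^ 2) := by
          have : ((j + 1 : ℕ) : ℝ) ^ (2 * a) ≤ ((j + 1 : ℕ) : ℝ) ^ (2 * b) :=
            Real.rpow_le_rpow_of_exponent_le (by exact_mod_cast Nat.succ_pos j) (by linarith)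
          gcongr
      _ ≤ _ := mul_le_mul_of_nonneg_right (le_add_of_nonneg_right (by positivity)) ht
  · refine (sq_biasTerm_le_sq hlam θ j).trans ((sq_le_of_ge hb θ hm hj).trans ?_)
    exact mul_le_mul_of_nonneg_right (le_add_of_nonneg_left (by positivity)) ht

/-- Beyond the effective dimension, the posterior mean does not recover the coefficients of the
regression function. -/
lemma le_tsum_sq_biasTerm {b : ℝ} (hb : 0 < b) (ha : 0 < a) (hA : 0 < A) (hσ : 0 < σ)
    (hlam : ∀ j, 0 < lam j) (hle : ∀ j, lam j ≤ A * ((j + 1 : ℕ) : ℝ) ^ (-1 - 2 * a)) (hn : 0 < n)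
    (hm : 0 < m) {θ : ℕ → ℝ} (hθ : Summable fun j => θ j ^ 2)
    (hθb : ∀ j, θ j ^ 2 = ((j + 1 : ℕ) : ℝ) ^ (-(1 + 2 * b))) :
    ((1 + A * (σ ^ 2)⁻¹) ^ 2)⁻¹ * (2 ^ (1 + 2 * b))⁻¹ * (effectiveDim a n m : ℝ) ^ (-(2 * b))
      ≤ ∑' j, biasTerm lam σ n m θ j ^ 2 := by
  have hK := effectiveDim_pos hn hm a
  have hlt := le_effectiveDim_rpow_of_lt (n := n) (m := m) ha
  refine le_trans ?_ ((summable_sq_biasTerm hlam hθ σ n m).sum_le_tsum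
    (Finset.Ico (effectiveDim a n m) (2 * effectiveDim a n m)) fun _ _ => sq_nonneg _)
  set K := effectiveDim a n m
  have hK' : (0 : ℝ) < K := by exact_mod_cast hK
  have hterm : ∀ j ∈ Finset.Ico K (2 * K), ((1 + A * (σ ^ 2)⁻¹) ^ 2)⁻¹ *
      ((2 ^ (1 + 2 * b))⁻¹ * (K : ℝ) ^ (-(1 + 2 * b))) ≤ biasTerm lam σ n m θ j ^ 2 := by
    intro j hj
    obtain ⟨hj1, hj2⟩ := Finset.mem_Ico.1 hj
    have h1 : ((1 + A * (σ ^ 2)⁻¹) ^ 2)⁻¹ * θ j ^ 2 ≤ biasTerm lam σ n m θ j ^ 2 := by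
      unfold biasTerm
      split_ifs with hjm
      · rw [mul_pow _ (θ j)]
        refine mul_le_mul_of_nonneg_right ?_ (sq_nonneg _)
        rw [← inv_pow]
        refine pow_le_pow_left₀ (by positivity) ?_ 2
        have h2 := hlam j
        rw [shrunkVar, ← mul_inv]
        refine inv_anti₀ (by positivity) ?_
        rw [add_mul, inv_mul_cancel₀ h2.ne']
        have h3 : (n : ℝ) * lam j ≤ A := by
          have hj0 : (0 : ℝ) < ((j + 1 : ℕ) : ℝ) := by positivity
          calc (n : ℝ) * lam j ≤ (K : ℝ) ^ (1 + 2 * a) *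
                (A * ((j + 1 : ℕ) : ℝ) ^ (-1 - 2 * a)) :=
                mul_le_mul (hlt (hj1.trans_lt hjm)) (hle j) h2.le (by positivity)
            _ ≤ ((j + 1 : ℕ) : ℝ) ^ (1 + 2 * a) * (A * ((j + 1 : ℕ) : ℝ) ^ (-1 - 2 * a)) := by
                have : (K : ℝ) ≤ ((j + 1 : ℕ) : ℝ) := by exact_mod_cast hj1.trans (Nat.le_succ j)
                gcongr
            _ = A := by
                rw [show -1 - 2 * a = -(1 + 2 * a) by ring, Real.rpow_neg hj0.le]
                have : 0 < ((j + 1 : ℕ) : ℝ) ^ (1 + 2 * a) := Real.rpow_pos_of_pos hj0 _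
                field_simp
        have h4 : (n : ℝ) * (σ ^ 2)⁻¹ * lam j = (n * lam j) * (σ ^ 2)⁻¹ := by ring
        rw [h4]
        gcongr
      · refine mul_le_of_le_one_left (sq_nonneg _) (inv_le_one_of_one_le₀ (one_le_pow₀ ?_))
        exact le_add_of_nonneg_right (by positivity)
    refine le_trans (mul_le_mul_of_nonneg_left ?_ (by positivity)) h1
    rw [hθb]
    exact inv_mul_rpow_le_of_mem_Ico (by positivity) hK hj2
  refine le_trans (le_of_eq ?_) (Finset.card_nsmul_le_sum _ _ _ hterm)
  rw [Nat.card_Ico, show 2 * K - K = K by omega, nsmul_eq_mul, neg_add, Real.rpow_add hK',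
    Real.rpow_neg_one]
  field_simp

end Rates

end

/-! ### The radius and the estimation error on the event of a well-conditioned design -/

section GoodDesign

variable {X : Type*} [MeasurableSpace X] {μ : Measure X} [IsProbabilityMeasure μ]
  {φ : ℕ → X → ℝ} {k : X → X → ℝ} {lam : ℕ → ℝ} {a A C σ γ : ℝ}
  {Ω : Type*} [MeasurableSpace Ω] [StandardBorelSpace Ω] [Nonempty Ω] {P : Measure Ω}
  [IsProbabilityMeasure P] {G : X → Ω → ℝ} {m n : ℕ}

lemma exists_normal_equation (hlam : ∀ j, 0 < lam j) (σ : ℝ) (x : Fin n → X) (y : Fin n → ℝ) :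
    ∃ a : EuclideanSpace ℝ (Fin m),
      (precision (fun j : Fin m => lam j) σ (designMatrix φ m x)).mulVec a.ofLp
        = (σ ^ 2)⁻¹ • (designMatrix φ m x).transpose.mulVec y := by
  have hB := posDef_precision (fun j : Fin m => hlam j) σ (designMatrix φ m x)
  refine ⟨WithLp.toLp 2 ((precision (fun j : Fin m => lam j) σ (designMatrix φ m x))⁻¹.mulVec
    ((σ ^ 2)⁻¹ • (designMatrix φ m x).transpose.mulVec y)), ?_⟩
  rw [Matrix.mulVec_mulVec, Matrix.mul_nonsing_inv _ hB.det_pos.ne'.isUnit, Matrix.one_mulVec]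

variable (hk : IsMercerDecomposition μ k lam φ) (hC : ∀ j t, |φ j t| ≤ C) (hG : IsGPPrior P k G)
  (hlam : ∀ j, 0 < lam j) (hσ : 0 < σ)
include hk hC hG hlam hσ

lemma postVar_mem_Icc (hn : 0 < n) {x : Fin n → X} (hE : gramError φ m x ≤ 1 / 16) (j : ℕ) :
    postVar lam (precision (fun j : Fin m => lam j) σ (designMatrix φ m x))⁻¹ j
      ∈ Set.Icc (1 / 2 * approxVar lam σ n m j) (3 / 2 * approxVar lam σ n m j) := by
  unfold postVar approxVar
  split_ifs with h
  · exact diag_inv_precision_mem_Icc hlam hn hE ⟨j, h⟩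
  · have := hlam j
    constructor <;> linarith

/-- The squared radius of the credible ball is of the order `effectiveDim ^ (-2 * a)`. -/
lemma exists_sq_credibleRadius_bounds (ha : 0 < a) (hA : 0 < A)
    (hle : ∀ j, lam j ≤ A * ((j + 1 : ℕ) : ℝ) ^ (-1 - 2 * a))
    (hge : ∀ j, ((j + 1 : ℕ) : ℝ) ^ (-1 - 2 * a) ≤ A * lam j) (hγ : γ ∈ Set.Ioo (0 : ℝ) 1) :
    ∃ c C' : ℝ, 0 < c ∧ 0 < C' ∧ ∀ n m : ℕ, 0 < n → 0 < m → ∀ (x : Fin n → X) (y : Fin n → ℝ)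
      (Q : Measure Ω) (ρ : ℝ), IsVariationalPosterior μ φ P σ G m x y Q →
      IsCredibleRadius μ G Q γ ρ → gramError φ m x ≤ 1 / 16 →
        c * (effectiveDim a n m : ℝ) ^ (-(2 * a)) ≤ ρ ^ 2 ∧
        ρ ^ 2 ≤ C' * (effectiveDim a n m : ℝ) ^ (-(2 * a)) := by
  obtain ⟨s, hs, hsγ⟩ := exists_smallBall_constant hγ.2
  have hγ0 := hγ.1
  refine ⟨(A * 2 ^ (1 + 2 * a) + (σ ^ 2)⁻¹)⁻¹ * (1 / 2) / s,
    3 / 2 * (σ ^ 2 * 2 ^ (1 + 2 * a) + A * (2 * a)⁻¹) / γ, by positivity, by positivity, ?_⟩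
  intro n m hn hm x y Q ρ hQ hρ hE
  obtain ⟨v, hv⟩ := exists_normal_equation (m := m) (φ := φ) hlam σ x y
  have hR := isReweighting_of_isVariationalPosterior hk hC hG hlam hσ hQ hv
  have hvar := postVar_mem_Icc hk hC hG hlam hσ hn hE
  have hK := effectiveDim_pos hn hm a
  constructor
  · have h1 := hR.sum_postVar_lt_sq_credibleRadius hk hC hG hρ hs hsγ
      (Finset.Ico (effectiveDim a n m) (2 * effectiveDim a n m))
      ⟨effectiveDim a n m, Finset.mem_Ico.2 ⟨le_rfl, by omega⟩⟩
      fun j _ => lt_of_lt_of_le (by have := approxVar_pos hlam σ n m j; positivity) (hvar j).1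
    refine le_trans ?_ h1.le
    rw [div_mul_eq_mul_div]
    refine div_le_div_of_nonneg_right ?_ hs.le
    calc _ = 1 / 2 * ((A * 2 ^ (1 + 2 * a) + (σ ^ 2)⁻¹)⁻¹ *
          (effectiveDim a n m : ℝ) ^ (-(2 * a))) := by ring
      _ ≤ 1 / 2 * ∑ j ∈ Finset.Ico (effectiveDim a n m) (2 * effectiveDim a n m),
          approxVar lam σ n m j := by
          gcongr
          exact le_sum_approxVar ha hA hlam hge hn hm
      _ ≤ _ := by
          rw [Finset.mul_sum]
          exact Finset.sum_le_sum fun j _ => (hvar j).1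
  · have h1 := hR.sq_credibleRadius_mul_le hk hC hG hγ hρ
    rw [div_mul_eq_mul_div, le_div_iff₀ hγ0]
    refine h1.trans ?_
    calc _ ≤ ∑' j, 3 / 2 * approxVar lam σ n m j :=
          (IsReweighting.summable_postVar hk _).tsum_le_tsum (fun j => (hvar j).2)
            ((summable_approxVar hlam hk.summable σ n m).mul_left _)
      _ ≤ _ := by
          rw [tsum_mul_left, mul_assoc]
          exact mul_le_mul_of_nonneg_left
            (tsum_approxVar_le ha hA hσ hlam hk.summable hle hn hm) (by norm_num)

/-- The squared error of the variational posterior mean is equivalent to the sum of the squared bias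
and of a stochastic term. -/
lemma exists_sq_error (hn : 0 < n) {x : Fin n → X} {y : Fin n → ℝ} {Q : Measure Ω}
    (hQ : IsVariationalPosterior μ φ P σ G m x y Q) (hE : gramError φ m x ≤ 1 / 16) {f₀ : X → ℝ}
    (hf : MemLp f₀ 2 μ) :
    ∃ δ : ℝ, eLpNorm (fun t => meanFunction G Q t - f₀ t) 2 μ = ENNReal.ofReal (Real.sqrt δ) ∧
      δ ≤ 8 * stochError φ lam σ (coeff μ φ f₀) m x y
        + 8 * ∑' j, biasTerm lam σ n m (coeff μ φ f₀) j ^ 2 ∧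
      ∑' j, biasTerm lam σ n m (coeff μ φ f₀) j ^ 2
        ≤ 6 * δ + 2 * stochError φ lam σ (coeff μ φ f₀) m x y := by
  obtain ⟨v, hv⟩ := exists_normal_equation (m := m) (φ := φ) hlam σ x y
  have hR := isReweighting_of_isVariationalPosterior hk hC hG hlam hσ hQ hv
  set θ := coeff μ φ f₀ with hθ
  have hmean : meanFunction G Q = fun t => ∑ j : Fin m, v j * φ j t :=
    funext (hR.meanFunction_eq hk hC hG)
  have hs := memLp_sum hk.basis v.ofLp
  have hd : MemLp (fun t => meanFunction G Q t - f₀ t) 2 μ := by rw [hmean]; exact hs.sub hf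
  have hθs : Summable fun j => θ j ^ 2 := (hk.basis.hasSum_coeff_sq hf).summable
  have h1 : ∫ t, (meanFunction G Q t - f₀ t) ^ 2 ∂μ
      = ∑ j : Fin m, (v j - θ j) ^ 2 + ∑' j, θ (j + m) ^ 2 := by
    have h2 := hk.basis.hasSum_coeff_sq hd
    rw [← h2.tsum_eq, ← h2.summable.sum_add_tsum_nat_add m, ← Fin.sum_univ_eq_sum_range
      (fun j => coeff μ φ (fun t => meanFunction G Q t - f₀ t) j ^ 2)]
    have h3 : ∀ j, coeff μ φ (fun t => meanFunction G Q t - f₀ t) j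
        = (if hj : j < m then v ⟨j, hj⟩ else 0) - θ j := fun j => by
      rw [hmean, coeff_sub hk.basis.memLp hs hf, coeff_sum hk.basis]
    congr 1
    · refine Finset.sum_congr rfl fun j _ => ?_
      rw [h3, dif_pos j.2]
    · refine tsum_congr fun j => ?_
      rw [h3, dif_neg (by omega), zero_sub, neg_sq]
  have h4 : ∑' j, biasTerm lam σ n m θ j ^ 2
      = ∑ j : Fin m, (shrunkVar lam σ n j * (lam j)⁻¹ * θ j) ^ 2 + ∑' j, θ (j + m) ^ 2 := by
    rw [← (summable_sq_biasTerm hlam hθs σ n m).sum_add_tsum_nat_add m,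
      ← Fin.sum_univ_eq_sum_range (fun j => biasTerm lam σ n m θ j ^ 2)]
    congr 1
    · exact Finset.sum_congr rfl fun j _ => by rw [biasTerm, if_pos j.2]
    · exact tsum_congr fun j => by rw [biasTerm, if_neg (by omega)]
  have h5 : 0 ≤ ∑' j, θ (j + m) ^ 2 := tsum_nonneg fun j => sq_nonneg _
  have h6 := sum_sq_error_le hlam hn θ hv hE
  have h7 := sum_sq_bias_le hlam hn θ hv hE
  refine ⟨_, eLpNorm_two_sq hd, ?_, ?_⟩
  · rw [h1, h4]; linarith
  · rw [h1, h4]; linarith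

end GoodDesign

/-! ### Probability of the exceptional event -/

section Exceptional

variable {X : Type*} [MeasurableSpace X] {μ : Measure X} [IsProbabilityMeasure μ]
  {φ : ℕ → X → ℝ} {lam : ℕ → ℝ} {C σ : ℝ} {f₀ : X → ℝ} {n : ℕ}

lemma measure_gramError_gt_le (hb : IsOrthonormalBasisL2 μ φ) (hC : ∀ j t, |φ j t| ≤ C)
    (hf : MemLp f₀ 2 μ) (σ : ℝ) (m : ℕ) (hn : 0 < n) :
    dataLaw μ σ f₀ n {p | ¬ gramError φ m p.1 ≤ 1 / 16}
      ≤ ENNReal.ofReal (16 * ((m : ℝ) ^ 2 * C ^ 4 / n)) := by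
  have hmeas : Measurable fun x : Fin n → X => ENNReal.ofReal (gramError φ m x) :=
    (measurable_gramError hb.1 m n).ennreal_ofReal
  have h1 := mul_meas_ge_le_lintegral (μ := dataLaw μ σ f₀ n) (hmeas.comp measurable_fst)
    (ENNReal.ofReal (1 / 16))
  simp only [Function.comp_apply] at h1
  rw [lintegral_fst_dataLaw hf.1.aemeasurable hmeas] at h1
  replace h1 := h1.trans (lintegral_gramError_le hb hC m hn)
  have h2 : dataLaw μ σ f₀ n {p | ¬ gramError φ m p.1 ≤ 1 / 16}
      ≤ dataLaw μ σ f₀ n {p | ENNReal.ofReal (1 / 16) ≤ ENNReal.ofReal (gramError φ m p.1)} :=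
    measure_mono fun p hp => ENNReal.ofReal_le_ofReal (not_le.1 hp).le
  calc _ ≤ _ := h2
    _ = ENNReal.ofReal 16 * (ENNReal.ofReal (1 / 16) * dataLaw μ σ f₀ n
          {p | ENNReal.ofReal (1 / 16) ≤ ENNReal.ofReal (gramError φ m p.1)}) := by
        rw [← mul_assoc, ← ENNReal.ofReal_mul (by norm_num)]
        norm_num
    _ ≤ ENNReal.ofReal 16 * ENNReal.ofReal ((m : ℝ) ^ 2 * C ^ 4 / n) := by gcongr
    _ = _ := by rw [← ENNReal.ofReal_mul (by norm_num)]

lemma measure_exceptional_le (hb : IsOrthonormalBasisL2 μ φ) (hC : ∀ j t, |φ j t| ≤ C)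
    (hlam : ∀ j, 0 < lam j) (hf : MemLp f₀ 2 μ) (hσ : 0 < σ) (m : ℕ) (hn : 0 < n) {B L : ℝ}
    (hB : 0 < B) (hL : 0 < L) (hle : 2 * C ^ 2 * (∫ t, f₀ t ^ 2 ∂μ + σ ^ 2) * (σ ^ 2)⁻¹ *
      ∑ j : Fin m, shrunkVar lam σ n j ≤ B) :
    dataLaw μ σ f₀ n {p | ¬ (gramError φ m p.1 ≤ 1 / 16 ∧
      stochError φ lam σ (coeff μ φ f₀) m p.1 p.2 ≤ L * B)}
      ≤ ENNReal.ofReal (16 * ((m : ℝ) ^ 2 * C ^ 4 / n)) + ENNReal.ofReal (1 / L) := by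
  have h1 : {p : (Fin n → X) × (Fin n → ℝ) | ¬ (gramError φ m p.1 ≤ 1 / 16 ∧
      stochError φ lam σ (coeff μ φ f₀) m p.1 p.2 ≤ L * B)}
      ⊆ {p | ¬ gramError φ m p.1 ≤ 1 / 16} ∪ {p | ENNReal.ofReal (L * B)
        ≤ ENNReal.ofReal (stochError φ lam σ (coeff μ φ f₀) m p.1 p.2)} := by
    intro p hp
    by_cases h : gramError φ m p.1 ≤ 1 / 16
    · exact Or.inr (ENNReal.ofReal_le_ofReal (not_le.1 fun h' => hp ⟨h, h'⟩).le)
    · exact Or.inl h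
  refine (measure_mono h1).trans ((measure_union_le _ _).trans
    (add_le_add (measure_gramError_gt_le hb hC hf σ m hn) ?_))
  have h2 := mul_meas_ge_le_lintegral (μ := dataLaw μ σ f₀ n)
    (measurable_stochError hb.1 lam σ (coeff μ φ f₀) m n).ennreal_ofReal (ENNReal.ofReal (L * B))
  replace h2 := h2.trans ((lintegral_stochError_le hb hC hlam hf hσ m n).trans
    (ENNReal.ofReal_le_ofReal hle))
  calc _ = ENNReal.ofReal (1 / (L * B)) * (ENNReal.ofReal (L * B) * dataLaw μ σ f₀ n
          {p | ENNReal.ofReal (L * B)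
            ≤ ENNReal.ofReal (stochError φ lam σ (coeff μ φ f₀) m p.1 p.2)}) := by
        rw [← mul_assoc, ← ENNReal.ofReal_mul (by positivity),
          one_div_mul_cancel (by positivity), ENNReal.ofReal_one, one_mul]
    _ ≤ ENNReal.ofReal (1 / (L * B)) * ENNReal.ofReal B := by gcongr
    _ = _ := by
        rw [← ENNReal.ofReal_mul (by positivity)]
        congr 1
        field_simp

end Exceptional

/-! ### Limits of probabilities -/

section Limits

lemma tendsto_zero_of_forall_eventually_le {q : ℕ → ℝ≥0∞} {ε : ℕ → ℝ}
    (hε : Tendsto ε atTop (𝓝 0)) (h : ∀ L : ℝ, 0 < L →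
      ∀ᶠ n in atTop, q n ≤ ENNReal.ofReal (ε n) + ENNReal.ofReal (1 / L)) :
    Tendsto q atTop (𝓝 0) := by
  rw [ENNReal.tendsto_nhds_zero]
  intro δ hδ
  obtain ⟨η, hη0, hη⟩ := ENNReal.lt_iff_exists_nnreal_btwn.1 hδ
  have hη' : (0 : ℝ) < η := by exact_mod_cast hη0
  filter_upwards [h (2 / η) (by positivity), hε.eventually_le_const (half_pos hη')] with n h1 h2
  calc q n ≤ _ := h1
    _ ≤ ENNReal.ofReal (η / 2) + ENNReal.ofReal (1 / (2 / η)) := by gcongr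
    _ = ENNReal.ofReal η := by
        rw [← ENNReal.ofReal_add (by positivity) (by positivity)]
        congr 1
        field_simp
        norm_num
    _ ≤ δ := by rw [ENNReal.ofReal_coe_nnreal]; exact hη.le

lemma tendsto_one_of_forall_eventually_le {q : ℕ → ℝ≥0∞} {ε : ℕ → ℝ} (hq : ∀ᶠ n in atTop, q n ≤ 1)
    (hε : Tendsto ε atTop (𝓝 0)) (h : ∀ L : ℝ, 0 < L →
      ∀ᶠ n in atTop, 1 ≤ q n + (ENNReal.ofReal (ε n) + ENNReal.ofReal (1 / L))) :
    Tendsto q atTop (𝓝 1) := by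
  have h1 : Tendsto (fun n => 1 - q n) atTop (𝓝 0) :=
    tendsto_zero_of_forall_eventually_le hε fun L hL => by
      filter_upwards [h L hL] with n hn
      exact tsub_le_iff_left.2 hn
  have h2 := ENNReal.Tendsto.sub (tendsto_const_nhds (x := (1 : ℝ≥0∞)) (f := atTop)) h1
    (Or.inl ENNReal.one_ne_top)
  rw [tsub_zero] at h2
  refine h2.congr' ?_
  filter_upwards [hq] with n hn
  exact ENNReal.sub_sub_cancel ENNReal.one_ne_top hn

lemma one_le_measure_add {α : Type*} [MeasurableSpace α] (ν : Measure α) [IsProbabilityMeasure ν]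
    {E B : Set α} (h : Bᶜ ⊆ E) : 1 ≤ ν E + ν B := by
  rw [← measure_univ (μ := ν)]
  refine (measure_mono fun x _ => ?_).trans (measure_union_le E B)
  by_cases hx : x ∈ B
  exacts [Or.inr hx, Or.inl (h hx)]

end Limits

/-! ### Limits of the number of inducing variables -/

section Growth

variable {m : ℕ → ℕ} {r D : ℝ}

lemma tendsto_cast_rpow_div {p : ℝ} (hp : 0 < p) (hrp : r * p < 1) (hD : 0 < D)
    (hmU : ∀ n : ℕ, 0 < n → (m n : ℝ) ≤ D * (n : ℝ) ^ r) :
    Tendsto (fun n => (m n : ℝ) ^ p / n) atTop (𝓝 0) := by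
  have h1 : Tendsto (fun n : ℕ => D ^ p * (n : ℝ) ^ (-(1 - r * p))) atTop (𝓝 (D ^ p * 0)) :=
    ((tendsto_rpow_neg_atTop (by linarith)).comp tendsto_natCast_atTop_atTop).const_mul _
  rw [mul_zero] at h1
  refine squeeze_zero' (Eventually.of_forall fun n => by positivity) ?_ h1
  filter_upwards [eventually_gt_atTop 0] with n hn
  have hn' : (0 : ℝ) < n := by exact_mod_cast hn
  rw [div_le_iff₀ hn']
  calc (m n : ℝ) ^ p ≤ (D * (n : ℝ) ^ r) ^ p :=
        Real.rpow_le_rpow (Nat.cast_nonneg _) (hmU n hn) hp.le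
    _ = D ^ p * ((n : ℝ) ^ (-(1 - r * p)) * (n : ℝ) ^ (1 : ℝ)) := by
        rw [Real.mul_rpow hD.le (by positivity), ← Real.rpow_mul hn'.le, ← Real.rpow_add hn']
        congr 2
        ring
    _ = _ := by rw [Real.rpow_one, mul_assoc]

lemma tendsto_cast_atTop (hr : 0 < r) (hD : 0 < D)
    (hmL : ∀ n : ℕ, 0 < n → (n : ℝ) ^ r ≤ D * m n) : Tendsto (fun n => (m n : ℝ)) atTop atTop := by
  have h1 : Tendsto (fun n : ℕ => D⁻¹ * (n : ℝ) ^ r) atTop atTop :=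
    ((tendsto_rpow_atTop hr).comp tendsto_natCast_atTop_atTop).const_mul_atTop (inv_pos.2 hD)
  refine tendsto_atTop_mono' _ ?_ h1
  filter_upwards [eventually_gt_atTop 0] with n hn
  rw [inv_mul_le_iff₀ hD]
  exact hmL n hn

lemma pos_of_rpow_le (hmL : ∀ n : ℕ, 0 < n → (n : ℝ) ^ r ≤ D * m n) {n : ℕ} (hn : 0 < n) :
    0 < m n := by
  refine Nat.pos_of_ne_zero fun h => ?_
  have h1 := hmL n hn
  rw [h, Nat.cast_zero, mul_zero] at h1
  exact absurd (Real.rpow_pos_of_pos (by exact_mod_cast hn : (0 : ℝ) < n) r) (not_lt.2 h1)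

lemma tendsto_effectiveDim {a : ℝ} (ha : 0 < a) (hm : Tendsto (fun n => (m n : ℝ)) atTop atTop) :
    Tendsto (fun n => (effectiveDim a n (m n) : ℝ)) atTop atTop := by
  have h1 : Tendsto (fun n : ℕ => (n : ℝ) ^ (1 / (1 + 2 * a))) atTop atTop :=
    (tendsto_rpow_atTop (by positivity)).comp tendsto_natCast_atTop_atTop
  refine tendsto_atTop.2 fun B => ?_
  filter_upwards [hm.eventually_ge_atTop B, h1.eventually_ge_atTop B] with n h2 h3
  rw [effectiveDim, Nat.cast_min]
  exact le_min h2 (h3.trans (Nat.le_ceil _))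

end Growth

/-! ### Coverage and size of the credible balls -/

section Coverage

variable {X : Type*} [MeasurableSpace X] {μ : Measure X} [IsProbabilityMeasure μ]
  {φ : ℕ → X → ℝ} {k : X → X → ℝ} {lam : ℕ → ℝ} {a b A C D σ γ r : ℝ}
  {Ω : Type*} [MeasurableSpace Ω] [StandardBorelSpace Ω] [Nonempty Ω] {P : Measure Ω}
  [IsProbabilityMeasure P] {G : X → Ω → ℝ} {m : ℕ → ℕ}
  {Ψ : (n : ℕ) → (Fin n → X) → (Fin n → ℝ) → Measure Ω}
  {ρ : (n : ℕ) → (Fin n → X) → (Fin n → ℝ) → ℝ} {f₀ : X → ℝ}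

variable (hk : IsMercerDecomposition μ k lam φ) (hC : ∀ j t, |φ j t| ≤ C) (hC0 : 0 < C)
  (hG : IsGPPrior P k G) (ha : 0 < a) (hA : 0 < A) (hσ : 0 < σ) (hlam : ∀ j, 0 < lam j)
  (hle : ∀ j, lam j ≤ A * ((j + 1 : ℕ) : ℝ) ^ (-1 - 2 * a))
  (hge : ∀ j, ((j + 1 : ℕ) : ℝ) ^ (-1 - 2 * a) ≤ A * lam j)
  (hr : r ∈ Set.Ioo (0 : ℝ) (1 / 2)) (hD : 0 < D)
  (hmU : ∀ n : ℕ, 0 < n → (m n : ℝ) ≤ D * (n : ℝ) ^ r)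
  (hmL : ∀ n : ℕ, 0 < n → (n : ℝ) ^ r ≤ D * m n)
  (hΨ : ∀ n x y, IsVariationalPosterior μ φ P σ G (m n) x y (Ψ n x y))
  (hγ : γ ∈ Set.Ioo (0 : ℝ) 1) (hρ : ∀ n x y, IsCredibleRadius μ G (Ψ n x y) γ (ρ n x y))

lemma tendsto_measure_gramError (C : ℝ) (hr : r ∈ Set.Ioo (0 : ℝ) (1 / 2)) (hD : 0 < D)
    (hmU : ∀ n : ℕ, 0 < n → (m n : ℝ) ≤ D * (n : ℝ) ^ r) :
    Tendsto (fun n => 16 * ((m n : ℝ) ^ 2 * C ^ 4 / n)) atTop (𝓝 0) := by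
  have h := (tendsto_cast_rpow_div (p := 2) (by norm_num) (by linarith [hr.2]) hD hmU).const_mul
    (16 * C ^ 4)
  rw [mul_zero] at h
  refine h.congr fun n => ?_
  rw [Real.rpow_two]
  ring

lemma mem_coverageEvent_iff {n : ℕ} {p : (Fin n → X) × (Fin n → ℝ)} {δ c : ℝ} (hc : 0 ≤ c)
    (hρ : ∀ n x y, IsCredibleRadius μ G (Ψ n x y) γ (ρ n x y))
    (hδ : eLpNorm (fun t => meanFunction G (Ψ n p.1 p.2) t - f₀ t) 2 μ
      = ENNReal.ofReal (Real.sqrt δ)) :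
    p ∈ coverageEvent μ G (Ψ n) (ρ n) f₀ c ↔ δ ≤ c ^ 2 * ρ n p.1 p.2 ^ 2 := by
  have h := mul_nonneg hc (hρ n p.1 p.2).1
  rw [coverageEvent, Set.mem_ofPred_eq, hδ, ENNReal.ofReal_le_ofReal_iff h, Real.sqrt_le_left h,
    mul_pow]

include hk hC hC0 hG ha hA hσ hlam hle hge hr hD hmU hmL hΨ hγ hρ

/-- Coverage of inflated credible balls, for regression functions as smooth as the prior. The
stochastic error, the bias and the radius are of the same order `effectiveDim ^ (-a)`. -/
lemma tendsto_coverage_inflated (hf : MemLp f₀ 2 μ)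
    (hθ : Summable fun j => ((j + 1 : ℕ) : ℝ) ^ (2 * a) * coeff μ φ f₀ j ^ 2) {M : ℕ → ℝ}
    (hM : Tendsto M atTop atTop) :
    Tendsto (fun n => dataLaw μ σ f₀ n (coverageEvent μ G (Ψ n) (ρ n) f₀ (M n))) atTop (𝓝 1) := by
  obtain ⟨c, C', hc, hC', hrad⟩ :=
    exists_sq_credibleRadius_bounds hk hC hG hlam hσ ha hA hle hge hγ
  have hθ0 : Summable fun j => coeff μ φ f₀ j ^ 2 := (hk.basis.hasSum_coeff_sq hf).summable
  have hI : 0 ≤ ∫ t, f₀ t ^ 2 ∂μ := integral_nonneg fun t => sq_nonneg _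
  refine tendsto_one_of_forall_eventually_le (Eventually.of_forall fun n => ?_)
    (tendsto_measure_gramError C hr hD hmU) fun L hL => ?_
  · have := isProbabilityMeasure_dataLaw hf.1.aemeasurable σ n
    exact prob_le_one
  set W := σ ^ 2 * 2 ^ (1 + 2 * a) + A * (2 * a)⁻¹ with hW
  set V := 2 * C ^ 2 * (∫ t, f₀ t ^ 2 ∂μ + σ ^ 2) * (σ ^ 2)⁻¹ with hV
  set N := ∑' j, ((j + 1 : ℕ) : ℝ) ^ (2 * a) * coeff μ φ f₀ j ^ 2 with hN
  have hV0 : 0 < V := by positivity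
  have hW0 : 0 < W := by positivity
  have hM2 : Tendsto (fun n => c * M n ^ 2) atTop atTop :=
    ((tendsto_pow_atTop two_ne_zero).comp hM).const_mul_atTop hc
  filter_upwards [eventually_gt_atTop 0, hM.eventually_ge_atTop 0, hM2.eventually_ge_atTop
    (8 * (L * (V * W)) + 8 * ((1 + σ ^ 2 * A * 2 ^ (1 + 2 * a)) * N))] with n hn hM0 hMn
  have hm := pos_of_rpow_le hmL hn
  have hK : (0 : ℝ) < effectiveDim a n (m n) := by exact_mod_cast effectiveDim_pos hn hm a
  set κ := (effectiveDim a n (m n) : ℝ) ^ (-(2 * a)) with hκ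
  have hκ0 : 0 < κ := Real.rpow_pos_of_pos hK _
  have hP := isProbabilityMeasure_dataLaw hf.1.aemeasurable σ n
  have hexc := measure_exceptional_le hk.basis hC hlam hf hσ (m n) hn (B := V * (W * κ)) (L := L)
    (by positivity) hL (mul_le_mul_of_nonneg_left
      ((sum_shrunkVar_le_tsum hlam hk.summable σ n (m n)).trans
        (tsum_approxVar_le ha hA hσ hlam hk.summable hle hn hm)) hV0.le)
  refine (one_le_measure_add (dataLaw μ σ f₀ n) ?_).trans (add_le_add le_rfl hexc)
  intro p hp
  rw [Set.mem_compl_iff, Set.mem_ofPred_eq, not_not] at hp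
  obtain ⟨hE, hS⟩ := hp
  obtain ⟨δ, hδ, hδ1, -⟩ := exists_sq_error hk hC hG hlam hσ hn (hΨ n p.1 p.2) hE hf
  rw [mem_coverageEvent_iff hM0 hρ hδ]
  have h1 := (hrad n (m n) hn hm p.1 p.2 _ _ (hΨ n p.1 p.2) (hρ n p.1 p.2) hE).1
  have h2 := tsum_sq_biasTerm_le ha hA hσ hlam hge hn hm hθ0 hθ
  calc δ ≤ 8 * (L * (V * (W * κ))) + 8 * ((1 + σ ^ 2 * A * 2 ^ (1 + 2 * a)) * N * κ) := by
        refine hδ1.trans ?_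
        gcongr
    _ = (8 * (L * (V * W)) + 8 * ((1 + σ ^ 2 * A * 2 ^ (1 + 2 * a)) * N)) * κ := by ring
    _ ≤ c * M n ^ 2 * κ := by gcongr
    _ = M n ^ 2 * (c * κ) := by ring
    _ ≤ _ := by gcongr

/-- Coverage without inflation. For few inducing variables and smooth regression functions, the
radius is at least of the order `m ^ (-a)`, which dominates both the stochastic error
`(m / n) ^ (1 / 2)` and the bias. -/
lemma tendsto_coverage (hab : a < b) (hra : r * (1 + 2 * a) < 1) (hf : MemLp f₀ 2 μ)
    (hθ : Summable fun j => ((j + 1 : ℕ) : ℝ) ^ (2 * b) * coeff μ φ f₀ j ^ 2) :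
    Tendsto (fun n => dataLaw μ σ f₀ n (coverageEvent μ G (Ψ n) (ρ n) f₀ 1)) atTop (𝓝 1) := by
  obtain ⟨c, C', hc, hC', hrad⟩ :=
    exists_sq_credibleRadius_bounds hk hC hG hlam hσ ha hA hle hge hγ
  have hθ0 : Summable fun j => coeff μ φ f₀ j ^ 2 := (hk.basis.hasSum_coeff_sq hf).summable
  have hI : 0 ≤ ∫ t, f₀ t ^ 2 ∂μ := integral_nonneg fun t => sq_nonneg _
  refine tendsto_one_of_forall_eventually_le (Eventually.of_forall fun n => ?_)
    (tendsto_measure_gramError C hr hD hmU) fun L hL => ?_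
  · have := isProbabilityMeasure_dataLaw hf.1.aemeasurable σ n
    exact prob_le_one
  set V := 2 * C ^ 2 * (∫ t, f₀ t ^ 2 ∂μ + σ ^ 2) * (σ ^ 2)⁻¹ with hV
  set N := ∑' j, ((j + 1 : ℕ) : ℝ) ^ (2 * b) * coeff μ φ f₀ j ^ 2 with hN
  have hV0 : 0 < V := by positivity
  have hlim1 := (tendsto_cast_rpow_div (p := 1 + 2 * a) (by positivity) hra hD hmU).const_mul
    (8 * (L * (V * σ ^ 2)) + 8 * (σ ^ 2 * A * N))
  have hlim2 := ((tendsto_rpow_neg_atTop (y := 2 * (b - a)) (by linarith)).comp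
    (tendsto_cast_atTop hr.1 hD hmL)).const_mul (8 * N)
  have hlim := hlim1.add hlim2
  rw [mul_zero, mul_zero, add_zero] at hlim
  filter_upwards [eventually_gt_atTop 0, hlim.eventually_le_const hc] with n hn hlt
  have hm := pos_of_rpow_le hmL hn
  have hm' : (0 : ℝ) < m n := by exact_mod_cast hm
  have hn' : (0 : ℝ) < n := by exact_mod_cast hn
  have hP := isProbabilityMeasure_dataLaw hf.1.aemeasurable σ n
  have hexc := measure_exceptional_le hk.basis hC hlam hf hσ (m n) hn
    (B := V * (σ ^ 2 * (m n / n))) (L := L) (by positivity) hL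
    (mul_le_mul_of_nonneg_left (sum_shrunkVar_le hlam hσ hn (m n)) hV0.le)
  refine (one_le_measure_add (dataLaw μ σ f₀ n) ?_).trans (add_le_add le_rfl hexc)
  intro p hp
  rw [Set.mem_compl_iff, Set.mem_ofPred_eq, not_not] at hp
  obtain ⟨hE, hS⟩ := hp
  obtain ⟨δ, hδ, hδ1, -⟩ := exists_sq_error hk hC hG hlam hσ hn (hΨ n p.1 p.2) hE hf
  rw [mem_coverageEvent_iff zero_le_one hρ hδ, one_pow, one_mul]
  have h1 := (hrad n (m n) hn hm p.1 p.2 _ _ (hΨ n p.1 p.2) (hρ n p.1 p.2) hE).1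
  have h2 := tsum_sq_biasTerm_le_add (ha.trans hab) hab.le hA hσ hlam hge hn hm hθ0 hθ
  have h3 : (m n : ℝ) ^ (-(2 * a)) ≤ (effectiveDim a n (m n) : ℝ) ^ (-(2 * a)) :=
    Real.rpow_le_rpow_of_nonpos (by exact_mod_cast effectiveDim_pos hn hm a)
      (by exact_mod_cast min_le_left _ _) (by linarith)
  have h4 : 0 < (m n : ℝ) ^ (2 * a) := Real.rpow_pos_of_pos hm' _
  have e1 : (m n : ℝ) ^ (1 + 2 * a) = m n * (m n : ℝ) ^ (2 * a) := by
    rw [Real.rpow_add hm', Real.rpow_one]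
  have e2 : (m n : ℝ) ^ (-(2 * (b - a))) = (m n : ℝ) ^ (-(2 * b)) * (m n : ℝ) ^ (2 * a) := by
    rw [← Real.rpow_add hm']; congr 1; ring
  simp only [Function.comp_apply] at hlt
  rw [e1, e2] at hlt
  calc δ ≤ 8 * (L * (V * (σ ^ 2 * (m n / n))))
        + 8 * ((σ ^ 2 * A * (m n / n) + (m n : ℝ) ^ (-(2 * b))) * N) := by
        refine hδ1.trans ?_
        gcongr
    _ = ((8 * (L * (V * σ ^ 2)) + 8 * (σ ^ 2 * A * N)) * (m n * (m n : ℝ) ^ (2 * a) / n)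
        + 8 * N * ((m n : ℝ) ^ (-(2 * b)) * (m n : ℝ) ^ (2 * a))) * (m n : ℝ) ^ (-(2 * a)) := by
        rw [Real.rpow_neg hm'.le (2 * a)]
        field_simp
        ring
    _ ≤ c * (m n : ℝ) ^ (-(2 * a)) := by gcongr
    _ ≤ c * (effectiveDim a n (m n) : ℝ) ^ (-(2 * a)) := by gcongr
    _ ≤ _ := h1

/-- Failure of coverage for a regression function that is rougher than the prior: its bias, of the
order `effectiveDim ^ (-b)`, exceeds the radius. -/
lemma tendsto_coverage_zero (hb : 0 < b) (hba : b < a) (hf : MemLp f₀ 2 μ)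
    (hθ : ∀ j, coeff μ φ f₀ j ^ 2 = ((j + 1 : ℕ) : ℝ) ^ (-(1 + 2 * b))) {M : ℝ} (hM : 0 < M) :
    Tendsto (fun n => dataLaw μ σ f₀ n (coverageEvent μ G (Ψ n) (ρ n) f₀ M)) atTop (𝓝 0) := by
  obtain ⟨c, C', hc, hC', hrad⟩ :=
    exists_sq_credibleRadius_bounds hk hC hG hlam hσ ha hA hle hge hγ
  have hθ0 : Summable fun j => coeff μ φ f₀ j ^ 2 := (hk.basis.hasSum_coeff_sq hf).summable
  have hI : 0 ≤ ∫ t, f₀ t ^ 2 ∂μ := integral_nonneg fun t => sq_nonneg _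
  refine tendsto_zero_of_forall_eventually_le (tendsto_measure_gramError C hr hD hmU) fun L hL => ?_
  set W := σ ^ 2 * 2 ^ (1 + 2 * a) + A * (2 * a)⁻¹ with hW
  set V := 2 * C ^ 2 * (∫ t, f₀ t ^ 2 ∂μ + σ ^ 2) * (σ ^ 2)⁻¹ with hV
  set c' := ((1 + A * (σ ^ 2)⁻¹) ^ 2)⁻¹ * (2 ^ (1 + 2 * b))⁻¹ with hc'
  have hV0 : 0 < V := by positivity
  have hW0 : 0 < W := by positivity
  have hc0 : 0 < c' := by positivity
  have hlim := ((tendsto_rpow_neg_atTop (y := 2 * (a - b)) (by linarith)).comp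
    (tendsto_effectiveDim ha (tendsto_cast_atTop hr.1 hD hmL))).const_mul
      (6 * (M ^ 2 * C') + 2 * (L * (V * W)))
  rw [mul_zero] at hlim
  filter_upwards [eventually_gt_atTop 0, hlim.eventually_lt_const hc0] with n hn hlt
  have hm := pos_of_rpow_le hmL hn
  have hK : (0 : ℝ) < effectiveDim a n (m n) := by exact_mod_cast effectiveDim_pos hn hm a
  set κ := (effectiveDim a n (m n) : ℝ) ^ (-(2 * a)) with hκ
  have hκ0 : 0 < κ := Real.rpow_pos_of_pos hK _
  have hexc := measure_exceptional_le hk.basis hC hlam hf hσ (m n) hn (B := V * (W * κ)) (L := L)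
    (by positivity) hL (mul_le_mul_of_nonneg_left
      ((sum_shrunkVar_le_tsum hlam hk.summable σ n (m n)).trans
        (tsum_approxVar_le ha hA hσ hlam hk.summable hle hn hm)) hV0.le)
  refine (measure_mono fun p hp => ?_).trans hexc
  rw [Set.mem_ofPred_eq]
  rintro ⟨hE, hS⟩
  obtain ⟨δ, hδ, -, hδ2⟩ := exists_sq_error hk hC hG hlam hσ hn (hΨ n p.1 p.2) hE hf
  rw [mem_coverageEvent_iff hM.le hρ hδ] at hp
  have h1 := (hrad n (m n) hn hm p.1 p.2 _ _ (hΨ n p.1 p.2) (hρ n p.1 p.2) hE).2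
  have h2 := le_tsum_sq_biasTerm hb ha hA hσ hlam hle hn hm hθ0 hθ
  have h3 : (effectiveDim a n (m n) : ℝ) ^ (-(2 * (a - b)))
      = κ * (effectiveDim a n (m n) : ℝ) ^ (2 * b) := by
    rw [hκ, ← Real.rpow_add hK]; congr 1; ring
  simp only [Function.comp_apply] at hlt
  rw [h3] at hlt
  have h4 : 0 < (effectiveDim a n (m n) : ℝ) ^ (2 * b) := Real.rpow_pos_of_pos hK _
  have h5 : c' * (effectiveDim a n (m n) : ℝ) ^ (-(2 * b))
      ≤ (6 * (M ^ 2 * C') + 2 * (L * (V * W))) * κ := by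
    calc _ ≤ _ := h2
      _ ≤ _ := hδ2
      _ ≤ 6 * (M ^ 2 * (C' * κ)) + 2 * (L * (V * (W * κ))) := by
          have h6 : δ ≤ M ^ 2 * (C' * κ) := hp.trans (by gcongr)
          gcongr
      _ = _ := by ring
  rw [Real.rpow_neg hK.le, ← div_eq_mul_inv, div_le_iff₀ h4] at h5
  linarith

/-- The radius is of the optimal order, uniformly in the regression function: the law of the design,
which determines the order of the radius, does not depend on it. -/
lemma exists_tendsto_radius (hmn : ∀ᶠ n : ℕ in atTop, (n : ℝ) ^ (1 / (1 + 2 * a)) ≤ m n)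
    (F : Set (X → ℝ)) (hF : ∀ f ∈ F, MemLp f 2 μ) (hF0 : F.Nonempty) :
    ∃ C' : ℝ, 0 < C' ∧ Tendsto (fun n => ⨅ f ∈ F, dataLaw μ σ f n
      {p | ρ n p.1 p.2 ≤ C' * (n : ℝ) ^ (-a / (1 + 2 * a))}) atTop (𝓝 1) := by
  obtain ⟨c, C', hc, hC', hrad⟩ :=
    exists_sq_credibleRadius_bounds hk hC hG hlam hσ ha hA hle hge hγ
  refine ⟨Real.sqrt C', Real.sqrt_pos.2 hC', ?_⟩
  refine tendsto_one_of_forall_eventually_le (Eventually.of_forall fun n => ?_)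
    (tendsto_measure_gramError C hr hD hmU) fun L hL => ?_
  · obtain ⟨f, hf⟩ := hF0
    have := isProbabilityMeasure_dataLaw (hF f hf).1.aemeasurable σ n
    exact (iInf₂_le f hf).trans prob_le_one
  filter_upwards [eventually_gt_atTop 0, hmn] with n hn hmn
  have hm := pos_of_rpow_le hmL hn
  have hn' : (0 : ℝ) < n := by exact_mod_cast hn
  rw [← tsub_le_iff_right]
  refine le_iInf₂ fun f hf => ?_
  rw [tsub_le_iff_right]
  have hP := isProbabilityMeasure_dataLaw (hF f hf).1.aemeasurable σ n
  refine (one_le_measure_add (dataLaw μ σ f n) ?_).trans (add_le_add le_rfl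
    ((measure_gramError_gt_le hk.basis hC (hF f hf) σ (m n) hn).trans le_self_add))
  intro p hp
  rw [Set.mem_compl_iff, Set.mem_ofPred_eq, not_not] at hp
  have h1 := (hrad n (m n) hn hm p.1 p.2 _ _ (hΨ n p.1 p.2) (hρ n p.1 p.2) hp).2
  have h2 : (n : ℝ) ^ (1 / (1 + 2 * a)) ≤ effectiveDim a n (m n) := by
    rw [effectiveDim, Nat.cast_min]
    exact le_min hmn (Nat.le_ceil _)
  have h3 : (effectiveDim a n (m n) : ℝ) ^ (-(2 * a)) ≤ ((n : ℝ) ^ (-a / (1 + 2 * a))) ^ 2 := by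
    calc _ ≤ ((n : ℝ) ^ (1 / (1 + 2 * a))) ^ (-(2 * a)) :=
          Real.rpow_le_rpow_of_nonpos (by positivity) h2 (by linarith)
      _ = _ := by
          rw [← Real.rpow_natCast, ← Real.rpow_mul hn'.le, ← Real.rpow_mul hn'.le]
          congr 1
          push_cast
          ring
  rw [Set.mem_ofPred_eq]
  refine le_of_sq_le_sq ?_ (by positivity)
  rw [mul_pow, Real.sq_sqrt hC'.le]
  exact h1.trans (by gcongr)

end Coverage

/-! ### Sobolev spaces -/

section Sobolev

variable {X : Type*} [MeasurableSpace X] {μ : Measure X} [IsProbabilityMeasure μ]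
  {φ : ℕ → X → ℝ} {d : ℕ} {β : ℝ} {f : X → ℝ}

lemma sobolevNorm_lt_top_iff : sobolevNorm μ φ d β f < ∞ ↔
    Summable fun j : ℕ => ((j + 1 : ℕ) : ℝ) ^ (2 * (β / d)) * coeff μ φ f j ^ 2 := by
  have h0 : ∀ j : ℕ, 0 ≤ ((j + 1 : ℕ) : ℝ) ^ (2 * (β / d)) * coeff μ φ f j ^ 2 := fun j => by
    positivity
  rw [sobolevNorm, ENNReal.rpow_lt_top_iff_of_pos (by norm_num), lt_top_iff_ne_top]
  simp_rw [mul_div_assoc]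
  constructor
  · intro h
    exact (ENNReal.summable_toReal h).congr fun j => ENNReal.toReal_ofReal (h0 j)
  · intro h
    exact h.tsum_ofReal_ne_top

/-- Every square-summable sequence is the sequence of coefficients of a function. -/
lemma IsOrthonormalBasisL2.exists_coeff_eq (h : IsOrthonormalBasisL2 μ φ) {θ : ℕ → ℝ}
    (hθ : Summable fun j => θ j ^ 2) : ∃ f : X → ℝ, MemLp f 2 μ ∧ ∀ j, coeff μ φ f j = θ j := by
  obtain ⟨b, hb⟩ := h.2
  have hmem : Memℓp θ 2 := by
    refine memℓp_gen ?_
    simpa using hθ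
  set g : Lp ℝ 2 μ := b.repr.symm ⟨θ, hmem⟩ with hg
  refine ⟨g, Lp.memLp g, fun j => ?_⟩
  have h1 : b.repr g j = θ j := by rw [hg, LinearIsometryEquiv.apply_symm_apply]
  rw [← h1, b.repr_apply_apply, L2.inner_def, coeff]
  refine integral_congr_ae ?_
  filter_upwards [hb j] with t ht
  simp [ht]

end Sobolev

end SparseGP

theorem corollary5p2
    -- the domain, the design distribution and the noise level
    {d : ℕ} (hd : 0 < d) (X : Set (EuclideanSpace ℝ (Fin d)))
    (μ : Measure X) [IsProbabilityMeasure μ] (σ : ℝ) (hσ : 0 < σ)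
    -- the kernel, with polynomial eigenvalues and uniformly bounded eigenfunctions
    (k : X → X → ℝ) (lam : ℕ → ℝ) (φ : ℕ → X → ℝ)
    (hk : SparseGP.IsMercerDecomposition μ k lam φ)
    (hφ : ∃ C : ℝ, ∀ j t, |φ j t| ≤ C)
    (α β : ℝ) (hα : 0 < α) (hβ : 0 < β)
    (hlam : SparseGP.AsympEq lam fun j => ((j + 1 : ℕ) : ℝ) ^ (-1 - 2 * α / d))
    -- the Gaussian process prior
    {Ω : Type*} [MeasurableSpace Ω] [StandardBorelSpace Ω] [Nonempty Ω]
    (P : Measure Ω) [IsProbabilityMeasure P] (G : X → Ω → ℝ) (hG : SparseGP.IsGPPrior P k G)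
    -- the number of inducing variables
    (m : ℕ → ℕ) (r : ℝ) (hr : r ∈ Set.Ioo (0 : ℝ) (1 / 2))
    (hm : SparseGP.AsympEq (fun n => (m (n + 1) : ℝ)) fun n => ((n + 1 : ℕ) : ℝ) ^ r)
    -- the variational posteriors and the radii of their credible balls
    (Ψ : (n : ℕ) → (Fin n → X) → (Fin n → ℝ) → Measure Ω)
    (hΨ : ∀ n x y, SparseGP.IsVariationalPosterior μ φ P σ G (m n) x y (Ψ n x y))
    (γ : ℝ) (hγ : γ ∈ Set.Ioo (0 : ℝ) 1)
    (ρ : (n : ℕ) → (Fin n → X) → (Fin n → ℝ) → ℝ)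
    (hρ : ∀ n x y, SparseGP.IsCredibleRadius μ G (Ψ n x y) γ (ρ n x y)) :
    (α ≤ β →
      ∀ f₀ ∈ SparseGP.sobolevSpace μ φ d β, (∃ K : ℝ, ∀ᵐ t ∂μ, |f₀ t| ≤ K) →
      ∀ M : ℕ → ℝ, Tendsto M atTop atTop →
        Tendsto (fun n => SparseGP.dataLaw μ σ f₀ n
          (SparseGP.coverageEvent μ G (Ψ n) (ρ n) f₀ (M n))) atTop (𝓝 1)) ∧
    (α < β → r < d / (d + 2 * α) →
      ∀ f₀ ∈ SparseGP.sobolevSpace μ φ d β, (∃ K : ℝ, ∀ᵐ t ∂μ, |f₀ t| ≤ K) →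
        Tendsto (fun n => SparseGP.dataLaw μ σ f₀ n
          (SparseGP.coverageEvent μ G (Ψ n) (ρ n) f₀ 1)) atTop (𝓝 1)) ∧
    (β < α →
      ∃ f₀ ∈ SparseGP.sobolevSpace μ φ d β, ∀ M : ℝ, 0 < M →
        Tendsto (fun n => SparseGP.dataLaw μ σ f₀ n
          (SparseGP.coverageEvent μ G (Ψ n) (ρ n) f₀ M)) atTop (𝓝 0)) ∧
    (β = α → (∀ᶠ n : ℕ in atTop, (n : ℝ) ^ ((d : ℝ) / (d + 2 * α)) ≤ m n) →
      ∀ M : ℝ, 0 < M → ∃ C : ℝ, 0 < C ∧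
        Tendsto (fun n => ⨅ f₀ ∈ SparseGP.sobolevBall μ φ d β M,
          SparseGP.dataLaw μ σ f₀ n
            {p | ρ n p.1 p.2 ≤ C * (n : ℝ) ^ (-β / (d + 2 * β))}) atTop (𝓝 1)) := by
  obtain ⟨C₀, hC₀⟩ := hφ
  have hC : ∀ j t, |φ j t| ≤ max C₀ 1 := fun j t => (hC₀ j t).trans (le_max_left _ _)
  have hC0 : 0 < max C₀ 1 := lt_of_lt_of_le one_pos (le_max_right _ _)
  obtain ⟨A, hA, hlam⟩ := hlam
  obtain ⟨D, hD, hm⟩ := hm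
  have hd' : (0 : ℝ) < d := by exact_mod_cast hd
  have ha : 0 < α / d := by positivity
  have hle : ∀ j, lam j ≤ A * ((j + 1 : ℕ) : ℝ) ^ (-1 - 2 * (α / d)) := fun j => by
    rw [← mul_div_assoc]; exact (hlam j).1
  have hge : ∀ j, ((j + 1 : ℕ) : ℝ) ^ (-1 - 2 * (α / d)) ≤ A * lam j := fun j => by
    rw [← mul_div_assoc]; exact (hlam j).2
  have hpos : ∀ j, 0 < lam j := fun j =>
    pos_of_mul_pos_right ((Real.rpow_pos_of_pos (by positivity) _).trans_le (hge j)) hA.le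
  have hmU : ∀ n : ℕ, 0 < n → (m n : ℝ) ≤ D * (n : ℝ) ^ r := fun n hn => by
    obtain ⟨n, rfl⟩ := Nat.exists_eq_succ_of_ne_zero hn.ne'
    exact (hm n).1
  have hmL : ∀ n : ℕ, 0 < n → (n : ℝ) ^ r ≤ D * m n := fun n hn => by
    obtain ⟨n, rfl⟩ := Nat.exists_eq_succ_of_ne_zero hn.ne'
    exact (hm n).2
  have hexp : (d : ℝ) / (d + 2 * α) = 1 / (1 + 2 * (α / d)) := by field_simp
  refine ⟨fun hαβ f₀ hf _ M hM => ?_, fun hαβ hrd f₀ hf _ => ?_, fun hβα => ?_,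
    fun hβα hmn M hM => ?_⟩
  · refine SparseGP.tendsto_coverage_inflated hk hC hC0 hG ha hA hσ hpos hle hge hr hD hmU hmL hΨ hγ
      hρ hf.1 ?_ hM
    refine (SparseGP.sobolevNorm_lt_top_iff.1 hf.2).of_nonneg_of_le (fun j => by positivity)
      fun j => ?_
    have h1 : (1 : ℝ) ≤ ((j + 1 : ℕ) : ℝ) := by exact_mod_cast Nat.succ_pos j
    gcongr
  · refine SparseGP.tendsto_coverage hk hC hC0 hG ha hA hσ hpos hle hge hr hD hmU hmL hΨ hγ
      hρ (b := β / d) (by gcongr) ?_ hf.1 (SparseGP.sobolevNorm_lt_top_iff.1 hf.2)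
    rw [hexp, lt_div_iff₀ (by positivity)] at hrd
    exact hrd
  · -- a smoothness strictly between those of the Sobolev space and of the prior
    set b := (α / d + β / d) / 2 with hb
    have hba : β / d < α / d := by gcongr
    have hb0 : 0 < b := by positivity
    have hsum : ∀ p : ℝ, p < -1 → Summable fun j : ℕ => ((j + 1 : ℕ) : ℝ) ^ p := fun p hp =>
      (summable_nat_add_iff 1).2 (Real.summable_nat_rpow.2 hp)
    have hsq : ∀ j : ℕ, (((j + 1 : ℕ) : ℝ) ^ (-(1 + 2 * b) / 2)) ^ 2
        = ((j + 1 : ℕ) : ℝ) ^ (-(1 + 2 * b)) := fun j => by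
      rw [← Real.rpow_natCast, ← Real.rpow_mul (by positivity)]
      congr 1
      push_cast
      ring
    obtain ⟨f₀, hf, hcoeff⟩ := hk.basis.exists_coeff_eq
      (θ := fun j : ℕ => ((j + 1 : ℕ) : ℝ) ^ (-(1 + 2 * b) / 2)) (by
        simp_rw [hsq]
        exact hsum _ (by linarith))
    have hθ : ∀ j, SparseGP.coeff μ φ f₀ j ^ 2 = ((j + 1 : ℕ) : ℝ) ^ (-(1 + 2 * b)) := fun j => by
      rw [hcoeff, hsq]
    refine ⟨f₀, ⟨hf, SparseGP.sobolevNorm_lt_top_iff.2 ?_⟩, fun M hM => ?_⟩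
    · refine (hsum (2 * (β / d) + -(1 + 2 * b)) (by linarith)).congr fun j => ?_
      rw [hθ, Real.rpow_add (by positivity)]
    · exact SparseGP.tendsto_coverage_zero hk hC hC0 hG ha hA hσ hpos hle hge hr hD hmU hmL hΨ hγ
        hρ hb0 (by linarith) hf hθ hM
  · subst hβα
    obtain ⟨C', hC', h⟩ := SparseGP.exists_tendsto_radius hk hC hC0 hG ha hA hσ hpos hle hge hr hD
      hmU hmL hΨ hγ hρ (by rwa [hexp] at hmn) (SparseGP.sobolevBall μ φ d β M) (fun f hf => hf.1)
      ⟨fun _ => 0, MemLp.zero, by simp [SparseGP.sobolevNorm, SparseGP.coeff]⟩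
    refine ⟨C', hC', ?_⟩
    have he : -β / (d + 2 * β) = -(β / d) / (1 + 2 * (β / d)) := by field_simp
    rw [he]
    exact h
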